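/- Let $\mathcal H$ be a complex Hilbert space, $\mathcal H_1\subseteq\mathcal H$ a closed subspace and $\mathcal H_2=\mathcal H_1^{\perp}$, so that $\mathcal H=\mathcal H_1\oplus\mathcal H_2$. For a Hilbert space $\mathcal K$ let $\mathcal F_{\mathcal K}$ be the fermion Fock space over $\mathcal K$, with creators $a^\dagger_g$ and annihilators $a_g$ $(g\in\mathcal K)$, number operator $N=\sum_j a^\dagger_{f_j}a_{f_j}$ ($(f_j)$ an orthonormal basis of $\mathcal K$), and let $\mathcal D_{\mathcal K}$ be the set of density operators $\Delta$ on $\mathcal F_{\mathcal K}$ that commute with $N$ and satisfy $\mathrm{Tr}(\Delta N)<\infty$. For $\Delta\in\mathcal D_{\mathcal K}$ let $\gamma_\Delta$ be the $1$-particle statistical operator on $\mathcal K$, $\langle h|\gamma_\Delta g\rangle=\mathrm{Tr}(\Delta a^\dagger_g a_h)$. For a positive trace class operator $\gamma$ with spectrum in $[0,1]$, with eigenvalues $p_j$ and an orthonormal basis of corresponding eigenvectors $f_j$, let $$\Gamma_\gamma=\sum_{\mathbf s}\Big(\prod_{i\in\mathbf s}p_i\prod_{j\notin\mathbf s}(1-p_j)\Big)\,|f_{\mathbf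 s}\rangle\langle f_{\mathbf s}|$$ be the density operator of the free state with $1$-particle statistical operator $\gamma$; here $\mathbf s$ runs over the finite sets of indices and $f_{\mathbf s}$ is the Slater determinant of the $f_i$, $i\in\mathbf s$. The nonfreeness of $\Delta\in\mathcal D_{\mathcal K}$ is the relative entropy $$\mathfrak C(\Delta)=S(\Delta\,|\,\Gamma_{\gamma_\Delta})\in[0,\infty],\qquad S(X|Y)=\mathrm{Tr}\,X(\log X-\log Y),$$ with $S(X|Y)=+\infty$ if $\ker Y\not\subseteq\ker X$. Identify $\mathcal F_{\mathcal H}$ with $\mathcal F_{\mathcal H_1}\otimes\mathcal F_{\mathcal H_2}$ through the unitary map $(x_1\wedge\dots\wedge x_n)\otimes(y_1\wedge\dots\wedge y_m)\mapsto x_1\wedge\dots\wedge x_n\wedge y_1\wedge\dots\wedge y_m$ $(x_i\in\mathcal H_1,\ y_j\in\mathcal H_2)$. Let $\Delta_1\in\mathcal D_{\mathcal H_1}$ and $\Delta_2\in\mathcal D_{\mathcal H_2}$. Then the product state $\Delta_1\otimes\Delta_2$ belongs to $\mathcal D_{\mathcal H}$; with $\gamma_i=\gamma_{\Delta_i}$,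 $$\Gamma_{\gamma_1\oplus\gamma_2}=\Gamma_{\gamma_1}\otimes\Gamma_{\gamma_2};$$ and nonfreeness is additive: $$\mathfrak C(\Delta_1\otimes\Delta_2)=\mathfrak C(\Delta_1)+\mathfrak C(\Delta_2).$$ -/

import Mathlib

namespace Nonfreeness
open scoped ComplexOrder InnerProductSpace
section Kernel
variable {H : Type*} [NormedAddCommGroup H] [InnerProductSpace ℂ H]

theorem prod_inner_posSemidef {ι : Type*} [Finite ι] (n : ℕ) (w : ι → Fin n → H) :
    (Matrix.of fun a b : ι => ∏ i, (inner ℂ (w a i) (w b i) : ℂ)).PosSemidef := by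
  induction n with
  | zero =>
    have h : (Matrix.of fun a b : ι => ∏ i, (inner ℂ (w a i) (w b i) : ℂ)) =
        Matrix.gram ℂ (fun _ : ι => (1 : ℂ)) := by
      ext a b
      simp [Matrix.gram]
    rw [h]
    exact Matrix.posSemidef_gram ℂ _
  | succ n ih =>
    have h : (Matrix.of fun a b : ι => ∏ i, (inner ℂ (w a i) (w b i) : ℂ)) =
        Matrix.hadamard (Matrix.gram ℂ (fun a : ι => w a 0))
          (Matrix.of fun a b : ι => ∏ i : Fin n, (inner ℂ (w a i.succ) (w b i.succ) : ℂ)) := by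
      ext a b
      simp [Matrix.gram, Fin.prod_univ_succ]
    rw [h]
    exact (Matrix.posSemidef_gram ℂ (fun a : ι => w a 0)).hadamard (ih fun a i => w a i.succ)

theorem sum_prod_inner_nonneg {ι : Type*} [Fintype ι] (n : ℕ) (w : ι → Fin n → H) (c : ι → ℂ) :
    0 ≤ ∑ a, ∑ b, star (c a) * c b * ∏ i, (inner ℂ (w a i) (w b i) : ℂ) := by
  have h := (prod_inner_posSemidef n w).dotProduct_mulVec_nonneg c
  convert h using 1
  simp only [dotProduct, Matrix.mulVec, Finset.mul_sum, Pi.star_apply, Matrix.of_apply]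
  refine Finset.sum_congr rfl fun a _ => Finset.sum_congr rfl fun b _ => by ring

theorem sum_det_inner_nonneg {ι : Type*} [Fintype ι] (n : ℕ) (v : ι → Fin n → H) (c : ι → ℂ) :
    0 ≤ ∑ a, ∑ b, star (c a) * c b *
      (Matrix.of fun i j : Fin n => (inner ℂ (v a i) (v b j) : ℂ)).det := by
  have h := sum_prod_inner_nonneg n (ι := ι × Equiv.Perm (Fin n)) (fun p => v p.1 ∘ p.2)
    (fun p => ((Equiv.Perm.sign p.2 : ℤ) : ℂ) * c p.1)
  have key : ∀ a b : ι, ∑ σ : Equiv.Perm (Fin n), ∑ τ : Equiv.Perm (Fin n),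
      ((Equiv.Perm.sign σ : ℤ) : ℂ) * ((Equiv.Perm.sign τ : ℤ) : ℂ) *
        ∏ i, (inner ℂ (v a (σ i)) (v b (τ i)) : ℂ) =
      (n.factorial : ℂ) * (Matrix.of fun i j : Fin n => (inner ℂ (v a i) (v b j) : ℂ)).det := by
    intro a b
    have h1 : ∀ σ : Equiv.Perm (Fin n), ∑ τ : Equiv.Perm (Fin n),
      ((Equiv.Perm.sign σ : ℤ) : ℂ) * ((Equiv.Perm.sign τ : ℤ) : ℂ) *
        ∏ i, (inner ℂ (v a (σ i)) (v b (τ i)) : ℂ) =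
        (Matrix.of fun i j : Fin n => (inner ℂ (v a i) (v b j) : ℂ)).det := by
      intro σ
      have h2 := Matrix.det_permute σ (Matrix.of fun i j : Fin n => (inner ℂ (v a i) (v b j) : ℂ))
      rw [← Matrix.det_transpose, Matrix.det_apply'] at h2
      simp only [Matrix.transpose_apply, Matrix.submatrix_apply, Matrix.of_apply, id] at h2
      simp_rw [mul_assoc]
      rw [← Finset.mul_sum, h2, ← mul_assoc]
      have : ((Equiv.Perm.sign σ : ℤ) : ℂ) * ((Equiv.Perm.sign σ : ℤ) : ℂ) = 1 := by
        rw [← Int.cast_mul, Int.units_coe_mul_self]; simp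
      rw [this, one_mul]
    simp only [h1]
    simp [Fintype.card_perm]
  have h3 : ∑ p : ι × Equiv.Perm (Fin n), ∑ q : ι × Equiv.Perm (Fin n),
      star (((Equiv.Perm.sign p.2 : ℤ) : ℂ) * c p.1) * (((Equiv.Perm.sign q.2 : ℤ) : ℂ) * c q.1) *
        ∏ i, (inner ℂ ((v p.1 ∘ p.2) i) ((v q.1 ∘ q.2) i) : ℂ) =
      (n.factorial : ℂ) * ∑ a, ∑ b, star (c a) * c b *
      (Matrix.of fun i j : Fin n => (inner ℂ (v a i) (v b j) : ℂ)).det := by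
    simp only [Fintype.sum_prod_type]
    rw [Finset.mul_sum]
    refine Finset.sum_congr rfl fun a _ => ?_
    rw [Finset.sum_comm, Finset.mul_sum]
    refine Finset.sum_congr rfl fun b _ => ?_
    rw [mul_left_comm, ← key a b, Finset.mul_sum]
    refine Finset.sum_congr rfl fun σ _ => ?_
    rw [Finset.mul_sum]
    refine Finset.sum_congr rfl fun τ _ => ?_
    simp
    ring
  rw [h3] at h
  have h4 : (0 : ℂ) ≤ ((n.factorial : ℝ)⁻¹ : ℝ) := by
    rw [Complex.zero_le_real]; positivity
  have h5 := mul_nonneg h4 h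
  rwa [← mul_assoc, Complex.ofReal_inv, Complex.ofReal_natCast,
    inv_mul_cancel₀ (by exact_mod_cast n.factorial_ne_zero), one_mul] at h5

/-- Finite tuples `(x₁, …, xₙ)` of one-particle vectors, of arbitrary length. -/
abbrev Tuple (H : Type*) : Type _ := Σ n : ℕ, (Fin n → H)

open Classical in
/-- The inner product `⟨x₁ ∧ ⋯ ∧ xₙ, y₁ ∧ ⋯ ∧ yₘ⟩` of two Slater determinants: it is
`det (⟨xᵢ, yⱼ⟩)` if `n = m` and `0` otherwise. -/
noncomputable def slaterKernel (x y : Tuple H) : ℂ :=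
  if h : x.1 = y.1 then
    (Matrix.of fun i j : Fin x.1 => (inner ℂ (x.2 i) (y.2 (Fin.cast h j)) : ℂ)).det
  else 0

theorem slaterKernel_mk {n : ℕ} (x y : Fin n → H) :
    slaterKernel ⟨n, x⟩ ⟨n, y⟩ = (Matrix.of fun i j => (inner ℂ (x i) (y j) : ℂ)).det := by
  simp [slaterKernel]

theorem slaterKernel_of_ne {x y : Tuple H} (h : x.1 ≠ y.1) : slaterKernel x y = 0 := by
  simp [slaterKernel, h]

theorem star_slaterKernel (x y : Tuple H) : star (slaterKernel y x) = slaterKernel x y := by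
  obtain ⟨n, x⟩ := x
  obtain ⟨m, y⟩ := y
  by_cases h : n = m
  · subst h
    rw [slaterKernel_mk, slaterKernel_mk, ← Matrix.det_conjTranspose]
    congr 1
    ext i j
    simp [Matrix.conjTranspose_apply]
  · rw [slaterKernel_of_ne (fun e => h e.symm), slaterKernel_of_ne (by exact h), star_zero]

theorem sum_slaterKernel_nonneg (f : Tuple H →₀ ℂ) :
    0 ≤ f.sum fun x c => f.sum fun y d => star c * d * slaterKernel x y := by
  classical
  have h : (f.sum fun x c => f.sum fun y d => star c * d * slaterKernel x y) =
      ∑ n ∈ f.support.image Sigma.fst, ∑ x : f.support, ∑ y : f.support,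
        star (if x.1.1 = n then f x else 0) * (if y.1.1 = n then f y else 0) *
        (Matrix.of fun i j : Fin n =>
          (inner ℂ (if h : x.1.1 = n then x.1.2 (Fin.cast h.symm i) else 0)
            (if h : y.1.1 = n then y.1.2 (Fin.cast h.symm j) else 0) : ℂ)).det := by
    rw [Finset.sum_comm]
    simp only [Finsupp.sum]
    rw [← Finset.sum_coe_sort]
    refine Finset.sum_congr rfl fun x _ => ?_
    rw [Finset.sum_comm, ← Finset.sum_coe_sort]
    refine Finset.sum_congr rfl fun y _ => ?_
    rw [Finset.sum_eq_single x.1.1]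
    · by_cases hxy : x.1.1 = y.1.1
      · simp [slaterKernel, hxy]
      · rw [slaterKernel_of_ne hxy]
        simp [Ne.symm hxy]
    · intro n _ hn
      simp [Ne.symm hn]
    · intro hx
      exact absurd (Finset.mem_image_of_mem _ x.2) hx
  rw [h]
  exact Finset.sum_nonneg fun n _ => sum_det_inner_nonneg n _ _

/-- The sesquilinear form determined by `slaterKernel`. -/
noncomputable def slaterForm (f g : Tuple H →₀ ℂ) : ℂ :=
  f.sum fun x c => g.sum fun y d => star c * d * slaterKernel x y

theorem slaterForm_conj (f g : Tuple H →₀ ℂ) :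
    (starRingEnd ℂ) (slaterForm g f) = slaterForm f g := by
  unfold slaterForm
  rw [Finsupp.sum_comm]
  simp only [map_finsuppSum]
  refine Finsupp.sum_congr fun x _ => Finsupp.sum_congr fun y _ => ?_
  rw [← star_slaterKernel x y]
  simp [mul_comm]

theorem slaterForm_add_left (f g k : Tuple H →₀ ℂ) :
    slaterForm (f + g) k = slaterForm f k + slaterForm g k := by
  unfold slaterForm
  rw [Finsupp.sum_add_index'] <;> intros <;> simp [← Finsupp.sum_add, add_mul]

theorem slaterForm_smul_left (f g : Tuple H →₀ ℂ) (r : ℂ) :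
    slaterForm (r • f) g = (starRingEnd ℂ) r * slaterForm f g := by
  unfold slaterForm
  rw [Finsupp.sum_smul_index]
  · simp [Finsupp.mul_sum, ← mul_assoc]
  · simp

/-- Formal finite linear combinations of Slater determinants. -/
def SlaterSpan (H : Type*) : Type _ := Tuple H →₀ ℂ

noncomputable instance : AddCommGroup (SlaterSpan H) := inferInstanceAs (AddCommGroup (Tuple H →₀ ℂ))

noncomputable instance : Module ℂ (SlaterSpan H) := inferInstanceAs (Module ℂ (Tuple H →₀ ℂ))

/-- The positive semidefinite sesquilinear form on formal combinations of Slater determinants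
that is determined by `slaterKernel`. -/
noncomputable instance SlaterSpan.core : PreInnerProductSpace.Core ℂ (SlaterSpan H) where
  inner f g := slaterForm f g
  conj_inner_symm f g := slaterForm_conj f g
  add_left f g k := slaterForm_add_left f g k
  smul_left f g r := slaterForm_smul_left f g r
  re_inner_nonneg f := (Complex.nonneg_iff.mp (sum_slaterKernel_nonneg f)).1

noncomputable instance : SeminormedAddCommGroup (SlaterSpan H) :=
  InnerProductSpace.Core.toSeminormedAddCommGroup (𝕜 := ℂ)

noncomputable instance : InnerProductSpace ℂ (SlaterSpan H) := .ofCore _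

/-- The formal Slater determinant of a tuple of one-particle vectors. -/
noncomputable def SlaterSpan.of (x : Tuple H) : SlaterSpan H := Finsupp.single x 1

theorem SlaterSpan.inner_of (x y : Tuple H) :
    inner ℂ (SlaterSpan.of x) (SlaterSpan.of y) = slaterKernel x y := by
  change slaterForm (Finsupp.single x (1 : ℂ)) (Finsupp.single y (1 : ℂ)) = _
  simp [slaterForm]

theorem SlaterSpan.induction {X : Type*} {p : SlaterSpan X → Prop} (f : SlaterSpan X) (h0 : p 0)
    (hadd : ∀ f g, p f → p g → p (f + g)) (hof : ∀ (c : ℂ) x, p (c • SlaterSpan.of x)) : p f := by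
  refine Finsupp.induction_linear (motive := p) f h0 hadd fun x c => ?_
  have h : c • (Finsupp.single x (1 : ℂ) : Tuple X →₀ ℂ) = Finsupp.single x c := by simp
  exact h ▸ hof c x

/-- The linear map on formal combinations with prescribed values on Slater determinants. -/
noncomputable def SlaterSpan.lift {X M : Type*} [AddCommGroup M] [Module ℂ M] (φ : Tuple X → M) :
    SlaterSpan X →ₗ[ℂ] M := Finsupp.linearCombination ℂ φ

theorem SlaterSpan.lift_of {X M : Type*} [AddCommGroup M] [Module ℂ M] (φ : Tuple X → M)
    (x : Tuple X) : SlaterSpan.lift φ (SlaterSpan.of x) = φ x := by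
  exact (Finsupp.linearCombination_single ℂ (1 : ℂ) x).trans (one_smul ℂ _)

theorem SlaterSpan.inner_ext {X Y E : Type*} [SeminormedAddCommGroup E] [InnerProductSpace ℂ E]
    (S : SlaterSpan X →ₗ[ℂ] E) (S' : SlaterSpan X →ₗ[ℂ] E)
    (T T' : SlaterSpan Y →ₗ[ℂ] E)
    (h : ∀ x y, (inner ℂ (S (.of x)) (T (.of y)) : ℂ) = inner ℂ (S' (.of x)) (T' (.of y)))
    (f : SlaterSpan X) (g : SlaterSpan Y) :
    (inner ℂ (S f) (T g) : ℂ) = inner ℂ (S' f) (T' g) := by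
  induction f using SlaterSpan.induction with
  | h0 => simp
  | hadd f f' h h' => simp [inner_add_left, h, h']
  | hof c x =>
    induction g using SlaterSpan.induction with
    | h0 => simp
    | hadd f f' h h' => simp only [map_add, inner_add_right, h, h']
    | hof d y => simp [inner_smul_left, inner_smul_right, h]

/-- The fermion Fock space over `H`: the Hilbert space completion of the (separated) span of
all Slater determinants `x₁ ∧ ⋯ ∧ xₙ` with
`⟨x₁ ∧ ⋯ ∧ xₙ, y₁ ∧ ⋯ ∧ yₘ⟩ = δₙₘ det (⟨xᵢ, yⱼ⟩)`, i.e. the Hilbert sum of the antisymmetric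
tensor powers of `H`. -/
abbrev Fock (H : Type*) [NormedAddCommGroup H] [InnerProductSpace ℂ H] : Type _ :=
  UniformSpace.Completion (SlaterSpan H)

/-- The Slater determinant `x₁ ∧ ⋯ ∧ xₙ` in Fock space. -/
noncomputable def slater {n : ℕ} (x : Fin n → H) : Fock H :=
  ((SlaterSpan.of ⟨n, x⟩ : SlaterSpan H) : UniformSpace.Completion (SlaterSpan H))

theorem inner_slater {n : ℕ} (x y : Fin n → H) :
    (inner ℂ (slater x) (slater y) : ℂ) =
      (Matrix.of fun i j => (inner ℂ (x i) (y j) : ℂ)).det := by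
  rw [slater, slater, UniformSpace.Completion.inner_coe, SlaterSpan.inner_of, slaterKernel_mk]

/- Creation and annihilation operators. -/

/-- `h ∧ ·` on formal combinations. -/
noncomputable def SlaterSpan.wedge (h : H) : SlaterSpan H →ₗ[ℂ] SlaterSpan H :=
  SlaterSpan.lift fun x => .of ⟨x.1 + 1, Fin.cons h x.2⟩

/-- The contraction with `h` on formal combinations:
`x₁ ∧ ⋯ ∧ xₙ ↦ ∑ⱼ (-1)ʲ⁺¹ ⟨h, xⱼ⟩ x₁ ∧ ⋯ x̂ⱼ ⋯ ∧ xₙ`. -/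
noncomputable def SlaterSpan.contract (h : H) : SlaterSpan H →ₗ[ℂ] SlaterSpan H :=
  SlaterSpan.lift fun x => match x with
    | ⟨0, _⟩ => 0
    | ⟨n + 1, x⟩ => ∑ j : Fin (n + 1),
        ((-1 : ℂ) ^ (j : ℕ) * inner ℂ h (x j)) • SlaterSpan.of ⟨n, fun i => x (j.succAbove i)⟩

theorem SlaterSpan.inner_wedge (h : H) (f g : SlaterSpan H) :
    (inner ℂ (SlaterSpan.wedge h f) g : ℂ) = inner ℂ f (SlaterSpan.contract h g) := by
  refine SlaterSpan.inner_ext (SlaterSpan.wedge h) LinearMap.id LinearMap.id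
    (SlaterSpan.contract h) (fun x y => ?_) f g
  obtain ⟨n, x⟩ := x
  obtain ⟨m, y⟩ := y
  simp only [LinearMap.id_apply, SlaterSpan.wedge, SlaterSpan.contract, SlaterSpan.lift_of,
    SlaterSpan.inner_of]
  cases m with
  | zero => simp [slaterKernel]
  | succ m =>
    simp only [inner_sum, inner_smul_right, SlaterSpan.inner_of]
    by_cases hnm : n = m
    · subst hnm
      rw [slaterKernel_mk, Matrix.det_succ_row_zero]
      refine Finset.sum_congr rfl fun j _ => ?_
      rw [slaterKernel_mk]
      simp only [Matrix.of_apply, Fin.cons_zero]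
      congr 2
    · rw [slaterKernel_of_ne (by simpa using hnm)]
      refine (Finset.sum_eq_zero fun j _ => ?_).symm
      rw [slaterKernel_of_ne (by simpa using hnm), mul_zero]

theorem SlaterSpan.contract_wedge (h k : H) (f : SlaterSpan H) :
    SlaterSpan.contract h (SlaterSpan.wedge k f) =
      (inner ℂ h k : ℂ) • f - SlaterSpan.wedge k (SlaterSpan.contract h f) := by
  induction f using SlaterSpan.induction with
  | h0 => simp
  | hadd f g hf hg => simp only [map_add, hf, hg, smul_add]; abel
  | hof c x =>
    simp only [map_smul]
    rw [smul_comm, ← smul_sub]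
    congr 1
    obtain ⟨n, x⟩ := x
    simp only [SlaterSpan.wedge, SlaterSpan.contract, SlaterSpan.lift_of]
    rw [Fin.sum_univ_succ]
    simp only [Fin.val_zero, pow_zero, one_mul, Fin.cons_zero, Fin.cons_succ, Fin.zero_succAbove,
      Fin.val_succ]
    rw [sub_eq_add_neg]
    congr 1
    cases n with
    | zero => simp
    | succ n =>
      simp only [map_sum, map_smul, SlaterSpan.lift_of]
      rw [← Finset.sum_neg_distrib]
      refine Finset.sum_congr rfl fun j _ => ?_
      rw [← neg_smul, pow_succ]
      congr 1
      · ring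
      · congr 2
        funext i
        refine Fin.cases ?_ (fun i => ?_) i <;> simp

theorem SlaterSpan.norm_wedge_le (h : H) (f : SlaterSpan H) :
    ‖SlaterSpan.wedge h f‖ ≤ ‖h‖ * ‖f‖ := by
  have h1 : (inner ℂ (SlaterSpan.wedge h f) (SlaterSpan.wedge h f) : ℂ) =
      (inner ℂ h h : ℂ) * inner ℂ f f -
        inner ℂ (SlaterSpan.contract h f) (SlaterSpan.contract h f) := by
    rw [SlaterSpan.inner_wedge, SlaterSpan.contract_wedge, inner_sub_right, inner_smul_right]
    congr 1
    rw [← inner_conj_symm, SlaterSpan.inner_wedge, inner_conj_symm]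
  rw [inner_self_eq_norm_sq_to_K, inner_self_eq_norm_sq_to_K, inner_self_eq_norm_sq_to_K,
    inner_self_eq_norm_sq_to_K] at h1
  have h2 : ‖SlaterSpan.wedge h f‖ ^ 2 = ‖h‖ ^ 2 * ‖f‖ ^ 2 - ‖SlaterSpan.contract h f‖ ^ 2 := by
    exact_mod_cast h1
  refine le_of_sq_le_sq ?_ (by positivity)
  nlinarith [sq_nonneg ‖SlaterSpan.contract h f‖]

/-- The creation operator `a†(h) : ψ ↦ h ∧ ψ`, a bounded operator on Fock space. -/
noncomputable def creation (h : H) : Fock H →L[ℂ] Fock H :=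
  (UniformSpace.Completion.toComplL ∘L
    (SlaterSpan.wedge h).mkContinuous ‖h‖ (SlaterSpan.norm_wedge_le h)).extend
      UniformSpace.Completion.toComplL

/-- The annihilation operator `a(h)`, the adjoint of the creation operator. -/
noncomputable def annihilation (h : H) : Fock H →L[ℂ] Fock H :=
  ContinuousLinearMap.adjoint (creation h)

theorem creation_slater (h : H) {n : ℕ} (x : Fin n → H) :
    creation h (slater x) = slater (Fin.cons h x : Fin (n + 1) → H) := by
  have := ContinuousLinearMap.extend_eq (UniformSpace.Completion.toComplL ∘L
    (SlaterSpan.wedge h).mkContinuous ‖h‖ (SlaterSpan.norm_wedge_le h))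
      (e := UniformSpace.Completion.toComplL) UniformSpace.Completion.denseRange_coe
      (UniformSpace.Completion.isUniformInducing_coe _) (SlaterSpan.of ⟨n, x⟩)
  refine this.trans ?_
  simp [SlaterSpan.wedge, SlaterSpan.lift_of, slater]

theorem Fock.ext_inner {v w : Fock H}
    (h : ∀ (n : ℕ) (x : Fin n → H), (inner ℂ (slater x) v : ℂ) = inner ℂ (slater x) w) : v = w := by
  refine UniformSpace.Completion.denseRange_coe.eq_of_inner_right ℂ fun f => ?_
  induction f using SlaterSpan.induction with
  | h0 =>
    have h0 : ((0 : SlaterSpan H) : UniformSpace.Completion (SlaterSpan H)) = 0 :=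
      UniformSpace.Completion.coe_zero
    rw [h0, inner_zero_left, inner_zero_left]
  | hadd f g hf hg =>
    rw [UniformSpace.Completion.coe_add, inner_add_left, inner_add_left, hf, hg]
  | hof c x =>
    rw [UniformSpace.Completion.coe_smul, inner_smul_left, inner_smul_left]
    exact congrArg _ (h x.1 x.2)

theorem Fock.ext_slater {G : Type*} [NormedAddCommGroup G] [NormedSpace ℂ G]
    {S T : Fock H →L[ℂ] G} (h : ∀ (n : ℕ) (x : Fin n → H), S (slater x) = T (slater x)) :
    S = T := by
  refine ContinuousLinearMap.ext fun v => ?_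
  refine UniformSpace.Completion.induction_on v (isClosed_eq S.continuous T.continuous) fun f => ?_
  induction f using SlaterSpan.induction with
  | h0 =>
    have h0 : ((0 : SlaterSpan H) : UniformSpace.Completion (SlaterSpan H)) = 0 :=
      UniformSpace.Completion.coe_zero
    rw [h0, map_zero, map_zero]
  | hadd f g hf hg => rw [UniformSpace.Completion.coe_add, map_add, map_add, hf, hg]
  | hof c x =>
    rw [UniformSpace.Completion.coe_smul, map_smul, map_smul]
    exact congrArg _ (h x.1 x.2)

theorem creation_coe (h : H) (f : SlaterSpan H) :
    creation h (f : UniformSpace.Completion (SlaterSpan H)) =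
      ((SlaterSpan.wedge h f : SlaterSpan H) : UniformSpace.Completion (SlaterSpan H)) :=
  ContinuousLinearMap.extend_eq (UniformSpace.Completion.toComplL ∘L
    (SlaterSpan.wedge h).mkContinuous ‖h‖ (SlaterSpan.norm_wedge_le h))
      (e := UniformSpace.Completion.toComplL) UniformSpace.Completion.denseRange_coe
      (UniformSpace.Completion.isUniformInducing_coe _) f

theorem creation_add (u v : H) : creation (u + v) = creation u + creation v := by
  refine Fock.ext_slater fun n x => Fock.ext_inner fun m y => ?_
  rw [add_apply, inner_add_right]
  simp only [slater, creation_coe, UniformSpace.Completion.inner_coe]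
  rw [← inner_conj_symm, ← inner_conj_symm _ (SlaterSpan.wedge u _),
    ← inner_conj_symm _ (SlaterSpan.wedge v _), SlaterSpan.inner_wedge, SlaterSpan.inner_wedge,
    SlaterSpan.inner_wedge, ← map_add, ← inner_add_right]
  congr 2
  simp only [SlaterSpan.contract, SlaterSpan.lift_of]
  cases m with
  | zero => simp
  | succ m => simp only [inner_add_left, mul_add, add_smul, Finset.sum_add_distrib]

theorem creation_anticomm (u v : H) (ψ : Fock H) :
    creation u (creation v ψ) = - creation v (creation u ψ) := by
  suffices h : creation u ∘L creation v = -(creation v ∘L creation u) from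
    congrArg (fun T : Fock H →L[ℂ] Fock H => T ψ) h
  refine Fock.ext_slater fun n x => Fock.ext_inner fun m y => ?_
  simp only [neg_apply, ContinuousLinearMap.comp_apply, creation_slater,
    inner_neg_right]
  by_cases hm : m = n + 2
  · subst hm
    rw [inner_slater, inner_slater]
    have h := Matrix.det_permute' (Equiv.swap (0 : Fin (n + 2)) 1) (Matrix.of fun i j : Fin (n + 2) =>
      (inner ℂ (y i) ((Fin.cons v (Fin.cons u x : Fin (n + 1) → H) : Fin (n + 2) → H) j) : ℂ))
    rw [Equiv.Perm.sign_swap (by simp)] at h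
    simp only [Units.val_neg, Units.val_one, Int.cast_neg, Int.cast_one, neg_mul, one_mul] at h
    rw [← h]
    congr 1
    ext i j
    simp only [Matrix.of_apply, Matrix.submatrix_apply, id]
    congr 1
    refine Fin.cases ?_ (fun j => Fin.cases ?_ (fun j => ?_) j) j
    · simp
    · simp
    · rw [Equiv.swap_apply_of_ne_of_ne]
      · simp
      · exact Fin.succ_ne_zero _
      · intro h
        have := Fin.val_eq_of_eq h
        simp at this
  · simp only [slater, UniformSpace.Completion.inner_coe, SlaterSpan.inner_of]
    rw [slaterKernel_of_ne (by exact hm), slaterKernel_of_ne (by exact hm), neg_zero]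

/- The isomorphism `F(K) ⊗ F(Kᗮ) ≃ F(H)`. -/

/-- `f ↦ x₁ ∧ ⋯ ∧ xₙ ∧ f` on formal combinations. -/
noncomputable def SlaterSpan.wedgeAll : (n : ℕ) → (Fin n → H) → (SlaterSpan H →ₗ[ℂ] SlaterSpan H)
  | 0, _ => LinearMap.id
  | n + 1, x => SlaterSpan.wedge (x 0) ∘ₗ SlaterSpan.wedgeAll n fun i => x i.succ

theorem SlaterSpan.inner_wedgeAll_zero (f : SlaterSpan H) (g : SlaterSpan H) (n : ℕ)
    (x : Fin (n + 1) → H) (hx : ∀ i, SlaterSpan.contract (x i) f = 0) :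
    (inner ℂ (SlaterSpan.wedgeAll (n + 1) x g) f : ℂ) = 0 := by
  rw [SlaterSpan.wedgeAll, LinearMap.comp_apply, SlaterSpan.inner_wedge, hx, inner_zero_right]

theorem SlaterSpan.contract_wedgeAll (h : H) (f : SlaterSpan H)
    (hf : SlaterSpan.contract h f = 0) (n : ℕ) (x : Fin (n + 1) → H) :
    SlaterSpan.contract h (SlaterSpan.wedgeAll (n + 1) x f) =
      ∑ j : Fin (n + 1), ((-1 : ℂ) ^ (j : ℕ) * inner ℂ h (x j)) •
        SlaterSpan.wedgeAll n (fun i => x (j.succAbove i)) f := by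
  induction n with
  | zero =>
    simp [SlaterSpan.wedgeAll, SlaterSpan.contract_wedge, hf]
  | succ n ih =>
    rw [SlaterSpan.wedgeAll, LinearMap.comp_apply, SlaterSpan.contract_wedge, ih]
    conv_rhs => rw [Fin.sum_univ_succ]
    simp only [Fin.val_zero, pow_zero, one_mul, Fin.zero_succAbove, Fin.val_succ]
    rw [sub_eq_add_neg]
    congr 1
    rw [map_sum, ← Finset.sum_neg_distrib]
    refine Finset.sum_congr rfl fun j _ => ?_
    rw [map_smul, ← neg_smul, pow_succ, SlaterSpan.wedgeAll, LinearMap.comp_apply]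
    simp only [Fin.succ_succAbove_zero, Fin.succ_succAbove_succ]
    congr 1
    ring

theorem SlaterSpan.inner_wedgeAll (f g : SlaterSpan H) (n m : ℕ) (x : Fin n → H) (y : Fin m → H)
    (hf : ∀ j, SlaterSpan.contract (y j) f = 0) (hg : ∀ i, SlaterSpan.contract (x i) g = 0) :
    (inner ℂ (SlaterSpan.wedgeAll n x f) (SlaterSpan.wedgeAll m y g) : ℂ) =
      slaterKernel ⟨n, x⟩ ⟨m, y⟩ * inner ℂ f g := by
  induction n generalizing m with
  | zero =>
    cases m with
    | zero => simp [SlaterSpan.wedgeAll, slaterKernel]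
    | succ m =>
      rw [slaterKernel_of_ne (by simp), zero_mul, ← inner_conj_symm, SlaterSpan.wedgeAll,
        LinearMap.id_apply, SlaterSpan.inner_wedgeAll_zero f g m y hf, map_zero]
  | succ n ih =>
    cases m with
    | zero =>
      rw [slaterKernel_of_ne (by simp), zero_mul]
      exact SlaterSpan.inner_wedgeAll_zero g f n x hg
    | succ m =>
      rw [SlaterSpan.wedgeAll, LinearMap.comp_apply, SlaterSpan.inner_wedge,
        SlaterSpan.contract_wedgeAll _ _ (hg 0), inner_sum]
      have h1 : slaterKernel ⟨n + 1, x⟩ ⟨m + 1, y⟩ = ∑ j : Fin (m + 1),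
          ((-1 : ℂ) ^ (j : ℕ) * inner ℂ (x 0) (y j)) *
            slaterKernel ⟨n, fun i => x i.succ⟩ ⟨m, fun i => y (j.succAbove i)⟩ := by
        have h2 := SlaterSpan.inner_wedge (x 0) (.of ⟨n, fun i => x i.succ⟩) (.of ⟨m + 1, y⟩)
        simp only [SlaterSpan.wedge, SlaterSpan.contract, SlaterSpan.lift_of, SlaterSpan.inner_of,
          inner_sum, inner_smul_right] at h2
        rw [← h2]
        congr 2
        exact (Fin.cons_self_tail x).symm
      rw [h1, Finset.sum_mul]
      refine Finset.sum_congr rfl fun j _ => ?_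
      rw [inner_smul_right, ih m (fun i => x i.succ) (fun i => y (j.succAbove i))
        (fun i => hf _) (fun i => hg _)]
      ring

/-- The map on formal combinations induced by the inclusion of a subspace. -/
noncomputable def SlaterSpan.incl (K : Submodule ℂ H) : SlaterSpan K →ₗ[ℂ] SlaterSpan H :=
  SlaterSpan.lift fun x => .of ⟨x.1, fun i => (x.2 i : H)⟩

theorem SlaterSpan.inner_incl (K : Submodule ℂ H) (f g : SlaterSpan K) :
    (inner ℂ (SlaterSpan.incl K f) (SlaterSpan.incl K g) : ℂ) = inner ℂ f g := by
  induction f using SlaterSpan.induction with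
  | h0 => simp
  | hadd f f' h h' => simp [inner_add_left, h, h']
  | hof c x =>
    induction g using SlaterSpan.induction with
    | h0 => simp
    | hadd f f' h h' => simp only [map_add, inner_add_right, h, h']
    | hof d y =>
      simp only [map_smul, inner_smul_left, inner_smul_right, SlaterSpan.incl, SlaterSpan.lift_of,
        SlaterSpan.inner_of]
      rfl

theorem SlaterSpan.contract_incl (K : Submodule ℂ H) {h : H} (hh : h ∈ Kᗮ) (f : SlaterSpan K) :
    SlaterSpan.contract h (SlaterSpan.incl K f) = 0 := by
  induction f using SlaterSpan.induction with
  | h0 => simp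
  | hadd f f' h h' => simp [h, h']
  | hof c x =>
    obtain ⟨n, x⟩ := x
    simp only [map_smul, SlaterSpan.incl, SlaterSpan.lift_of, SlaterSpan.contract]
    cases n with
    | zero => simp
    | succ n => simp [Submodule.inner_left_of_mem_orthogonal (x _).2 hh]

/-- The bilinear map `(x₁ ∧ ⋯ ∧ xₙ, y₁ ∧ ⋯ ∧ yₘ) ↦ x₁ ∧ ⋯ ∧ xₙ ∧ y₁ ∧ ⋯ ∧ yₘ` with `xᵢ ∈ K` and
`yⱼ ∈ Kᗮ`, on formal combinations. -/
noncomputable def SlaterSpan.wedgeProd (K : Submodule ℂ H) :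
    SlaterSpan K →ₗ[ℂ] SlaterSpan Kᗮ →ₗ[ℂ] SlaterSpan H :=
  SlaterSpan.lift fun x =>
    SlaterSpan.wedgeAll x.1 (fun i => (x.2 i : H)) ∘ₗ SlaterSpan.incl Kᗮ

theorem SlaterSpan.inner_wedgeProd (K : Submodule ℂ H) (f f' : SlaterSpan K)
    (g g' : SlaterSpan Kᗮ) :
    (inner ℂ (SlaterSpan.wedgeProd K f g) (SlaterSpan.wedgeProd K f' g') : ℂ) =
      inner ℂ f f' * inner ℂ g g' := by
  induction f using SlaterSpan.induction with
  | h0 => simp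
  | hadd f f' h h' => simp [inner_add_left, h, h', add_mul]
  | hof c x =>
    induction f' using SlaterSpan.induction with
    | h0 => simp
    | hadd f f' h h' =>
      simp only [map_add, LinearMap.add_apply, inner_add_right, h, h', add_mul]
    | hof d y =>
      have hK : ∀ k : K, (k : H) ∈ Kᗮᗮ := fun k => K.le_orthogonal_orthogonal k.2
      simp only [map_smul, LinearMap.smul_apply, inner_smul_left, inner_smul_right,
        SlaterSpan.wedgeProd, SlaterSpan.lift_of, SlaterSpan.inner_of, LinearMap.comp_apply]
      rw [SlaterSpan.inner_wedgeAll _ _ _ _ _ _ (fun j => SlaterSpan.contract_incl _ (hK _) _)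
        (fun j => SlaterSpan.contract_incl _ (hK _) _), SlaterSpan.inner_incl]
      simp only [slaterKernel, Submodule.coe_inner]
      ring

theorem SlaterSpan.norm_wedgeProd (K : Submodule ℂ H) (f : SlaterSpan K) (g : SlaterSpan Kᗮ) :
    ‖SlaterSpan.wedgeProd K f g‖ = ‖f‖ * ‖g‖ := by
  have h := SlaterSpan.inner_wedgeProd K f f g g
  rw [inner_self_eq_norm_sq_to_K, inner_self_eq_norm_sq_to_K, inner_self_eq_norm_sq_to_K] at h
  have h2 : ‖SlaterSpan.wedgeProd K f g‖ ^ 2 = (‖f‖ * ‖g‖) ^ 2 := by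
    rw [mul_pow]
    exact_mod_cast h
  exact (sq_eq_sq₀ (norm_nonneg _) (by positivity)).mp h2

theorem Fock.isUniformInducing_coe :
    IsUniformInducing (UniformSpace.Completion.toComplL (𝕜 := ℂ) (E := SlaterSpan H)) :=
  UniformSpace.Completion.isUniformInducing_coe _

theorem Fock.denseRange_coe :
    DenseRange (UniformSpace.Completion.toComplL (𝕜 := ℂ) (E := SlaterSpan H)) :=
  UniformSpace.Completion.denseRange_coe

/-- `f ∧ ·` as a bounded map `F(Kᗮ) → F(H)`, for a formal combination `f` over `K`. -/
noncomputable def wedgeRight (K : Submodule ℂ H) (f : SlaterSpan K) : Fock Kᗮ →L[ℂ] Fock H :=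
  (UniformSpace.Completion.toComplL ∘L (SlaterSpan.wedgeProd K f).mkContinuous ‖f‖
    fun g => (SlaterSpan.norm_wedgeProd K f g).le).extend UniformSpace.Completion.toComplL

theorem wedgeRight_coe (K : Submodule ℂ H) (f : SlaterSpan K) (g : SlaterSpan Kᗮ) :
    wedgeRight K f (g : UniformSpace.Completion (SlaterSpan Kᗮ)) =
      ((SlaterSpan.wedgeProd K f g : SlaterSpan H) : UniformSpace.Completion (SlaterSpan H)) :=
  ContinuousLinearMap.extend_eq _ Fock.denseRange_coe Fock.isUniformInducing_coe g

theorem norm_wedgeRight_apply (K : Submodule ℂ H) (f : SlaterSpan K) (φ : Fock Kᗮ) :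
    ‖wedgeRight K f φ‖ = ‖f‖ * ‖φ‖ := by
  refine UniformSpace.Completion.induction_on φ (isClosed_eq (by fun_prop) (by fun_prop)) fun g => ?_
  rw [wedgeRight_coe, UniformSpace.Completion.norm_coe, UniformSpace.Completion.norm_coe,
    SlaterSpan.norm_wedgeProd]

/-- `wedgeRight` as a bounded linear map of `f`. -/
noncomputable def wedgeRightL (K : Submodule ℂ H) : SlaterSpan K →L[ℂ] Fock Kᗮ →L[ℂ] Fock H :=
  LinearMap.mkContinuous
    { toFun := wedgeRight K
      map_add' := fun f g => by
        refine Fock.ext_slater fun n x => ?_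
        simp only [slater, add_apply, wedgeRight_coe, map_add, LinearMap.add_apply,
          UniformSpace.Completion.coe_add]
      map_smul' := fun c f => by
        refine Fock.ext_slater fun n x => ?_
        simp only [slater, smul_apply, wedgeRight_coe, map_smul, LinearMap.smul_apply,
          UniformSpace.Completion.coe_smul, RingHom.id_apply] }
    1 fun f => ContinuousLinearMap.opNorm_le_bound _ (by positivity) fun φ => by
      rw [one_mul]
      exact (norm_wedgeRight_apply K f φ).le

/-- The wedge product `F(K) × F(Kᗮ) → F(H)`,
`(x₁ ∧ ⋯ ∧ xₙ, y₁ ∧ ⋯ ∧ yₘ) ↦ x₁ ∧ ⋯ ∧ xₙ ∧ y₁ ∧ ⋯ ∧ yₘ`. -/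
noncomputable def fockWedge (K : Submodule ℂ H) : Fock K →L[ℂ] Fock Kᗮ →L[ℂ] Fock H :=
  (wedgeRightL K).extend UniformSpace.Completion.toComplL

theorem fockWedge_coe (K : Submodule ℂ H) (f : SlaterSpan K) (g : SlaterSpan Kᗮ) :
    fockWedge K (f : UniformSpace.Completion (SlaterSpan K))
        (g : UniformSpace.Completion (SlaterSpan Kᗮ)) =
      ((SlaterSpan.wedgeProd K f g : SlaterSpan H) : UniformSpace.Completion (SlaterSpan H)) := by
  have h : fockWedge K (f : UniformSpace.Completion (SlaterSpan K)) = wedgeRight K f :=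
    ContinuousLinearMap.extend_eq (wedgeRightL K) Fock.denseRange_coe Fock.isUniformInducing_coe f
  rw [h, wedgeRight_coe]

theorem inner_fockWedge (K : Submodule ℂ H) (φ φ' : Fock K) (χ χ' : Fock Kᗮ) :
    (inner ℂ (fockWedge K φ χ) (fockWedge K φ' χ') : ℂ) = inner ℂ φ φ' * inner ℂ χ χ' := by
  refine UniformSpace.Completion.induction_on₂ φ φ' (isClosed_eq (by fun_prop) (by fun_prop))
    fun f f' => ?_
  refine UniformSpace.Completion.induction_on₂ χ χ' (isClosed_eq (by fun_prop) (by fun_prop))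
    fun g g' => ?_
  rw [fockWedge_coe, fockWedge_coe, UniformSpace.Completion.inner_coe,
    UniformSpace.Completion.inner_coe, UniformSpace.Completion.inner_coe,
    SlaterSpan.inner_wedgeProd]

open scoped TensorProduct

/-- The Hilbert space tensor product. -/
abbrev HilbertTensor (E F : Type*) [NormedAddCommGroup E] [InnerProductSpace ℂ E]
    [NormedAddCommGroup F] [InnerProductSpace ℂ F] : Type _ :=
  UniformSpace.Completion (E ⊗[ℂ] F)

/-- The tensor product `A ⊗ B` of bounded operators on the Hilbert space tensor product. -/
noncomputable def hilbertTensorMap {E F : Type*} [NormedAddCommGroup E] [InnerProductSpace ℂ E]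
    [NormedAddCommGroup F] [InnerProductSpace ℂ F] (A : E →L[ℂ] E) (B : F →L[ℂ] F) :
    HilbertTensor E F →L[ℂ] HilbertTensor E F :=
  (UniformSpace.Completion.toComplL ∘L TensorProduct.mapL A B).extend
    UniformSpace.Completion.toComplL

/-- The wedge product as an isometry on the algebraic tensor product. -/
noncomputable def fockTensorAlg (K : Submodule ℂ H) : Fock K ⊗[ℂ] Fock Kᗮ →ₗᵢ[ℂ] Fock H :=
  LinearMap.isometryOfInner
    (TensorProduct.lift ((ContinuousLinearMap.coeLM ℂ).comp (fockWedge K).toLinearMap)) (by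
      intro s t
      induction s using TensorProduct.induction_on with
      | zero => simp
      | add s s' h h' => simp only [map_add, inner_add_left, h, h']
      | tmul φ χ =>
        induction t using TensorProduct.induction_on with
        | zero => simp
        | add s s' h h' => simp only [map_add, inner_add_right, h, h']
        | tmul φ' χ' => simpa using inner_fockWedge K φ φ' χ χ')

theorem fockTensorAlg_tmul (K : Submodule ℂ H) (φ : Fock K) (χ : Fock Kᗮ) :
    fockTensorAlg K (φ ⊗ₜ χ) = fockWedge K φ χ := rfl

/-- The wedge product as an isometry `F(K) ⊗ F(Kᗮ) → F(H)`. -/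
noncomputable def fockTensorIsometry (K : Submodule ℂ H) :
    HilbertTensor (Fock K) (Fock Kᗮ) →ₗᵢ[ℂ] Fock H where
  toLinearMap := ((fockTensorAlg K).toContinuousLinearMap.extend
    UniformSpace.Completion.toComplL).toLinearMap
  norm_map' := fun t => by
    refine UniformSpace.Completion.induction_on t (isClosed_eq ?_ (by fun_prop)) fun s => ?_
    · exact ((fockTensorAlg K).toContinuousLinearMap.extend
        UniformSpace.Completion.toComplL).continuous.norm
    · refine (congrArg norm (ContinuousLinearMap.extend_eq (fockTensorAlg K).toContinuousLinearMap
        (e := UniformSpace.Completion.toComplL) UniformSpace.Completion.denseRange_coe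
        (UniformSpace.Completion.isUniformInducing_coe _) s)).trans ?_
      exact ((fockTensorAlg K).norm_map s).trans (UniformSpace.Completion.norm_coe s).symm

theorem fockTensorIsometry_coe (K : Submodule ℂ H) (s : Fock K ⊗[ℂ] Fock Kᗮ) :
    fockTensorIsometry K (s : UniformSpace.Completion (Fock K ⊗[ℂ] Fock Kᗮ)) = fockTensorAlg K s :=
  ContinuousLinearMap.extend_eq (fockTensorAlg K).toContinuousLinearMap
        (e := UniformSpace.Completion.toComplL) UniformSpace.Completion.denseRange_coe
        (UniformSpace.Completion.isUniformInducing_coe _) s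

theorem SlaterSpan.wedgeProd_cons (K : Submodule ℂ H) (k : K) {n : ℕ} (x : Fin n → K)
    (g : SlaterSpan Kᗮ) :
    SlaterSpan.wedgeProd K (.of ⟨n + 1, Fin.cons k x⟩) g =
      SlaterSpan.wedge (k : H) (SlaterSpan.wedgeProd K (.of ⟨n, x⟩) g) := by
  simp only [SlaterSpan.wedgeProd, SlaterSpan.lift_of, LinearMap.comp_apply, SlaterSpan.wedgeAll,
    Fin.cons_zero, Fin.cons_succ]

theorem slater_wedge_mem (K : Submodule ℂ H) [K.HasOrthogonalProjection] {n : ℕ} (z : Fin n → H) :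
    slater z ∈ Submodule.span ℂ {ψ : Fock H | ∃ (n m : ℕ) (x : Fin n → K) (y : Fin m → Kᗮ),
      ψ = fockWedge K (slater x) (slater y)} := by
  set S := Submodule.span ℂ {ψ : Fock H | ∃ (n m : ℕ) (x : Fin n → K) (y : Fin m → Kᗮ),
      ψ = fockWedge K (slater x) (slater y)} with hS
  have hcons : ∀ (k : K) {n : ℕ} (x : Fin n → K) {m : ℕ} (y : Fin m → Kᗮ),
      creation (k : H) (fockWedge K (slater x) (slater y)) =
        fockWedge K (slater (Fin.cons k x : Fin (n + 1) → K)) (slater y) := by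
    intro k n x m y
    simp only [slater, fockWedge_coe, creation_coe, SlaterSpan.wedgeProd_cons]
  have hstable : ∀ h : H, (∀ (n m : ℕ) (x : Fin n → K) (y : Fin m → Kᗮ),
      creation h (fockWedge K (slater x) (slater y)) ∈ S) → ∀ ψ ∈ S, creation h ψ ∈ S := by
    intro h hh ψ hψ
    induction hψ using Submodule.span_induction with
    | mem ψ hψ =>
      obtain ⟨n, m, x, y, rfl⟩ := hψ
      exact hh n m x y
    | zero => simp
    | add _ _ _ _ h1 h2 => rw [map_add]; exact S.add_mem h1 h2
    | smul c _ _ h1 => rw [map_smul]; exact S.smul_mem c h1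
  have hK : ∀ k : K, ∀ ψ ∈ S, creation (k : H) ψ ∈ S := fun k =>
    hstable k fun n m x y => by
      rw [hcons]
      exact Submodule.subset_span ⟨_, _, _, _, rfl⟩
  have hL : ∀ l : Kᗮ, ∀ ψ ∈ S, creation (l : H) ψ ∈ S := fun l =>
    hstable l fun n m x y => by
      induction n with
      | zero =>
        refine Submodule.subset_span ⟨0, m + 1, x, Fin.cons l y, ?_⟩
        simp only [slater, fockWedge_coe, creation_coe, SlaterSpan.wedgeProd, SlaterSpan.lift_of,
          LinearMap.comp_apply, SlaterSpan.wedgeAll, LinearMap.id_apply, SlaterSpan.incl,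
          SlaterSpan.wedge]
        congr 4
        funext i
        refine Fin.cases ?_ (fun i => ?_) i <;> simp
      | succ n ih =>
        rw [← Fin.cons_self_tail x, ← hcons, creation_anticomm]
        exact S.neg_mem (hK _ _ (ih _))
  induction n with
  | zero =>
    refine Submodule.subset_span ⟨0, 0, Fin.elim0, Fin.elim0, ?_⟩
    simp only [slater, fockWedge_coe, SlaterSpan.wedgeProd, SlaterSpan.lift_of,
      LinearMap.comp_apply, SlaterSpan.wedgeAll, LinearMap.id_apply, SlaterSpan.incl]
    congr 3
    exact Subsingleton.elim _ _
  | succ n ih =>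
    rw [← Fin.cons_self_tail z, ← creation_slater]
    obtain ⟨k, hk, l, hl, hkl⟩ := K.exists_add_mem_mem_orthogonal (z 0)
    rw [hkl, creation_add, add_apply]
    exact S.add_mem (hK ⟨k, hk⟩ _ (ih _)) (hL ⟨l, hl⟩ _ (ih _))

theorem fockTensorIsometry_surjective (K : Submodule ℂ H) [K.HasOrthogonalProjection] :
    Function.Surjective (fockTensorIsometry K) := by
  have hcl : IsClosed (Set.range (fockTensorIsometry K)) :=
    (fockTensorIsometry K).isometry.isClosedEmbedding.isClosed_range
  have hsl : ∀ (n : ℕ) (z : Fin n → H), slater z ∈ LinearMap.range (fockTensorIsometry K).toLinearMap := by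
    intro n z
    refine Submodule.span_le.mpr ?_ (slater_wedge_mem K z)
    rintro ψ ⟨n, m, x, y, rfl⟩
    exact ⟨((slater x ⊗ₜ slater y : Fock K ⊗[ℂ] Fock Kᗮ) :
      UniformSpace.Completion (Fock K ⊗[ℂ] Fock Kᗮ)), fockTensorIsometry_coe K _⟩
  intro ψ
  refine UniformSpace.Completion.induction_on
    (p := fun ψ => ψ ∈ Set.range (fockTensorIsometry K)) ψ hcl fun f => ?_
  change _ ∈ LinearMap.range (fockTensorIsometry K).toLinearMap
  induction f using SlaterSpan.induction with
  | h0 =>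
    have h0 : ((0 : SlaterSpan H) : UniformSpace.Completion (SlaterSpan H)) = 0 :=
      UniformSpace.Completion.coe_zero
    rw [h0]
    exact Submodule.zero_mem _
  | hadd f g hf hg =>
    rw [UniformSpace.Completion.coe_add]
    exact Submodule.add_mem _ hf hg
  | hof c x =>
    rw [UniformSpace.Completion.coe_smul]
    exact Submodule.smul_mem _ _ (hsl x.1 x.2)

/-- The canonical unitary `F(K) ⊗ F(Kᗮ) ≃ F(H)`,
`(x₁ ∧ ⋯ ∧ xₙ) ⊗ (y₁ ∧ ⋯ ∧ yₘ) ↦ x₁ ∧ ⋯ ∧ xₙ ∧ y₁ ∧ ⋯ ∧ yₘ`. -/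
noncomputable def fockTensorEquiv (K : Submodule ℂ H) [K.HasOrthogonalProjection] :
    HilbertTensor (Fock K) (Fock Kᗮ) ≃ₗᵢ[ℂ] Fock H :=
  LinearIsometryEquiv.ofSurjective (fockTensorIsometry K) (fockTensorIsometry_surjective K)

/-- The operator on `F(H)` that corresponds to `A ⊗ B` under `F(H) ≃ F(K) ⊗ F(Kᗮ)`. -/
noncomputable def fockProd (K : Submodule ℂ H) [K.HasOrthogonalProjection]
    (A : Fock K →L[ℂ] Fock K) (B : Fock Kᗮ →L[ℂ] Fock Kᗮ) : Fock H →L[ℂ] Fock H :=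
  (fockTensorEquiv K).toContinuousLinearEquiv.toContinuousLinearMap ∘L hilbertTensorMap A B ∘L
    (fockTensorEquiv K).symm.toContinuousLinearEquiv.toContinuousLinearMap

theorem fockProd_fockWedge (K : Submodule ℂ H) [K.HasOrthogonalProjection]
    (A : Fock K →L[ℂ] Fock K) (B : Fock Kᗮ →L[ℂ] Fock Kᗮ) (φ : Fock K) (χ : Fock Kᗮ) :
    fockProd K A B (fockWedge K φ χ) = fockWedge K (A φ) (B χ) := by
  have h1 : ∀ s : Fock K ⊗[ℂ] Fock Kᗮ,
      fockTensorEquiv K (s : UniformSpace.Completion (Fock K ⊗[ℂ] Fock Kᗮ)) = fockTensorAlg K s :=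
    fockTensorIsometry_coe K
  have h2 : (fockTensorEquiv K).symm (fockWedge K φ χ) =
      ((φ ⊗ₜ χ : Fock K ⊗[ℂ] Fock Kᗮ) : UniformSpace.Completion (Fock K ⊗[ℂ] Fock Kᗮ)) := by
    rw [LinearIsometryEquiv.symm_apply_eq, h1, fockTensorAlg_tmul]
  have h3 : hilbertTensorMap A B ((φ ⊗ₜ χ : Fock K ⊗[ℂ] Fock Kᗮ) :
      UniformSpace.Completion (Fock K ⊗[ℂ] Fock Kᗮ)) =
      ((A φ ⊗ₜ B χ : Fock K ⊗[ℂ] Fock Kᗮ) : UniformSpace.Completion (Fock K ⊗[ℂ] Fock Kᗮ)) :=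
    ContinuousLinearMap.extend_eq (UniformSpace.Completion.toComplL ∘L TensorProduct.mapL A B)
      (e := UniformSpace.Completion.toComplL) UniformSpace.Completion.denseRange_coe
      (UniformSpace.Completion.isUniformInducing_coe _) _
  change fockTensorEquiv K (hilbertTensorMap A B ((fockTensorEquiv K).symm _)) = _
  rw [h2, h3, h1, fockTensorAlg_tmul]

end Kernel

section Operators

variable {E : Type*} [NormedAddCommGroup E] [InnerProductSpace ℂ E] [CompleteSpace E]

/-- The index set of a fixed Hilbert basis of `E`. -/
noncomputable def stdIndex (E : Type*) [NormedAddCommGroup E] [InnerProductSpace ℂ E]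
    [CompleteSpace E] : Set E := (exists_hilbertBasis ℂ E).choose

/-- A fixed Hilbert basis of `E`. -/
noncomputable def stdBasis (E : Type*) [NormedAddCommGroup E] [InnerProductSpace ℂ E]
    [CompleteSpace E] : HilbertBasis (stdIndex E) ℂ E :=
  (exists_hilbertBasis ℂ E).choose_spec.choose

/-- The trace of a positive operator, with value `∞` if the operator is not of trace class. -/
noncomputable def posTrace (T : E →L[ℂ] E) : ENNReal :=
  ∑' i, ENNReal.ofReal (inner ℂ (stdBasis E i) (T (stdBasis E i)) : ℂ).re

/-- The trace of a trace class operator. -/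
noncomputable def opTrace (T : E →L[ℂ] E) : ℂ :=
  ∑' i, (inner ℂ (stdBasis E i) (T (stdBasis E i)) : ℂ)

/-- Density operators: positive operators of trace one. -/
structure IsDensityOperator (D : E →L[ℂ] E) : Prop where
  isPositive : D.IsPositive
  trace_eq_one : posTrace D = 1

/-- A spectral decomposition of an operator: a Hilbert basis of eigenvectors with real
eigenvalues. Every positive (or self-adjoint) trace class operator has one. -/
structure EigenBasis (T : E →L[ℂ] E) where
  index : Set E
  basis : HilbertBasis index ℂ E
  eigenvalue : index → ℝ
  apply_basis : ∀ i, T (basis i) = (eigenvalue i : ℂ) • basis i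

/-- The sum `∑_{j,k} |⟨φⱼ, ψₖ⟩|² (dⱼ log dⱼ - dⱼ log gₖ + gₖ - dⱼ)` over two eigenbases. Each term
is nonnegative if `D` and `G` are density operators with `ker G ⊆ ker D`; the terms with `gₖ = 0`
then vanish. -/
noncomputable def EigenBasis.entropySum {D G : E →L[ℂ] E} (φ : EigenBasis D) (ψ : EigenBasis G) :
    ENNReal :=
  ∑' j, ∑' k, ENNReal.ofReal (‖(inner ℂ (φ.basis j) (ψ.basis k) : ℂ)‖ ^ 2 *
    (φ.eigenvalue j * Real.log (φ.eigenvalue j) - φ.eigenvalue j * Real.log (ψ.eigenvalue k)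
      + ψ.eigenvalue k - φ.eigenvalue j))

open Classical in
/-- The relative entropy `S(D | G) = Tr D (log D - log G) ∈ [0, ∞]` of two density operators: it is
`∞` if the kernel of `G` is not contained in the kernel of `D`, and otherwise it is computed from
the spectral decompositions of `D` and `G`. -/
noncomputable def relEntropy (D G : E →L[ℂ] E) : ENNReal :=
  if h : LinearMap.ker G.toLinearMap ≤ LinearMap.ker D.toLinearMap ∧
      Nonempty (EigenBasis D) ∧ Nonempty (EigenBasis G) then
    EigenBasis.entropySum (Classical.choice h.2.1) (Classical.choice h.2.2)
  else ⊤

end Operators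

section States

variable {H : Type*} [NormedAddCommGroup H] [InnerProductSpace ℂ H] [CompleteSpace H]

/-- The number operator `N = ∑ⱼ a†(fⱼ) a(fⱼ)`, for a Hilbert basis `f` of `H`, as an unbounded
operator whose domain consists of all vectors for which the series converges. -/
noncomputable def numberOp (H : Type*) [NormedAddCommGroup H] [InnerProductSpace ℂ H]
    [CompleteSpace H] : Fock H →ₗ.[ℂ] Fock H where
  domain :=
    { carrier := {ψ | Summable fun j => creation (stdBasis H j) (annihilation (stdBasis H j) ψ)}
      add_mem' := fun {φ ψ} hφ hψ => by simpa using Summable.add hφ hψ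
      zero_mem' := by simp
      smul_mem' := fun c ψ hψ => by simpa using Summable.const_smul c hψ }
  toFun :=
    { toFun := fun ψ => ∑' j, creation (stdBasis H j) (annihilation (stdBasis H j) (ψ : Fock H))
      map_add' := fun φ ψ => by
        simpa using Summable.tsum_add φ.2 ψ.2
      map_smul' := fun c ψ => by
        simpa using Summable.tsum_const_smul c ψ.2 }

/-- `Tr(Δ N) = ∑ⱼ Tr(Δ a†(fⱼ) a(fⱼ)) ∈ [0, ∞]`, for a density operator `Δ`. -/
noncomputable def expectedNumber (Δ : Fock H →L[ℂ] Fock H) : ENNReal :=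
  ∑' j, ENNReal.ofReal
    (opTrace (Δ ∘L creation (stdBasis H j) ∘L annihilation (stdBasis H j))).re

/-- The class of density operators on Fock space that commute with the number operator and have
finite expected particle number. A bounded operator `Δ` commutes with the unbounded operator `N`
if `Δ N ⊆ N Δ`. -/
structure ClassD (Δ : Fock H →L[ℂ] Fock H) : Prop where
  isDensityOperator : IsDensityOperator Δ
  commute : ∀ ψ : (numberOp H).domain, ∃ h : Δ ψ ∈ (numberOp H).domain,
    numberOp H ⟨Δ ψ, h⟩ = Δ (numberOp H ψ)
  expectedNumber_lt_top : expectedNumber Δ < ⊤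

open Classical in
/-- The one-particle statistical operator `γ` of a density operator `Δ` on Fock space: the unique
bounded operator on `H` with `⟨h, γ g⟩ = Tr(Δ a†(g) a(h))` for all `g`, `h`. -/
noncomputable def oneParticleOp (Δ : Fock H →L[ℂ] Fock H) : H →L[ℂ] H :=
  if h : ∃ γ : H →L[ℂ] H, ∀ g h : H,
      (inner ℂ h (γ g) : ℂ) = opTrace (Δ ∘L creation g ∘L annihilation h) then
    h.choose
  else 0

/-- The weight `p(s) = ∏_{i ∈ s} pᵢ ∏_{j ∉ s} (1 - pⱼ)`. -/
noncomputable def EigenBasis.weight {γ : H →L[ℂ] H} (b : EigenBasis γ) (s : Finset b.index) : ℝ :=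
  (∏ i ∈ s, b.eigenvalue i) * ∏' j : {j : b.index // j ∉ s}, (1 - b.eigenvalue j)

/-- The Slater determinant of the eigenvectors with index in `s`. (The order of the factors
affects only its sign.) -/
noncomputable def EigenBasis.slaterVec {γ : H →L[ℂ] H} (b : EigenBasis γ) (s : Finset b.index) :
    Fock H :=
  slater fun i : Fin s.card => b.basis (s.equivFin.symm i : b.index)

open Classical in
/-- The density operator `Γ_γ` of the free state with one-particle operator `γ`,
`∑ₛ p(s) |fₛ⟩⟨fₛ|`, where `fₛ` runs over all Slater determinants of finitely many vectors of an
eigenbasis of `γ`. (If an eigenvector in `s` has eigenvalue `0`, then `p(s) = 0`.) -/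
noncomputable def freeState (γ : H →L[ℂ] H) : Fock H →L[ℂ] Fock H :=
  if h : Nonempty (EigenBasis γ) then
    ∑' s : Finset (Classical.choice h).index, (((Classical.choice h).weight s : ℝ) : ℂ) •
      InnerProductSpace.rankOne ℂ ((Classical.choice h).slaterVec s)
        ((Classical.choice h).slaterVec s)
  else 0

/-- The nonfreeness of a state: its entropy relative to the free state with the same one-particle
statistical operator. -/
noncomputable def nonfreeness (Δ : Fock H →L[ℂ] Fock H) : ENNReal :=
  relEntropy Δ (freeState (oneParticleOp Δ))

/-- The operator `γ₁ ⊕ γ₂` on `H = K ⊕ Kᗮ`. -/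
noncomputable def opDirectSum (K : Submodule ℂ H) [K.HasOrthogonalProjection]
    (γ₁ : K →L[ℂ] K) (γ₂ : Kᗮ →L[ℂ] Kᗮ) : H →L[ℂ] H :=
  K.subtypeL ∘L γ₁ ∘L K.orthogonalProjectionOnto +
    Kᗮ.subtypeL ∘L γ₂ ∘L Kᗮ.orthogonalProjectionOnto

end States

end Nonfreeness

/-! Everything is diagonalised. A density operator is compact, because its square root is
Hilbert–Schmidt, so it has a Hilbert basis of eigenvectors. If `φᵢ` and `χⱼ` are eigenbases of Δ₁
and Δ₂ with eigenvalues `dᵢ` and `eⱼ`, then the vectors `φᵢ ∧ χⱼ` form an eigenbasis of the product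
with eigenvalues `dᵢ eⱼ`. Trace one and the finite expected particle number follow. Commuting with
`N` amounts to preserving every particle-number sector (`commute_numberOp_iff`), which can be tested
on products of Slater determinants.

The one-particle operator of the product is `γ₁ ⊕ γ₂` (`oneParticleOp_fockProd`). If `g` and `h` lie
in the same summand, `a†(g) a(h)` acts on one tensor factor only. If they lie in different summands,
it changes the particle number of each factor by one, and its expectation vanishes because Δ₁ and Δ₂
preserve sectors.

The free state of `γ₁ ⊕ γ₂` factorises (`freeState_opDirectSum`). The Slater determinants of the
union of two eigenbases are, up to sign, the products of the Slater determinants of each, and the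
weight of a disjoint union of index sets is the product of the weights.

For the entropy (`relEntropy_fockProd`), let `η(d, g) = d log d - d log g + g - d`. The relative
entropy is the sum of `|⟨φ, ψ⟩|² η(d, g)` over two eigenbases. On products the overlaps multiply,
and `entropyDensity_mul` expands `η(d e, g h)` into `η(d, g) e + d η(e, h)` plus terms whose total
weights are all 1 by normalisation and cancel. If the kernel condition fails for the product, it
fails for a factor, and both sides are infinite.

The free state and the entropy are defined through arbitrarily chosen eigenbases, whereas the
argument needs product bases. Independence of the choice rests on `tsum_label`,
`tsum_label_indicator` and `freeState_slaterBasis`. -/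

namespace Nonfreeness

open scoped ComplexOrder InnerProductSpace
open Filter Topology

/-! ### Parseval sums and labelled Hilbert bases -/

section HilbertBases

variable {E : Type*} [NormedAddCommGroup E] [InnerProductSpace ℂ E]
variable {ι κ : Type*}

theorem hasSum_norm_inner_sq (b : HilbertBasis ι ℂ E) (v : E) :
    HasSum (fun i => ‖(inner ℂ (b i) v : ℂ)‖ ^ 2) (‖v‖ ^ 2) := by
  have h := b.hasSum_inner_mul_inner v v
  rw [inner_self_eq_norm_sq_to_K] at h
  have h2 := Complex.hasSum_re h
  convert h2 using 1
  · funext i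
    rw [← inner_conj_symm v (b i), ← Complex.normSq_eq_conj_mul_self, Complex.ofReal_re,
      Complex.normSq_eq_norm_sq]
  · norm_cast

theorem tsum_ofReal_norm_inner_sq (b : HilbertBasis ι ℂ E) (v : E) :
    ∑' i, ENNReal.ofReal (‖(inner ℂ (b i) v : ℂ)‖ ^ 2) = ENNReal.ofReal (‖v‖ ^ 2) := by
  rw [← ENNReal.ofReal_tsum_of_nonneg (fun _ => by positivity) (hasSum_norm_inner_sq b v).summable,
    (hasSum_norm_inner_sq b v).tsum_eq]

theorem norm_basis (b : HilbertBasis ι ℂ E) (i : ι) : ‖b i‖ = 1 := b.orthonormal.1 i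

open Classical in
theorem inner_basis (b : HilbertBasis ι ℂ E) (i j : ι) :
    (inner ℂ (b i) (b j) : ℂ) = if i = j then 1 else 0 :=
  orthonormal_iff_ite.mp b.orthonormal i j

theorem ext_inner_basis (b : HilbertBasis ι ℂ E) {v w : E}
    (h : ∀ i, (inner ℂ (b i) v : ℂ) = inner ℂ (b i) w) : v = w := by
  apply b.repr.injective
  ext i
  rw [b.repr_apply_apply, b.repr_apply_apply, h]

theorem ext_clm_basis {F : Type*} [NormedAddCommGroup F] [NormedSpace ℂ F]
    (b : HilbertBasis ι ℂ E) {S T : E →L[ℂ] F} (h : ∀ i, S (b i) = T (b i)) : S = T :=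
  ContinuousLinearMap.ext_on (Submodule.dense_iff_topologicalClosure_eq_top.mpr b.dense_span) (by
    rintro _ ⟨i, rfl⟩
    exact h i)

theorem hasSum_basis (b : HilbertBasis ι ℂ E) (v : E) :
    HasSum (fun i => (inner ℂ (b i) v : ℂ) • b i) v := by
  simpa only [b.repr_apply_apply] using b.hasSum_repr v

-- Expand `‖P_c v‖²` by Parseval in `e`. Since `P_c` is self-adjoint, `⟨eᵢ, P_c v⟩ = ⟨P_c eᵢ, v⟩`,
-- which survives only for `c = m i`.
open Classical in
theorem tsum_label_eq_tsum_starProjection {L : Type*} (e : HilbertBasis ι ℂ E) (m : ι → L)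
    (S : L → Submodule ℂ E) [∀ c, (S c).HasOrthogonalProjection]
    (hm : ∀ c i, (S c).starProjection (e i) = if m i = c then e i else 0) (f : L → ENNReal) (v : E) :
    ∑' i, f (m i) * ENNReal.ofReal (‖(inner ℂ (e i) v : ℂ)‖ ^ 2) =
      ∑' c, f c * ENNReal.ofReal (‖(S c).starProjection v‖ ^ 2) := by
  simp_rw [← tsum_ofReal_norm_inner_sq e, ← ENNReal.tsum_mul_left]
  rw [ENNReal.tsum_comm]
  refine tsum_congr fun i => ?_
  rw [tsum_eq_single (m i)]
  · rw [← Submodule.inner_starProjection_left_eq_right, hm, if_pos rfl]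
  · intro c hc
    rw [← Submodule.inner_starProjection_left_eq_right, hm, if_neg (Ne.symm hc)]
    simp

/-- Both labelled bases resolve the same family of orthogonal subspaces, one for each label, and
each sum equals `∑ f(c) ‖P_c v‖²`. With eigenvalues as labels this makes spectral sums independent
of the eigenbasis; with particle numbers as labels it does the same for the number operator. -/
theorem tsum_label [CompleteSpace E] {L : Type*} (b : HilbertBasis ι ℂ E) (b' : HilbertBasis κ ℂ E)
    (l : ι → L) (l' : κ → L) (h : ∀ i k, (inner ℂ (b i) (b' k) : ℂ) ≠ 0 → l i = l' k)
    (f : L → ENNReal) (v : E) :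
    ∑' i, f (l i) * ENNReal.ofReal (‖(inner ℂ (b i) v : ℂ)‖ ^ 2) =
      ∑' k, f (l' k) * ENNReal.ofReal (‖(inner ℂ (b' k) v : ℂ)‖ ^ 2) := by
  classical
  -- As an orthogonal complement the subspace is closed, so its projection exists without further
  -- work.
  let S : L → Submodule ℂ E := fun c => (Submodule.span ℂ (b '' {i | l i ≠ c}))ᗮ
  have hS : ∀ c w, w ∈ S c ↔ ∀ i, l i ≠ c → (inner ℂ (b i) w : ℂ) = 0 := by
    intro c w
    simp only [S, Submodule.mem_orthogonal]
    constructor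
    · intro hw i hi
      exact hw _ (Submodule.subset_span ⟨i, hi, rfl⟩)
    · intro hw u hu
      induction hu using Submodule.span_induction with
      | mem u hu => obtain ⟨i, hi, rfl⟩ := hu; exact hw i hi
      | zero => simp
      | add _ _ _ _ h1 h2 => rw [inner_add_left, h1, h2, add_zero]
      | smul a _ _ h1 => rw [inner_smul_left, h1, mul_zero]
  have hproj : ∀ c i, (S c).starProjection (b i) = if l i = c then b i else 0 := by
    intro c i
    split_ifs with hi
    · rw [Submodule.starProjection_eq_self_iff, hS]
      intro j hj
      rw [inner_basis, if_neg]
      rintro rfl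
      exact hj hi
    · rw [Submodule.starProjection_apply_eq_zero_iff]
      exact Submodule.le_orthogonal_orthogonal _ (Submodule.subset_span ⟨i, hi, rfl⟩)
  have hproj' : ∀ c k, (S c).starProjection (b' k) = if l' k = c then b' k else 0 := by
    intro c k
    split_ifs with hk
    · rw [Submodule.starProjection_eq_self_iff, hS]
      intro j hj
      by_contra h0
      exact hj ((h j k h0).trans hk)
    · rw [Submodule.starProjection_apply_eq_zero_iff, Submodule.mem_orthogonal]
      intro u hu
      rw [hS] at hu
      rw [← b.tsum_inner_mul_inner]
      convert tsum_zero with i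
      by_cases hi : l i = c
      · have : (inner ℂ (b i) (b' k) : ℂ) = 0 := by
          by_contra h0
          exact hk ((h i k h0).symm.trans hi)
        rw [this, mul_zero]
      · rw [← inner_conj_symm, hu i hi, map_zero, zero_mul]
  rw [tsum_label_eq_tsum_starProjection b l S hproj, tsum_label_eq_tsum_starProjection b' l' S hproj']

/-- Insert `1 = ∑ₖ |⟨b'ₖ, bᵢ⟩|²` and exchange the sums; only pairs with equal labels contribute.
This yields the invariance of multiplicities and of traces. -/
theorem tsum_label_indicator (b : HilbertBasis ι ℂ E) (b' : HilbertBasis κ ℂ E) {L : Type*}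
    (l : ι → L) (l' : κ → L) (h : ∀ i k, (inner ℂ (b i) (b' k) : ℂ) ≠ 0 → l i = l' k)
    (f : L → ENNReal) : ∑' i, f (l i) = ∑' k, f (l' k) := by
  have h1 : ∀ i, f (l i) = ∑' k, f (l i) * ENNReal.ofReal (‖(inner ℂ (b' k) (b i) : ℂ)‖ ^ 2) := by
    intro i
    rw [ENNReal.tsum_mul_left, tsum_ofReal_norm_inner_sq, norm_basis]
    simp
  have h2 : ∀ k, f (l' k) = ∑' i, f (l' k) * ENNReal.ofReal (‖(inner ℂ (b i) (b' k) : ℂ)‖ ^ 2) := by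
    intro k
    rw [ENNReal.tsum_mul_left, tsum_ofReal_norm_inner_sq, norm_basis]
    simp
  rw [tsum_congr h1, ENNReal.tsum_comm]
  refine tsum_congr fun k => ?_
  rw [h2]
  refine tsum_congr fun i => ?_
  rw [norm_inner_symm]
  by_cases h0 : (inner ℂ (b i) (b' k) : ℂ) = 0
  · simp [h0]
  · rw [h i k h0]

end HilbertBases

/-! ### Operators with an eigenbasis: positivity and traces -/

section Eigenbases

variable {E : Type*} [NormedAddCommGroup E] [InnerProductSpace ℂ E]
variable {ι κ : Type*} {T : E →L[ℂ] E} {b : HilbertBasis ι ℂ E} {p : ι → ℝ}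
  {b' : HilbertBasis κ ℂ E} {p' : κ → ℝ}

theorem inner_eigenbasis_apply (hb : ∀ i, T (b i) = (p i : ℂ) • b i) (i : ι) (v : E) :
    (inner ℂ (b i) (T v) : ℂ) = p i * inner ℂ (b i) v := by
  have h : (innerSL ℂ (b i)) ∘L T = (p i : ℂ) • innerSL ℂ (b i) := by
    refine ext_clm_basis b fun j => ?_
    simp only [ContinuousLinearMap.comp_apply, hb, map_smul, innerSL_apply_apply, inner_basis,
      smul_apply, smul_eq_mul]
    split_ifs with hij
    · rw [hij]
    · simp
  simpa using congrArg (fun S : E →L[ℂ] ℂ => S v) h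

theorem isSymmetric_of_eigenbasis (hb : ∀ i, T (b i) = (p i : ℂ) • b i) (v w : E) :
    (inner ℂ (T v) w : ℂ) = inner ℂ v (T w) := by
  rw [← b.tsum_inner_mul_inner, ← b.tsum_inner_mul_inner v]
  refine tsum_congr fun i => ?_
  rw [inner_eigenbasis_apply hb, ← inner_conj_symm, inner_eigenbasis_apply hb, map_mul,
    inner_conj_symm, Complex.conj_ofReal]
  ring

theorem eigenvalue_eq_of_inner_ne_zero (hb : ∀ i, T (b i) = (p i : ℂ) • b i)
    (hb' : ∀ i, T (b' i) = (p' i : ℂ) • b' i) (i : ι) (k : κ)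
    (h : (inner ℂ (b i) (b' k) : ℂ) ≠ 0) : p i = p' k := by
  have h1 := inner_eigenbasis_apply hb i (b' k)
  rw [hb', inner_smul_right] at h1
  exact_mod_cast (mul_right_cancel₀ h h1).symm

theorem hasSum_inner_eigenbasis (hb : ∀ i, T (b i) = (p i : ℂ) • b i) (v w : E) :
    HasSum (fun i => (p i : ℂ) * (inner ℂ v (b i) * inner ℂ (b i) w)) (inner ℂ v (T w) : ℂ) := by
  have h := b.hasSum_inner_mul_inner v (T w)
  simp_rw [inner_eigenbasis_apply hb, mul_left_comm] at h
  exact h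

theorem re_inner_eigenbasis (hb : ∀ i, T (b i) = (p i : ℂ) • b i) (v : E) :
    HasSum (fun i => p i * ‖(inner ℂ (b i) v : ℂ)‖ ^ 2) (inner ℂ v (T v) : ℂ).re := by
  refine (Complex.hasSum_re (hasSum_inner_eigenbasis hb v v)).congr_fun fun i => ?_
  rw [← inner_conj_symm v (b i), ← Complex.normSq_eq_conj_mul_self, ← Complex.ofReal_mul,
    Complex.ofReal_re, Complex.normSq_eq_norm_sq]

theorem ofReal_inner_eigenbasis (hb : ∀ i, T (b i) = (p i : ℂ) • b i) (hp : ∀ i, 0 ≤ p i) (v : E) :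
    ENNReal.ofReal (inner ℂ v (T v) : ℂ).re =
      ∑' i, ENNReal.ofReal (p i) * ENNReal.ofReal (‖(inner ℂ (b i) v : ℂ)‖ ^ 2) := by
  have h := re_inner_eigenbasis hb v
  rw [← h.tsum_eq, ENNReal.ofReal_tsum_of_nonneg (fun i => mul_nonneg (hp i) (by positivity))
    h.summable]
  simp_rw [ENNReal.ofReal_mul (hp _)]

theorem isPositive_of_eigenbasis [CompleteSpace E] (hb : ∀ i, T (b i) = (p i : ℂ) • b i)
    (hp : ∀ i, 0 ≤ p i) : T.IsPositive := by
  rw [ContinuousLinearMap.isPositive_def']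
  refine ⟨?_, fun v => ?_⟩
  · rw [ContinuousLinearMap.isSelfAdjoint_iff_isSymmetric]
    exact fun v w => isSymmetric_of_eigenbasis hb v w
  · rw [ContinuousLinearMap.reApplyInnerSelf_apply, inner_re_symm]
    exact (re_inner_eigenbasis hb v).nonneg fun i => mul_nonneg (hp i) (by positivity)

theorem eigenvalue_nonneg (hT : T.IsPositive) (hb : ∀ i, T (b i) = (p i : ℂ) • b i) (i : ι) :
    0 ≤ p i := by
  have h := hT.re_inner_nonneg_right (b i)
  rw [hb, inner_smul_right, inner_self_eq_norm_sq_to_K, norm_basis] at h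
  simpa using h

theorem posTrace_eq_tsum [CompleteSpace E] (hb : ∀ i, T (b i) = (p i : ℂ) • b i)
    (hp : ∀ i, 0 ≤ p i) : posTrace T = ∑' i, ENNReal.ofReal (p i) := by
  unfold posTrace
  simp_rw [ofReal_inner_eigenbasis hb hp]
  rw [ENNReal.tsum_comm]
  refine tsum_congr fun i => ?_
  simp_rw [norm_inner_symm (b i)]
  rw [ENNReal.tsum_mul_left, tsum_ofReal_norm_inner_sq, norm_basis]
  simp

theorem summable_of_posTrace [CompleteSpace E] (hb : ∀ i, T (b i) = (p i : ℂ) • b i)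
    (hp : ∀ i, 0 ≤ p i) (hT : posTrace T ≠ ⊤) : Summable p := by
  rw [posTrace_eq_tsum hb hp] at hT
  have := ENNReal.summable_toReal hT
  simpa only [ENNReal.toReal_ofReal (hp _)] using this

theorem hasSum_of_posTrace [CompleteSpace E] (hb : ∀ i, T (b i) = (p i : ℂ) • b i)
    (hp : ∀ i, 0 ≤ p i) (hT : posTrace T = 1) : HasSum p 1 := by
  have hs := summable_of_posTrace hb hp (by simp [hT])
  rw [posTrace_eq_tsum hb hp, ← ENNReal.ofReal_tsum_of_nonneg hp hs] at hT
  rw [hs.hasSum_iff]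
  simpa using hT

theorem summable_inner_mul_inner_norm (e : HilbertBasis κ ℂ E) (v w : E) :
    Summable (fun i => ‖(inner ℂ v (e i) : ℂ) * inner ℂ (e i) w‖) ∧
      ∑' i, ‖(inner ℂ v (e i) : ℂ) * inner ℂ (e i) w‖ ≤ ‖v‖ * ‖w‖ := by
  have h1 : HasSum (fun i => ‖(inner ℂ v (e i) : ℂ)‖ ^ (2 : ℝ)) (‖v‖ ^ (2 : ℝ)) := by
    simpa [norm_inner_symm v] using hasSum_norm_inner_sq e v
  have h2 : HasSum (fun i => ‖(inner ℂ (e i) w : ℂ)‖ ^ (2 : ℝ)) (‖w‖ ^ (2 : ℝ)) := by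
    simpa using hasSum_norm_inner_sq e w
  obtain ⟨C, -, hC, h⟩ := Real.inner_le_Lp_mul_Lq_hasSum_of_nonneg Real.HolderConjugate.two_two
    (norm_nonneg v) (norm_nonneg w) (fun _ => norm_nonneg _) (fun _ => norm_nonneg _) h1 h2
  simp only [norm_mul]
  exact ⟨h.summable, h.tsum_eq.trans_le hC⟩

/-- The double series `pᵢ ⟨X* bᵢ, eₖ⟩ ⟨eₖ, bᵢ⟩` converges absolutely: by Cauchy–Schwarz its `i`-th
row has norm sum at most `pᵢ ‖X*‖`. Summing in the two orders gives the two sides. The value does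
not involve `e`, so the trace can be computed in any Hilbert basis. -/
theorem hasSum_trace_comp (hb : ∀ i, T (b i) = (p i : ℂ) • b i) (hp : ∀ i, 0 ≤ p i)
    (hs : Summable p) (X : E →L[ℂ] E) (e : HilbertBasis κ ℂ E) [CompleteSpace E] :
    HasSum (fun k => (inner ℂ (e k) (T (X (e k))) : ℂ))
      (∑' i, (p i : ℂ) * inner ℂ (b i) (X (b i))) := by
  set F : ι × κ → ℂ := fun q => (p q.1 : ℂ) *
    (inner ℂ (ContinuousLinearMap.adjoint X (b q.1)) (e q.2) * inner ℂ (e q.2) (b q.1)) with hF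
  have hbound : ∀ i, ‖ContinuousLinearMap.adjoint X (b i)‖ * ‖b i‖ ≤
      ‖ContinuousLinearMap.adjoint X‖ := by
    intro i
    have := (ContinuousLinearMap.adjoint X).le_opNorm (b i)
    rw [norm_basis, mul_one] at this ⊢
    exact this
  have hFs : Summable F := by
    apply Summable.of_norm
    rw [summable_prod_of_nonneg (fun _ => norm_nonneg _)]
    constructor
    · intro i
      simp only [hF]
      simp_rw [norm_mul (p _ : ℂ)]
      exact (summable_inner_mul_inner_norm e _ _).1.mul_left _
    · simp only [hF]
      simp_rw [norm_mul (p _ : ℂ), tsum_mul_left, Complex.norm_real, Real.norm_of_nonneg (hp _)]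
      refine Summable.of_nonneg_of_le (fun i => mul_nonneg (hp i)
        (tsum_nonneg fun _ => norm_nonneg _)) (fun i => ?_)
        (hs.mul_right ‖ContinuousLinearMap.adjoint X‖)
      exact mul_le_mul_of_nonneg_left
        ((summable_inner_mul_inner_norm e _ _).2.trans (hbound i)) (hp i)
  have h1 : ∀ i, HasSum (fun k => F (i, k)) ((p i : ℂ) * inner ℂ (b i) (X (b i))) := by
    intro i
    have := (e.hasSum_inner_mul_inner (ContinuousLinearMap.adjoint X (b i)) (b i)).mul_left
      (p i : ℂ)
    rwa [ContinuousLinearMap.adjoint_inner_left] at this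
  have h2 : ∀ k, HasSum (fun i => F (i, k)) (inner ℂ (e k) (T (X (e k))) : ℂ) := by
    intro k
    convert hasSum_inner_eigenbasis hb (e k) (X (e k)) using 1
    funext i
    simp only [hF, ContinuousLinearMap.adjoint_inner_left]
    ring
  have h3 := hFs.hasSum.prod_fiberwise h1
  have h4 := HasSum.prod_fiberwise ((Equiv.prodComm κ ι).hasSum_iff.mpr hFs.hasSum) h2
  rwa [h3.tsum_eq]

theorem opTrace_comp_eq_tsum (hb : ∀ i, T (b i) = (p i : ℂ) • b i) (hp : ∀ i, 0 ≤ p i)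
    (hs : Summable p) (X : E →L[ℂ] E) [CompleteSpace E] :
    opTrace (T ∘L X) = ∑' i, (p i : ℂ) * inner ℂ (b i) (X (b i)) :=
  (hasSum_trace_comp hb hp hs X (stdBasis E)).tsum_eq

theorem opTrace_comp_eq_tsum_basis (hb : ∀ i, T (b i) = (p i : ℂ) • b i) (hp : ∀ i, 0 ≤ p i)
    (hs : Summable p) (X : E →L[ℂ] E) (e : HilbertBasis κ ℂ E) [CompleteSpace E] :
    HasSum (fun k => (inner ℂ (e k) (T (X (e k))) : ℂ)) (opTrace (T ∘L X)) := by
  rw [opTrace_comp_eq_tsum hb hp hs]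
  exact hasSum_trace_comp hb hp hs X e

theorem norm_inner_clm_le (X : E →L[ℂ] E) (i : ι) (b : HilbertBasis ι ℂ E) :
    ‖(inner ℂ (b i) (X (b i)) : ℂ)‖ ≤ ‖X‖ := by
  refine (norm_inner_le_norm _ _).trans ?_
  have := X.le_opNorm (b i)
  rw [norm_basis, mul_one] at this
  rwa [norm_basis, one_mul]

theorem summable_trace (hp : ∀ i, 0 ≤ p i) (hs : Summable p) (X : E →L[ℂ] E) :
    Summable fun i => (p i : ℂ) * inner ℂ (b i) (X (b i)) := by
  refine Summable.of_norm_bounded (hs.mul_right ‖X‖) fun i => ?_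
  rw [norm_mul, Complex.norm_real, Real.norm_of_nonneg (hp i)]
  exact mul_le_mul_of_nonneg_left (norm_inner_clm_le X i b) (hp i)

end Eigenbases

/-! ### Positive trace class operators are compact and have eigenbases -/

section Compactness

variable {E : Type*} [NormedAddCommGroup E] [InnerProductSpace ℂ E]
variable {ι κ : Type*}

/-- Cauchy–Schwarz applied to the tail of `A v = ∑ ⟨bᵢ, v⟩ A bᵢ`. -/
theorem norm_sum_smul_le_of_summable (A : E →L[ℂ] E) (b : HilbertBasis ι ℂ E)
    (hA : Summable fun i => ‖A (b i)‖ ^ 2) (J : Finset ι) (v : E) :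
    ‖A v - ∑ i ∈ J, (inner ℂ (b i) v : ℂ) • A (b i)‖ ≤
      √(∑' i : {i // i ∉ J}, ‖A (b i)‖ ^ 2) * ‖v‖ := by
  have h1 : HasSum (fun i => (inner ℂ (b i) v : ℂ) • A (b i)) (A v) := by
    simpa using (hasSum_basis b v).mapL A
  have h2 : HasSum (fun i : {i // i ∉ J} => (inner ℂ (b i) v : ℂ) • A (b i))
      (A v - ∑ i ∈ J, (inner ℂ (b i) v : ℂ) • A (b i)) := by
    refine (Finset.hasSum_compl_iff (f := fun i => (inner ℂ (b i) v : ℂ) • A (b i)) J).mpr ?_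
    rwa [sub_add_cancel]
  have h3 : HasSum (fun i : {i // i ∉ J} => ‖A (b i)‖ ^ (2 : ℝ))
      (√(∑' i : {i // i ∉ J}, ‖A (b i)‖ ^ 2) ^ (2 : ℝ)) := by
    have : 0 ≤ ∑' i : {i // i ∉ J}, ‖A (b i)‖ ^ 2 := tsum_nonneg fun _ => by positivity
    have h := (hA.subtype (fun i => i ∉ J)).hasSum
    rw [Real.rpow_two, Real.sq_sqrt this]
    simp only [Real.rpow_two]
    exact h
  have h4 : Summable (fun i : {i // i ∉ J} => ‖(inner ℂ (b i) v : ℂ)‖ ^ 2) :=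
    (hasSum_norm_inner_sq b v).summable.subtype _
  have h5 : HasSum (fun i : {i // i ∉ J} => ‖(inner ℂ (b i) v : ℂ)‖ ^ (2 : ℝ))
      (√(∑' i : {i // i ∉ J}, ‖(inner ℂ (b i) v : ℂ)‖ ^ 2) ^ (2 : ℝ)) := by
    have : 0 ≤ ∑' i : {i // i ∉ J}, ‖(inner ℂ (b i) v : ℂ)‖ ^ 2 :=
      tsum_nonneg fun _ => by positivity
    simpa [Real.sq_sqrt this] using h4.hasSum
  have h6 : √(∑' i : {i // i ∉ J}, ‖(inner ℂ (b i) v : ℂ)‖ ^ 2) ≤ ‖v‖ := by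
    rw [Real.sqrt_le_left (norm_nonneg v), ← (hasSum_norm_inner_sq b v).tsum_eq]
    exact (hasSum_norm_inner_sq b v).summable.tsum_subtype_le _ {i | i ∉ J} (fun _ => by positivity)
  obtain ⟨C, -, hC, h⟩ := Real.inner_le_Lp_mul_Lq_hasSum_of_nonneg Real.HolderConjugate.two_two
    (Real.sqrt_nonneg _) (Real.sqrt_nonneg _) (fun _ => norm_nonneg _) (fun _ => norm_nonneg _)
    h3 h5
  rw [← h2.tsum_eq]
  refine (tsum_of_norm_bounded h fun i => ?_).trans
    (hC.trans (mul_le_mul_of_nonneg_left h6 (Real.sqrt_nonneg _)))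
  rw [norm_smul, mul_comm]

variable [CompleteSpace E]

/-- A Hilbert–Schmidt operator is the norm limit of its finite-rank truncations, by the tail bound
above. -/
theorem isCompactOperator_of_summable (A : E →L[ℂ] E) (b : HilbertBasis ι ℂ E)
    (hA : Summable fun i => ‖A (b i)‖ ^ 2) : IsCompactOperator A := by
  let F : Finset ι → E →L[ℂ] E := fun J => ∑ i ∈ J, (innerSL ℂ (b i)).smulRight (A (b i))
  refine isCompactOperator_of_tendsto (l := atTop) (F := F) ?_ (Eventually.of_forall fun J => ?_)
  · rw [tendsto_iff_norm_sub_tendsto_zero]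
    have h0 : Tendsto (fun J : Finset ι => √(∑' i : {i // i ∉ J}, ‖A (b i)‖ ^ 2)) atTop (𝓝 0) := by
      have := (Real.continuous_sqrt.tendsto 0).comp
        (tendsto_tsum_compl_atTop_zero fun i => ‖A (b i)‖ ^ 2)
      rwa [Real.sqrt_zero] at this
    refine squeeze_zero (fun _ => norm_nonneg _) (fun J => ?_) h0
    refine ContinuousLinearMap.opNorm_le_bound _ (Real.sqrt_nonneg _) fun v => ?_
    rw [sub_apply, norm_sub_rev]
    have hF : F J v = ∑ i ∈ J, (inner ℂ (b i) v : ℂ) • A (b i) := by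
      simp [F]
    rw [hF]
    exact norm_sum_smul_le_of_summable A b hA J v
  · simp only [F]
    induction J using Finset.cons_induction with
    | empty => simpa using isCompactOperator_zero
    | cons i J hi ih =>
      rw [Finset.sum_cons]
      refine IsCompactOperator.add ?_ ih
      have h1 : IsCompactOperator (ContinuousLinearMap.toSpanSingleton ℂ (A (b i))) :=
        isCompactOperator_of_locallyCompactSpace_rng
          (ContinuousLinearMap.toSpanSingleton ℂ (A (b i)))
      exact h1.comp_clm (innerSL ℂ (b i))

/-- For `A = √T` one has `∑ ‖A eᵢ‖² = Tr T < ∞`, so `A` is Hilbert–Schmidt, hence compact, and so is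
`T = A A`. -/
theorem isCompactOperator_of_posTrace {T : E →L[ℂ] E} (hT : T.IsPositive) (h : posTrace T ≠ ⊤) :
    IsCompactOperator T := by
  have hT0 : 0 ≤ T := (ContinuousLinearMap.nonneg_iff_isPositive T).mpr hT
  set A := CFC.sqrt T with hA
  have hA0 : 0 ≤ A := CFC.sqrt_nonneg T
  have hAA : A * A = T := CFC.sqrt_mul_sqrt_self T hT0
  have hAs : A.IsPositive := (ContinuousLinearMap.nonneg_iff_isPositive A).mp hA0
  have h1 : ∀ v, ENNReal.ofReal (inner ℂ v (T v) : ℂ).re = ENNReal.ofReal (‖A v‖ ^ 2) := by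
    intro v
    rw [← hAA, mul_apply_eq_comp, ← ContinuousLinearMap.coe_coe A, ← hAs.isSymmetric, inner_self_eq_norm_sq_to_K]
    congr 1
    norm_cast
  unfold posTrace at h
  simp_rw [h1] at h
  have h2 : Summable fun i => ‖A (stdBasis E i)‖ ^ 2 := by
    have := ENNReal.summable_toReal h
    simpa only [ENNReal.toReal_ofReal (sq_nonneg _)] using this
  have h3 := isCompactOperator_of_summable A _ h2
  have h4 := h3.comp_clm A
  rw [← hAA]
  exact h4

/-- A Hilbert basis with its index set changed along an equivalence. -/
noncomputable def reindexBasis (b : HilbertBasis ι ℂ E) (e : κ ≃ ι) : HilbertBasis κ ℂ E :=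
  HilbertBasis.mk (b.orthonormal.comp e e.injective) (by
    rw [e.surjective.range_comp, b.dense_span])

theorem reindexBasis_apply (b : HilbertBasis ι ℂ E) (e : κ ≃ ι) (k : κ) :
    reindexBasis b e k = b (e k) :=
  congrFun (HilbertBasis.coe_mk _ _) k

/-- An indexed Hilbert basis of eigenvectors, as an `EigenBasis`. -/
noncomputable def EigenBasis.ofHilbertBasis {T : E →L[ℂ] E} (b : HilbertBasis ι ℂ E) (p : ι → ℝ)
    (hb : ∀ i, T (b i) = (p i : ℂ) • b i) : EigenBasis T where
  index := Set.range b
  basis := reindexBasis b (Equiv.ofInjective b b.orthonormal.linearIndependent.injective).symm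
  eigenvalue := p ∘ (Equiv.ofInjective b b.orthonormal.linearIndependent.injective).symm
  apply_basis := fun i => by
    rw [reindexBasis_apply, hb]
    rfl

/-- By the spectral theorem for compact self-adjoint operators the eigenspaces are mutually
orthogonal with trivial joint complement. Hilbert bases of the individual eigenspaces therefore
combine to one of `E`. -/
theorem exists_eigenbasis {T : E →L[ℂ] E} (hT : T.IsPositive) (h : posTrace T ≠ ⊤) :
    Nonempty (EigenBasis T) := by
  have hc := isCompactOperator_of_posTrace hT h
  have hs : T.IsSymmetric := hT.isSymmetric
  have htop := ContinuousLinearMap.orthogonalComplement_iSup_eigenspaces_eq_bot hc hs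
  have hof : OrthogonalFamily ℂ
      (fun μ : ℂ => Module.End.eigenspace (T : Module.End ℂ E) μ) fun μ => Submodule.subtypeₗᵢ _ :=
    hs.orthogonalFamily_eigenspaces
  have hcl : ∀ μ : ℂ, IsClosed (Module.End.eigenspace (T : Module.End ℂ E) μ : Set E) := by
    intro μ
    have : (Module.End.eigenspace (T : Module.End ℂ E) μ : Set E) = {v | T v = μ • v} := by
      ext v
      simp
    rw [this]
    exact isClosed_eq T.continuous (continuous_const_smul μ)
  have hcomp : ∀ μ : ℂ, CompleteSpace (Module.End.eigenspace (T : Module.End ℂ E) μ) :=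
    fun μ => (hcl μ).completeSpace_coe
  let w := fun μ : ℂ => stdBasis (Module.End.eigenspace (T : Module.End ℂ E) μ)
  have hon : Orthonormal ℂ (fun a : Σ μ : ℂ,
      stdIndex (Module.End.eigenspace (T : Module.End ℂ E) μ) => (w a.1 a.2 : E)) :=
    hof.orthonormal_sigma_orthonormal (v_family := fun μ => w μ) fun μ => (w μ).orthonormal
  have hsp : (Submodule.span ℂ (Set.range (fun a : Σ μ : ℂ,
      stdIndex (Module.End.eigenspace (T : Module.End ℂ E) μ) => (w a.1 a.2 : E))))ᗮ = ⊥ := by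
    rw [eq_bot_iff, ← htop]
    intro v hv
    rw [Submodule.mem_orthogonal] at hv
    have hle : (⨆ μ, Module.End.eigenspace (T : Module.End ℂ E) μ) ≤ (ℂ ∙ v)ᗮ := by
      refine iSup_le fun μ u hu => ?_
      rw [Submodule.mem_orthogonal_singleton_iff_inner_left]
      have h1 := (hasSum_basis (w μ) ⟨u, hu⟩).mapL
        (Module.End.eigenspace (T : Module.End ℂ E) μ).subtypeL
      have h2 := h1.mapL (innerSL ℂ v)
      refine inner_eq_zero_symm.mp (h2.unique ?_)
      convert hasSum_zero with i
      simp only [Submodule.subtypeL_apply, map_smul, innerSL_apply_apply]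
      rw [inner_eq_zero_symm.mp (hv _ (Submodule.subset_span ⟨⟨μ, i⟩, rfl⟩)), smul_zero]
    rw [Submodule.mem_orthogonal]
    intro u hu
    exact Submodule.mem_orthogonal_singleton_iff_inner_left.mp (hle hu)
  let b := HilbertBasis.mkOfOrthogonalEqBot hon hsp
  refine ⟨EigenBasis.ofHilbertBasis b (fun a => a.1.re) fun a => ?_⟩
  have hb : b a = (w a.1 a.2 : E) :=
    congrFun (HilbertBasis.coe_mkOfOrthogonalEqBot hon hsp) a
  have h1 : T (b a) = a.1 • b a := by
    rw [hb]
    exact Module.End.mem_eigenspace_iff.mp (w a.1 a.2).2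
  -- The eigenspaces are indexed by complex numbers; symmetry shows that those containing a basis
  -- vector have a real index, so taking the real part loses nothing.
  have h2 := hs (b a) (b a)
  rw [ContinuousLinearMap.coe_coe, h1, inner_smul_left, inner_smul_right,
    inner_self_eq_norm_sq_to_K, norm_basis] at h2
  have h3 : (starRingEnd ℂ) a.1 = a.1 := by simpa using h2
  rw [Complex.conj_eq_iff_re.mp h3, h1]

end Compactness

/-! ### Bernoulli weights on finite index sets -/

section Weights

variable {ι κ : Type*}

/-- The probability `∏_{i ∈ s} pᵢ ∏_{j ∉ s} (1 - pⱼ)` that independent events with probabilities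
`pᵢ` occur exactly for the indices in `s`. -/
noncomputable def bernoulliWeight (p : ι → ℝ) (s : Finset ι) : ℝ :=
  (∏ i ∈ s, p i) * ∏' j : {j : ι // j ∉ s}, (1 - p j)

theorem multipliable_one_sub {p : ι → ℝ} (hs : Summable p) : Multipliable fun j => 1 - p j := by
  simpa only [sub_eq_add_neg] using Real.multipliable_one_add_of_summable hs.neg

-- Rewrites the product over the complement of `s` as a limit over finite sets of all indices, where
-- the binomial expansion of a finite product is available.
open Classical in
theorem tendsto_prod_sdiff {p : ι → ℝ} (hs : Summable p) (s : Finset ι) :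
    Tendsto (fun J : Finset ι => ∏ j ∈ J \ s, (1 - p j)) atTop
      (𝓝 (∏' j : {j : ι // j ∉ s}, (1 - p j))) := by
  have h1 : HasProd ((fun j => 1 - p j) ∘ ((↑) : {j | j ∉ s} → ι))
      (∏' j : {j : ι // j ∉ s}, (1 - p j)) :=
    (multipliable_one_sub (hs.subtype {j | j ∉ s})).hasProd
  rw [hasProd_subtype_iff_mulIndicator] at h1
  refine Tendsto.congr (fun J => ?_) h1
  rw [← Finset.prod_filter_mul_prod_filter_not J (· ∈ s), Finset.prod_eq_one, one_mul,
    Finset.sdiff_eq_filter]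
  · refine Finset.prod_congr rfl fun j hj => ?_
    exact Set.mulIndicator_of_mem (s := {j | j ∉ s}) (Finset.mem_filter.mp hj).2 _
  · intro j hj
    refine Set.mulIndicator_of_notMem (s := {j | j ∉ s}) ?_ _
    simpa using (Finset.mem_filter.mp hj).2

variable {p : ι → ℝ}

theorem bernoulliWeight_nonneg (hp0 : ∀ i, 0 ≤ p i) (hp1 : ∀ i, p i ≤ 1) (hs : Summable p)
    (s : Finset ι) : 0 ≤ bernoulliWeight p s := by
  classical
  refine mul_nonneg (Finset.prod_nonneg fun i _ => hp0 i) ?_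
  exact ge_of_tendsto' (tendsto_prod_sdiff hs s) fun J =>
    Finset.prod_nonneg fun i _ => sub_nonneg.mpr (hp1 i)

/-- For a finite set `J` the weights truncated to `J` add up to `∏_{j ∈ J} (pⱼ + (1 - pⱼ)) = 1`.
They are dominated by `∏_{i ∈ s} pᵢ`, which is summable over finite `s` because `p` is summable, so
the limit over `J` may be taken under the sum. -/
theorem hasSum_bernoulliWeight (hp0 : ∀ i, 0 ≤ p i) (hp1 : ∀ i, p i ≤ 1) (hs : Summable p) :
    HasSum (bernoulliWeight p) 1 := by
  classical
  have hsum := summable_finsetProd_of_summable_nonneg hp0 hs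
  let f : Finset ι → Finset ι → ℝ := fun J s =>
    if s ⊆ J then (∏ i ∈ s, p i) * ∏ j ∈ J \ s, (1 - p j) else 0
  have hprod1 : ∀ A : Finset ι, ∏ j ∈ A, (1 - p j) ≤ 1 := fun A =>
    Finset.prod_le_one (fun i _ => sub_nonneg.mpr (hp1 i)) fun i _ => by linarith [hp0 i]
  have hprod0 : ∀ A : Finset ι, 0 ≤ ∏ j ∈ A, (1 - p j) := fun A =>
    Finset.prod_nonneg (fun i _ => sub_nonneg.mpr (hp1 i))
  have hlim : ∀ s, Tendsto (fun J => f J s) atTop (𝓝 (bernoulliWeight p s)) := by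
    intro s
    refine ((tendsto_prod_sdiff hs s).const_mul (∏ i ∈ s, p i)).congr' ?_
    filter_upwards [eventually_ge_atTop s] with J hJ
    simp only [f]
    rw [if_pos hJ]
  have hbound : ∀ J s, ‖f J s‖ ≤ ∏ i ∈ s, p i := by
    intro J s
    have h0 : 0 ≤ ∏ i ∈ s, p i := Finset.prod_nonneg fun i _ => hp0 i
    simp only [f]
    split_ifs
    · rw [Real.norm_of_nonneg (mul_nonneg h0 (hprod0 _))]
      exact mul_le_of_le_one_right h0 (hprod1 _)
    · simpa using h0
  have hone : ∀ J, ∑' s, f J s = 1 := by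
    intro J
    rw [tsum_eq_sum (s := J.powerset)]
    · have := Finset.prod_add p (fun i => 1 - p i) J
      simp only [add_sub_cancel, Finset.prod_const_one] at this
      rw [this]
      refine Finset.sum_congr rfl fun s hs => ?_
      simp only [f]
      rw [if_pos (Finset.mem_powerset.mp hs)]
    · intro s hs
      simp only [f]
      rw [if_neg fun h => hs (Finset.mem_powerset.mpr h)]
  have hT := tendsto_tsum_of_dominated_convergence hsum hlim (Eventually.of_forall hbound)
  simp_rw [hone] at hT
  have hsm : Summable (bernoulliWeight p) := Summable.of_norm_bounded hsum fun s =>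
    le_of_tendsto' (hlim s).norm fun J => hbound J s
  rw [hsm.hasSum_iff]
  exact tendsto_nhds_unique hT tendsto_const_nhds

/-- The complement of `s ⊔ t` splits as a disjoint union, and the infinite product splits with it
because both parts are multipliable. This is the scalar core of the factorisation of free states. -/
theorem bernoulliWeight_disjSum (hs : Summable p) {q : κ → ℝ} (hq : Summable q)
    (s : Finset ι) (t : Finset κ) :
    bernoulliWeight (Sum.elim p q) (s.disjSum t) = bernoulliWeight p s * bernoulliWeight q t := by
  have h : ∏' j : {j : ι ⊕ κ // j ∉ s.disjSum t}, (1 - Sum.elim p q j) =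
      (∏' j : {j : ι // j ∉ s}, (1 - p j)) * ∏' j : {j : κ // j ∉ t}, (1 - q j) := by
    let e : {j : ι // j ∉ s} ⊕ {j : κ // j ∉ t} ≃ {j : ι ⊕ κ // j ∉ s.disjSum t} :=
      { toFun := Sum.elim (fun j => ⟨Sum.inl j, by simpa using j.2⟩)
          (fun j => ⟨Sum.inr j, by simpa using j.2⟩)
        invFun := fun j => match j with
          | ⟨Sum.inl j, h⟩ => Sum.inl ⟨j, by simpa using h⟩
          | ⟨Sum.inr j, h⟩ => Sum.inr ⟨j, by simpa using h⟩
        left_inv := by rintro (j | j) <;> rfl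
        right_inv := by rintro ⟨j | j, h⟩ <;> rfl }
    rw [← e.tprod_eq]
    refine HasProd.tprod_eq ?_
    refine HasProd.sum ?_ ?_
    · exact (multipliable_one_sub (hs.subtype {j | j ∉ s})).hasProd
    · exact (multipliable_one_sub (hq.subtype {j | j ∉ t})).hasProd
  rw [bernoulliWeight, bernoulliWeight, bernoulliWeight, h, Finset.prod_disjSum]
  simp only [Sum.elim_inl, Sum.elim_inr]
  ring

theorem finite_fiber_of_summable (hs : Summable p) {c : ℝ} (hc : c ≠ 0) : {i | p i = c}.Finite := by
  have h := hs.tendsto_cofinite_zero.eventually (isOpen_ne.mem_nhds (Ne.symm hc))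
  rw [eventually_cofinite] at h
  simpa using h

/-- Indices with `pⱼ = 0` contribute the factor 1. Removing them discards the only level set of a
summable family that can be infinite. -/
theorem tprod_one_sub_eq_tprod_ne_zero (p : ι → ℝ) (s : Finset ι) :
    ∏' j : {j // j ∉ s}, (1 - p j) = ∏' j : {j // j ∉ s ∧ p j ≠ 0}, (1 - p j) := by
  let g : {j // j ∉ s ∧ p j ≠ 0} → {j // j ∉ s} := fun j => ⟨j, j.2.1⟩
  have hg : Function.Injective g := fun i j hij => Subtype.ext (congrArg (fun x : {j // j ∉ s} => (x : ι)) hij)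
  refine (hg.tprod_eq (f := fun j : {j // j ∉ s} => 1 - p j) fun j hj => ?_).symm
  exact ⟨⟨j, j.2, fun h0 => hj (by simp [h0])⟩, rfl⟩

/-- The weight sees only the values of `p` with multiplicity. For `c ≠ 0` the level sets are finite
of equal size, and `σ` matches their parts inside `s` and `t`, so the remaining parts also have
equal size. Gluing bijections of these remainders gives a value-preserving bijection of the
complements. -/
theorem bernoulliWeight_congr (hs : Summable p) {p' : κ → ℝ} (hs' : Summable p')
    (hm : ∀ c ≠ 0, {i | p i = c}.ncard = {k | p' k = c}.ncard)
    {s : Finset ι} {t : Finset κ} (σ : s ≃ t) (hσ : ∀ i, p' (σ i) = p i) :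
    bernoulliWeight p s = bernoulliWeight p' t := by
  classical
  have h1 : ∏ i ∈ s, p i = ∏ k ∈ t, p' k := by
    rw [← Finset.prod_coe_sort, ← Finset.prod_coe_sort t]
    exact Fintype.prod_equiv σ _ _ fun i => (hσ i).symm
  have hcard : ∀ c ≠ 0, ({i | p i = c} \ (s : Set ι)).ncard = ({k | p' k = c} \ (t : Set κ)).ncard := by
    intro c hc
    have a1 := Set.ncard_inter_add_ncard_sdiff_eq_ncard {i | p i = c} (s : Set ι)
      (finite_fiber_of_summable hs hc)
    have a2 := Set.ncard_inter_add_ncard_sdiff_eq_ncard {k | p' k = c} (t : Set κ)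
      (finite_fiber_of_summable hs' hc)
    have a3 : ({i | p i = c} ∩ (s : Set ι)).ncard = ({k | p' k = c} ∩ (t : Set κ)).ncard := by
      refine Set.ncard_congr (fun i hi => (σ ⟨i, hi.2⟩ : κ)) ?_ ?_ ?_
      · rintro i ⟨hi, hi'⟩
        exact ⟨(hσ ⟨i, hi'⟩).trans hi, (σ ⟨i, hi'⟩).2⟩
      · intro i j hi hj hij
        simpa using hij
      · rintro k ⟨hk, hk'⟩
        refine ⟨σ.symm ⟨k, hk'⟩, ⟨?_, (σ.symm ⟨k, hk'⟩).2⟩, by simp⟩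
        rw [Set.mem_ofPred_eq, ← hσ, Equiv.apply_symm_apply]
        exact hk
    have := hm c hc
    omega
  have hfib : ∀ c : ℝ, Nonempty ({x : {i // i ∉ s ∧ p i ≠ 0} // p x = c} ≃
      {x : {k // k ∉ t ∧ p' k ≠ 0} // p' x = c}) := by
    intro c
    by_cases hc : c = 0
    · subst hc
      have : IsEmpty {x : {i // i ∉ s ∧ p i ≠ 0} // p x = 0} := ⟨fun x => x.1.2.2 x.2⟩
      have : IsEmpty {x : {k // k ∉ t ∧ p' k ≠ 0} // p' x = 0} := ⟨fun x => x.1.2.2 x.2⟩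
      exact ⟨Equiv.equivOfIsEmpty _ _⟩
    · have hf := (finite_fiber_of_summable hs hc).subset (Set.sdiff_subset (t := (s : Set ι)))
      have hf' := (finite_fiber_of_summable hs' hc).subset (Set.sdiff_subset (t := (t : Set κ)))
      have e1 : {x : {i // i ∉ s ∧ p i ≠ 0} // p x = c} ≃ ↥({i | p i = c} \ (s : Set ι)) :=
        { toFun := fun x => ⟨x.1, x.2, x.1.2.1⟩
          invFun := fun x => ⟨⟨x.1, x.2.2, by rw [x.2.1]; exact hc⟩, x.2.1⟩
          left_inv := fun _ => rfl
          right_inv := fun _ => rfl }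
      have e2 : {x : {k // k ∉ t ∧ p' k ≠ 0} // p' x = c} ≃ ↥({k | p' k = c} \ (t : Set κ)) :=
        { toFun := fun x => ⟨x.1, x.2, x.1.2.1⟩
          invFun := fun x => ⟨⟨x.1, x.2.2, by rw [x.2.1]; exact hc⟩, x.2.1⟩
          left_inv := fun _ => rfl
          right_inv := fun _ => rfl }
      have := hf.to_subtype
      have := hf'.to_subtype
      obtain ⟨e3⟩ := Finite.card_eq.mp (hcard c hc)
      exact ⟨e1.trans (e3.trans e2.symm)⟩
  let e : {i // i ∉ s ∧ p i ≠ 0} ≃ {k // k ∉ t ∧ p' k ≠ 0} :=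
    (Equiv.sigmaFiberEquiv fun x : {i // i ∉ s ∧ p i ≠ 0} => p x).symm.trans
      ((Equiv.sigmaCongrRight fun c => (hfib c).some).trans
        (Equiv.sigmaFiberEquiv fun x : {k // k ∉ t ∧ p' k ≠ 0} => p' x))
  have he : ∀ x, p' (e x) = p x := fun x => ((hfib (p x)).some ⟨x, rfl⟩).2
  rw [bernoulliWeight, bernoulliWeight, h1, tprod_one_sub_eq_tprod_ne_zero p s,
    tprod_one_sub_eq_tprod_ne_zero p' t, ← e.tprod_eq]
  simp_rw [he]

end Weights

/-! ### Slater determinants of lists and the anticommutation relations -/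

section SlaterLists

variable {H : Type*} [NormedAddCommGroup H] [InnerProductSpace ℂ H]
variable {ι κ : Type*}

/-- The vacuum vector. -/
noncomputable def vacuum (H : Type*) [NormedAddCommGroup H] [InnerProductSpace ℂ H] : Fock H :=
  slater (Fin.elim0 : Fin 0 → H)

/-- The Slater determinant of a list of vectors. -/
noncomputable def slaterList (l : List H) : Fock H := l.foldr (fun h ψ => creation h ψ) (vacuum H)

@[simp]
theorem slaterList_nil : slaterList ([] : List H) = vacuum H := rfl

@[simp]
theorem slaterList_cons (h : H) (l : List H) :
    slaterList (h :: l) = creation h (slaterList l) := rfl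

theorem slater_eq_slaterList {n : ℕ} (x : Fin n → H) : slater x = slaterList (List.ofFn x) := by
  induction n with
  | zero =>
    rw [List.ofFn_zero, slaterList_nil, vacuum]
    congr 1
    exact Subsingleton.elim _ _
  | succ n ih =>
    rw [List.ofFn_succ, slaterList_cons, ← ih, creation_slater]
    congr 1
    exact (Fin.cons_self_tail x).symm

theorem slaterList_eq_slater (l : List H) : slaterList l = slater l.get := by
  rw [slater_eq_slaterList, List.ofFn_get]

theorem inner_slaterList_of_length_ne {l l' : List H} (h : l.length ≠ l'.length) :
    (inner ℂ (slaterList l) (slaterList l') : ℂ) = 0 := by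
  rw [slaterList_eq_slater, slaterList_eq_slater, slater, slater,
    UniformSpace.Completion.inner_coe, SlaterSpan.inner_of]
  exact slaterKernel_of_ne h

/-- Equality up to a sign. -/
def EqUpToSign {M : Type*} [AddCommGroup M] (v w : M) : Prop := v = w ∨ v = -w

theorem EqUpToSign.exists_unit {v w : Fock H} (h : EqUpToSign v w) :
    ∃ c : ℂ, ‖c‖ = 1 ∧ v = c • w := by
  rcases h with h | h
  · exact ⟨1, by simp, by simp [h]⟩
  · exact ⟨-1, by simp, by simp [h]⟩

/-- Permutations are generated by swaps of neighbours, and each swap costs one sign by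
anticommutation of creators. -/
theorem slaterList_perm {l l' : List H} (h : l.Perm l') :
    EqUpToSign (slaterList l) (slaterList l') := by
  induction h with
  | nil => exact Or.inl rfl
  | cons x _ ih =>
    rcases ih with ih | ih
    · exact Or.inl (by rw [slaterList_cons, slaterList_cons, ih])
    · exact Or.inr (by rw [slaterList_cons, slaterList_cons, ih, map_neg])
  | swap x y l => exact Or.inr (by simp only [slaterList_cons]; exact creation_anticomm y x _)
  | trans _ _ ih1 ih2 =>
    rcases ih1 with h1 | h1 <;> rcases ih2 with h2 | h2
    · exact Or.inl (by rw [h1, h2])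
    · exact Or.inr (by rw [h1, h2])
    · exact Or.inr (by rw [h1, h2])
    · exact Or.inl (by rw [h1, h2, neg_neg])

theorem creation_self (h : H) (ψ : Fock H) : creation h (creation h ψ) = 0 := by
  have h1 : (2 : ℂ) • creation h (creation h ψ) = 0 := by
    rw [two_smul]
    exact add_eq_zero_iff_eq_neg.mpr (creation_anticomm h h ψ)
  exact (smul_eq_zero.mp h1).resolve_left two_ne_zero

theorem creation_slaterList_of_mem {h : H} {l : List H} (hl : h ∈ l) :
    creation h (slaterList l) = 0 := by
  induction l with
  | nil => simp at hl
  | cons x l ih =>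
    rcases List.mem_cons.mp hl with rfl | hl
    · exact creation_self h _
    · rw [slaterList_cons, creation_anticomm, ih hl, map_zero, neg_zero]

theorem norm_creation_le (h : H) : ‖creation h‖ ≤ ‖h‖ := by
  refine ContinuousLinearMap.opNorm_le_bound _ (norm_nonneg h) fun ψ => ?_
  refine UniformSpace.Completion.induction_on ψ (isClosed_le (by fun_prop) (by fun_prop)) fun f => ?_
  rw [creation_coe, UniformSpace.Completion.norm_coe, UniformSpace.Completion.norm_coe]
  exact SlaterSpan.norm_wedge_le h f

theorem SlaterSpan.contract_smul_of (c : ℂ) (h : H) (x : Tuple H) :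
    SlaterSpan.contract (c • h) (.of x) = (starRingEnd ℂ) c • SlaterSpan.contract h (.of x) := by
  obtain ⟨n, x⟩ := x
  simp only [SlaterSpan.contract, SlaterSpan.lift_of]
  cases n with
  | zero => simp
  | succ n =>
    simp only [inner_smul_left, Finset.smul_sum, smul_smul]
    refine Finset.sum_congr rfl fun j _ => ?_
    congr 1
    ring

theorem creation_smul (c : ℂ) (h : H) : creation (c • h) = c • creation h := by
  refine Fock.ext_slater fun n x => Fock.ext_inner fun m y => ?_
  rw [smul_apply, inner_smul_right]
  simp only [slater, creation_coe, UniformSpace.Completion.inner_coe]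
  rw [← inner_conj_symm, ← inner_conj_symm _ (SlaterSpan.wedge h _), SlaterSpan.inner_wedge,
    SlaterSpan.inner_wedge, inner_conj_symm, inner_conj_symm, SlaterSpan.contract_smul_of,
    inner_smul_left, Complex.conj_conj]

/-- The annihilation operator acts on formal combinations by contraction. -/
theorem annihilation_coe (h : H) (f : SlaterSpan H) :
    annihilation h (f : UniformSpace.Completion (SlaterSpan H)) =
      ((SlaterSpan.contract h f : SlaterSpan H) : UniformSpace.Completion (SlaterSpan H)) := by
  refine UniformSpace.Completion.denseRange_coe.eq_of_inner_right ℂ fun g => ?_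
  rw [annihilation, ContinuousLinearMap.adjoint_inner_right, creation_coe,
    UniformSpace.Completion.inner_coe, UniformSpace.Completion.inner_coe, SlaterSpan.inner_wedge]

/-- The mixed anticommutation relation. Together with `annihilation_vacuum` it gives the overlaps of
Slater determinants below without evaluating determinants. -/
theorem annihilation_creation (h k : H) (ψ : Fock H) :
    annihilation h (creation k ψ) = (inner ℂ h k : ℂ) • ψ - creation k (annihilation h ψ) := by
  suffices hs : annihilation h ∘L creation k =
      (inner ℂ h k : ℂ) • ContinuousLinearMap.id ℂ (Fock H) - creation k ∘L annihilation h from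
    congrArg (fun T : Fock H →L[ℂ] Fock H => T ψ) hs
  refine Fock.ext_slater fun n x => ?_
  simp only [slater, ContinuousLinearMap.comp_apply, sub_apply, smul_apply,
    ContinuousLinearMap.id_apply, creation_coe, annihilation_coe, SlaterSpan.contract_wedge,
    UniformSpace.Completion.coe_sub, UniformSpace.Completion.coe_smul]

theorem annihilation_vacuum (h : H) : annihilation h (vacuum H) = 0 := by
  rw [vacuum, slater, annihilation_coe, SlaterSpan.contract, SlaterSpan.lift_of]
  exact UniformSpace.Completion.coe_zero

theorem annihilation_slaterList_eq_zero {h : H} {l : List H}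
    (hl : ∀ k ∈ l, (inner ℂ h k : ℂ) = 0) : annihilation h (slaterList l) = 0 := by
  induction l with
  | nil => exact annihilation_vacuum h
  | cons x l ih =>
    rw [slaterList_cons, annihilation_creation, hl x (by simp), zero_smul,
      ih fun k hk => hl k (by simp [hk]), map_zero, sub_zero]

theorem norm_vacuum : ‖vacuum H‖ = 1 := by
  have h : (inner ℂ (vacuum H) (vacuum H) : ℂ) = 1 := by
    rw [vacuum, inner_slater]
    simp
  have h2 : ‖vacuum H‖ ^ 2 = 1 := by
    rw [norm_sq_eq_re_inner (𝕜 := ℂ), h]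
    simp
  exact (pow_eq_one_iff_of_nonneg (norm_nonneg _) two_ne_zero).mp h2

theorem inner_slaterList_self {b : ι → H} (hb : Orthonormal ℂ b) {l : List ι} (hl : l.Nodup) :
    (inner ℂ (slaterList (l.map b)) (slaterList (l.map b)) : ℂ) = 1 := by
  induction l with
  | nil => rw [List.map_nil, slaterList_nil, inner_self_eq_norm_sq_to_K, norm_vacuum]; simp
  | cons i l ih =>
    rw [List.nodup_cons] at hl
    rw [List.map_cons, slaterList_cons, ← ContinuousLinearMap.adjoint_inner_right]
    change (inner ℂ _ (annihilation (b i) _) : ℂ) = 1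
    rw [annihilation_creation, annihilation_slaterList_eq_zero, map_zero, sub_zero,
      inner_smul_right, ih hl.2, inner_self_eq_norm_sq_to_K, hb.1 i]
    · simp
    · intro k hk
      obtain ⟨j, hj, rfl⟩ := List.mem_map.mp hk
      exact hb.2 fun hij => hl.1 (hij ▸ hj)

/-- Move `h` to the front of `l` at the cost of a sign, pass it to the other side as an annihilator,
and let it run through `l'` to the vacuum. -/
theorem inner_slaterList_eq_zero {h : H} {l l' : List H} (hl : h ∈ l)
    (hl' : ∀ k ∈ l', (inner ℂ h k : ℂ) = 0) :
    (inner ℂ (slaterList l) (slaterList l') : ℂ) = 0 := by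
  induction l with
  | nil => simp at hl
  | cons x l ih =>
    rcases List.mem_cons.mp hl with rfl | hl
    · rw [slaterList_cons, ← ContinuousLinearMap.adjoint_inner_right]
      change (inner ℂ _ (annihilation h _) : ℂ) = 0
      rw [annihilation_slaterList_eq_zero hl', inner_zero_right]
    · obtain ⟨s, t, rfl⟩ := List.append_of_mem hl
      obtain ⟨c, -, hc⟩ := (slaterList_perm (l := x :: (s ++ h :: t)) (l' := h :: (x :: (s ++ t)))
        ((List.Perm.cons x List.perm_middle).trans (List.Perm.swap _ _ _))).exists_unit
      rw [hc, slaterList_cons, inner_smul_left, ← ContinuousLinearMap.adjoint_inner_right]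
      change _ * (inner ℂ _ (annihilation h _) : ℂ) = 0
      rw [annihilation_slaterList_eq_zero hl', inner_zero_right, mul_zero]

/-- The creation operator as a bounded linear map of the one-particle vector. -/
noncomputable def creationL (H : Type*) [NormedAddCommGroup H] [InnerProductSpace ℂ H] :
    H →L[ℂ] Fock H →L[ℂ] Fock H :=
  LinearMap.mkContinuous { toFun := creation, map_add' := creation_add, map_smul' := creation_smul }
    1 fun h => by rw [one_mul]; exact norm_creation_le h

theorem creationL_apply (h : H) : creationL H h = creation h := rfl

theorem dense_span_slater :
    Dense (Submodule.span ℂ (Set.range (slaterList (H := H))) : Set (Fock H)) := by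
  refine UniformSpace.Completion.denseRange_coe.mono ?_
  rintro _ ⟨f, rfl⟩
  induction f using SlaterSpan.induction with
  | h0 =>
    have h0 : ((0 : SlaterSpan H) : UniformSpace.Completion (SlaterSpan H)) = 0 :=
      UniformSpace.Completion.coe_zero
    rw [h0]
    exact Submodule.zero_mem _
  | hadd f g hf hg =>
    rw [UniformSpace.Completion.coe_add]
    exact Submodule.add_mem _ hf hg
  | hof c x =>
    rw [UniformSpace.Completion.coe_smul]
    exact Submodule.smul_mem _ _ (Submodule.subset_span ⟨_, (slater_eq_slaterList x.2).symm⟩)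

/-- The Slater determinant of the members of a family of vectors with index in a finite set. -/
noncomputable def slaterVecOf (b : ι → H) (s : Finset ι) : Fock H :=
  slater fun i : Fin s.card => b (s.equivFin.symm i : ι)

theorem slaterVecOf_eq_slaterList (b : ι → H) (s : Finset ι) :
    ∃ l : List ι, l.Nodup ∧ (∀ i, i ∈ l ↔ i ∈ s) ∧ l.length = s.card ∧
      slaterVecOf b s = slaterList (l.map b) := by
  refine ⟨List.ofFn fun i : Fin s.card => (s.equivFin.symm i : ι), ?_, ?_, by simp, ?_⟩
  · rw [List.nodup_ofFn]
    exact Subtype.val_injective.comp s.equivFin.symm.injective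
  · intro i
    rw [List.mem_ofFn]
    constructor
    · rintro ⟨j, rfl⟩
      exact (s.equivFin.symm j).2
    · intro hi
      exact ⟨s.equivFin ⟨i, hi⟩, by simp⟩
  · rw [slaterVecOf, slater_eq_slaterList, List.map_ofFn]
    rfl

theorem slaterVecOf_of_nodup (b : ι → H) {s : Finset ι} {l : List ι} (hl : l.Nodup)
    (hs : ∀ i, i ∈ l ↔ i ∈ s) : EqUpToSign (slaterList (l.map b)) (slaterVecOf b s) := by
  obtain ⟨l', h1, h2, -, h3⟩ := slaterVecOf_eq_slaterList b s
  rw [h3]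
  refine slaterList_perm (List.Perm.map b ?_)
  rw [List.perm_ext_iff_of_nodup hl h1]
  intro i
  rw [hs, h2]

end SlaterLists

/-! ### The Slater basis of Fock space -/

section SlaterBasis

variable {H : Type*} [NormedAddCommGroup H] [InnerProductSpace ℂ H]
variable {ι : Type*}

theorem orthonormal_slaterVecOf (b : HilbertBasis ι ℂ H) : Orthonormal ℂ (slaterVecOf b) := by
  classical
  rw [orthonormal_iff_ite]
  intro s t
  obtain ⟨l, h1, h2, -, h3⟩ := slaterVecOf_eq_slaterList b s
  obtain ⟨l', h1', h2', h4', h3'⟩ := slaterVecOf_eq_slaterList b t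
  split_ifs with hst
  · subst hst
    rw [h3]
    exact inner_slaterList_self b.orthonormal h1
  · have key : ∀ {u v : Finset ι} {l l' : List ι}, (∀ i, i ∈ l ↔ i ∈ u) → (∀ i, i ∈ l' ↔ i ∈ v) →
        ¬ u ⊆ v → (inner ℂ (slaterList (l.map b)) (slaterList (l'.map b)) : ℂ) = 0 := by
      intro u v l l' hu hv huv
      obtain ⟨i, hi, hi'⟩ := Finset.not_subset.mp huv
      refine inner_slaterList_eq_zero (List.mem_map.mpr ⟨i, (hu i).mpr hi, rfl⟩) fun k hk => ?_
      obtain ⟨j, hj, rfl⟩ := List.mem_map.mp hk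
      exact b.orthonormal.2 fun hij => hi' ((hv i).mp (hij ▸ hj))
    rw [h3, h3']
    by_cases hs : s ⊆ t
    · rw [inner_eq_zero_symm]
      exact key h2' h2 fun h => hst (hs.antisymm h)
    · exact key h2 h2' hs

theorem annihilation_slaterVecOf_of_notMem (b : HilbertBasis ι ℂ H) {i : ι} {s : Finset ι}
    (hi : i ∉ s) : annihilation (b i) (slaterVecOf b s) = 0 := by
  obtain ⟨l, -, h2, -, hl⟩ := slaterVecOf_eq_slaterList b s
  rw [hl]
  refine annihilation_slaterList_eq_zero fun k hk => ?_
  obtain ⟨j, hj, rfl⟩ := List.mem_map.mp hk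
  exact b.orthonormal.2 fun hij => hi ((h2 i).mp (hij ▸ hj))

/-- The closed span contains the vacuum up to sign and is stable under `creation (b i)`. By
linearity and continuity it is stable under every creator, so it contains all Slater determinants,
which are total. -/
theorem slaterVecOf_total (b : HilbertBasis ι ℂ H) :
    ⊤ ≤ (Submodule.span ℂ (Set.range (slaterVecOf b))).topologicalClosure := by
  classical
  set S := (Submodule.span ℂ (Set.range (slaterVecOf b))).topologicalClosure with hS
  have hcl : IsClosed (S : Set (Fock H)) := Submodule.isClosed_topologicalClosure _
  have hmem : ∀ s, slaterVecOf b s ∈ S := fun s =>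
    Submodule.le_topologicalClosure _ (Submodule.subset_span ⟨s, rfl⟩)
  have h1 : ∀ i s, creation (b i) (slaterVecOf b s) ∈ S := by
    intro i s
    obtain ⟨l, h1, h2, -, h3⟩ := slaterVecOf_eq_slaterList b s
    rw [h3]
    by_cases hi : i ∈ s
    · rw [creation_slaterList_of_mem (List.mem_map.mpr ⟨i, (h2 i).mpr hi, rfl⟩)]
      exact S.zero_mem
    · have h4 : EqUpToSign (slaterList ((i :: l).map b)) (slaterVecOf b (insert i s)) :=
        slaterVecOf_of_nodup b (List.nodup_cons.mpr ⟨fun h => hi ((h2 i).mp h), h1⟩) (by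
          intro j
          rw [List.mem_cons, Finset.mem_insert, h2])
      obtain ⟨c, -, hc⟩ := h4.exists_unit
      rw [List.map_cons, slaterList_cons] at hc
      rw [hc]
      exact S.smul_mem _ (hmem _)
  have h2 : ∀ i, ∀ ψ ∈ S, creation (b i) ψ ∈ S := by
    intro i
    have hle : Submodule.span ℂ (Set.range (slaterVecOf b)) ≤
        S.comap (creation (b i)).toLinearMap := by
      rw [Submodule.span_le]
      rintro _ ⟨s, rfl⟩
      exact h1 i s
    exact Submodule.topologicalClosure_minimal _ hle (hcl.preimage (creation (b i)).continuous)
  have h3 : ∀ h, ∀ ψ ∈ S, creation h ψ ∈ S := by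
    intro h ψ hψ
    -- Since `h ↦ creation h` is bounded and linear, the expansion of `h` in the basis gives a
    -- convergent expansion of `creation h ψ`.
    have h4 := ((hasSum_basis b h).mapL (creationL H)).mapL (ContinuousLinearMap.apply ℂ (Fock H) ψ)
    refine hcl.mem_of_tendsto h4 (Eventually.of_forall fun J => ?_)
    refine Submodule.sum_mem _ fun i _ => ?_
    simp only [map_smul, creationL_apply]
    exact S.smul_mem _ (h2 i ψ hψ)
  have h4 : ∀ l : List H, slaterList l ∈ S := by
    intro l
    induction l with
    | nil =>
      obtain ⟨c, -, hc⟩ := (slaterVecOf_of_nodup b (s := ∅) List.nodup_nil (by simp)).exists_unit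
      rw [List.map_nil] at hc
      rw [hc]
      exact S.smul_mem _ (hmem _)
    | cons h l ih => exact h3 h _ ih
  have h5 : (Submodule.span ℂ (Set.range (slaterList (H := H)))).topologicalClosure ≤ S :=
    Submodule.topologicalClosure_minimal _ (by
      rw [Submodule.span_le]
      rintro _ ⟨l, rfl⟩
      exact h4 l) hcl
  rwa [Submodule.dense_iff_topologicalClosure_eq_top.mp dense_span_slater] at h5

/-- The Hilbert basis of Fock space that consists of the Slater determinants of the vectors of a
Hilbert basis. -/
noncomputable def slaterBasis [CompleteSpace H] (b : HilbertBasis ι ℂ H) : HilbertBasis (Finset ι) ℂ (Fock H) :=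
  HilbertBasis.mk (orthonormal_slaterVecOf b) (slaterVecOf_total b)

theorem slaterBasis_apply [CompleteSpace H] (b : HilbertBasis ι ℂ H) (s : Finset ι) :
    slaterBasis b s = slaterVecOf b s :=
  congrFun (HilbertBasis.coe_mk _ _) s

end SlaterBasis

/-! ### Particle-number sectors -/

section Sectors

variable {H : Type*} [NormedAddCommGroup H] [InnerProductSpace ℂ H]
variable {ι κ : Type*}

/-- The `n`-particle sector of Fock space. -/
def sector (H : Type*) [NormedAddCommGroup H] [InnerProductSpace ℂ H] (n : ℕ) :
    Submodule ℂ (Fock H) where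
  carrier := {ψ | ∀ l : List H, l.length ≠ n → (inner ℂ (slaterList l) ψ : ℂ) = 0}
  add_mem' := fun hφ hψ l hl => by rw [inner_add_right, hφ l hl, hψ l hl, add_zero]
  zero_mem' := fun l _ => inner_zero_right _
  smul_mem' := fun c ψ hψ l hl => by rw [inner_smul_right, hψ l hl, mul_zero]

theorem slaterList_mem_sector (l : List H) : slaterList l ∈ sector H l.length :=
  fun _ hl => inner_slaterList_of_length_ne hl

theorem slaterVecOf_mem_sector (b : ι → H) (s : Finset ι) : slaterVecOf b s ∈ sector H s.card := by
  obtain ⟨l, -, -, h, hl⟩ := slaterVecOf_eq_slaterList b s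
  rw [hl, ← h, ← List.length_map (f := b)]
  exact slaterList_mem_sector _

theorem creation_slaterVecOf_mem_sector (b : ι → H) (s : Finset ι) (h : H) :
    creation h (slaterVecOf b s) ∈ sector H (s.card + 1) := by
  obtain ⟨l, -, -, h', hl⟩ := slaterVecOf_eq_slaterList b s
  have := slaterList_mem_sector (h :: l.map b)
  rwa [List.length_cons, List.length_map, h', slaterList_cons, ← hl] at this

theorem inner_slaterVecOf_of_mem_sector (b : ι → H) {s : Finset ι} {n : ℕ} {ψ : Fock H}
    (hψ : ψ ∈ sector H n) (hs : s.card ≠ n) : (inner ℂ (slaterVecOf b s) ψ : ℂ) = 0 := by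
  obtain ⟨l, -, -, h, hl⟩ := slaterVecOf_eq_slaterList b s
  rw [hl]
  exact hψ _ (by rwa [List.length_map, h])

variable [CompleteSpace H]

theorem inner_eq_zero_of_mem_sector {m n : ℕ} (hmn : m ≠ n) {φ ψ : Fock H} (hφ : φ ∈ sector H m)
    (hψ : ψ ∈ sector H n) : (inner ℂ φ ψ : ℂ) = 0 := by
  rw [← (slaterBasis (stdBasis H)).tsum_inner_mul_inner]
  convert tsum_zero with s
  rw [slaterBasis_apply]
  by_cases hs : s.card = n
  · rw [← inner_conj_symm, inner_slaterVecOf_of_mem_sector _ hφ (fun h => hmn (h.symm.trans hs)),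
      map_zero, zero_mul]
  · rw [inner_slaterVecOf_of_mem_sector _ hψ hs, mul_zero]

/-- Membership may be tested on any Hilbert basis adapted to the sectors. It is applied to products
of Slater determinants, which are not literally of the form `slaterVecOf`. -/
theorem mem_sector_iff_basis (e : HilbertBasis ι ℂ (Fock H)) (d : ι → ℕ)
    (he : ∀ i, e i ∈ sector H (d i)) {n : ℕ} {ψ : Fock H} :
    ψ ∈ sector H n ↔ ∀ i, d i ≠ n → (inner ℂ (e i) ψ : ℂ) = 0 := by
  constructor
  · exact fun hψ i hi => inner_eq_zero_of_mem_sector hi (he i) hψ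
  · intro h l hl
    rw [← e.tsum_inner_mul_inner]
    convert tsum_zero with i
    by_cases hi : d i = n
    · rw [inner_eq_zero_of_mem_sector (fun h' => hl (h'.trans hi)) (slaterList_mem_sector l) (he i),
        zero_mul]
    · rw [h i hi, mul_zero]

end Sectors

/-! ### Creators, annihilators and bases under the wedge product -/

section Wedge

variable {H : Type*} [NormedAddCommGroup H] [InnerProductSpace ℂ H] (K : Submodule ℂ H)
variable {ι κ : Type*}

theorem SlaterSpan.wedgeProd_wedge (k : K) (f : SlaterSpan K) (g : SlaterSpan Kᗮ) :
    SlaterSpan.wedgeProd K (SlaterSpan.wedge k f) g =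
      SlaterSpan.wedge (k : H) (SlaterSpan.wedgeProd K f g) := by
  induction f using SlaterSpan.induction with
  | h0 => simp
  | hadd f f' h h' => simp only [map_add, LinearMap.add_apply, h, h']
  | hof c x =>
    simp only [map_smul, LinearMap.smul_apply]
    rw [← SlaterSpan.wedgeProd_cons, SlaterSpan.wedge, SlaterSpan.lift_of]

theorem fockWedge_creation_left (k : K) (φ : Fock K) (χ : Fock Kᗮ) :
    fockWedge K (creation k φ) χ = creation (k : H) (fockWedge K φ χ) := by
  suffices h : (fockWedge K).comp (creation k) =
      ContinuousLinearMap.compL ℂ (Fock Kᗮ) (Fock H) (Fock H) (creation (k : H)) ∘L fockWedge K from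
    congrArg (fun T : Fock K →L[ℂ] Fock Kᗮ →L[ℂ] Fock H => T φ χ) h
  refine Fock.ext_slater (G := Fock Kᗮ →L[ℂ] Fock H) fun n x => ?_
  refine Fock.ext_slater (G := Fock H) fun m y => ?_
  simp only [slater, ContinuousLinearMap.comp_apply, ContinuousLinearMap.compL_apply, creation_coe,
    fockWedge_coe, SlaterSpan.wedgeProd_wedge]

theorem fockWedge_vacuum_slaterList (l : List Kᗮ) :
    fockWedge K (vacuum K) (slaterList l) = slaterList (List.map (fun y : Kᗮ => (y : H)) l) := by
  rw [slaterList_eq_slater l, vacuum, slater, slater, fockWedge_coe, SlaterSpan.wedgeProd,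
    SlaterSpan.lift_of, SlaterSpan.wedgeAll, LinearMap.id_comp, SlaterSpan.incl, SlaterSpan.lift_of]
  change slater _ = _
  rw [slater_eq_slaterList]
  congr 1
  change List.ofFn ((fun y : Kᗮ => (y : H)) ∘ l.get) = _
  rw [← List.map_ofFn, List.ofFn_get]

theorem fockWedge_slaterList (l : List K) (l' : List Kᗮ) :
    fockWedge K (slaterList l) (slaterList l') =
      slaterList (List.map (fun x : K => (x : H)) l ++ List.map (fun y : Kᗮ => (y : H)) l') := by
  induction l with
  | nil => exact fockWedge_vacuum_slaterList K l'
  | cons k l ih =>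
    rw [slaterList_cons, fockWedge_creation_left, ih]
    rfl

theorem fockWedge_slaterList_mem_sector (l : List K) (l' : List Kᗮ) :
    fockWedge K (slaterList l) (slaterList l') ∈ sector H (l.length + l'.length) := by
  rw [fockWedge_slaterList]
  convert slaterList_mem_sector _ using 2
  simp

/-- The vector `y` enters on the far left and must pass every factor from `K`; each passage changes
the sign. -/
theorem creation_fockWedge_right (y : Kᗮ) (l : List K) (χ : Fock Kᗮ) :
    creation (y : H) (fockWedge K (slaterList l) χ) =
      (-1 : ℂ) ^ l.length • fockWedge K (slaterList l) (creation y χ) := by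
  suffices h : creation (y : H) ∘L fockWedge K (slaterList l) =
      (-1 : ℂ) ^ l.length • (fockWedge K (slaterList l) ∘L creation y) from
    congrArg (fun T : Fock Kᗮ →L[ℂ] Fock H => T χ) h
  refine Fock.ext_slater fun n x => ?_
  simp only [ContinuousLinearMap.comp_apply, smul_apply, slater_eq_slaterList]
  rw [← slaterList_cons, fockWedge_slaterList, fockWedge_slaterList]
  induction l with
  | nil => simp
  | cons k l ih =>
    simp only [List.map_cons, List.cons_append, slaterList_cons, List.length_cons] at ih ⊢
    rw [creation_anticomm, ih, map_smul, pow_succ, mul_neg_one, neg_smul]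

theorem creation_fockWedge_slaterVecOf (y : Kᗮ) (b : ι → K) (s : Finset ι)
    (χ : Fock Kᗮ) :
    creation (y : H) (fockWedge K (slaterVecOf b s) χ) =
      (-1 : ℂ) ^ s.card • fockWedge K (slaterVecOf b s) (creation y χ) := by
  obtain ⟨l, -, -, h, hl⟩ := slaterVecOf_eq_slaterList b s
  rw [hl, creation_fockWedge_right, List.length_map, h]

variable [CompleteSpace K]

/-- The Hilbert basis of `F(H)` formed by the products of two Hilbert bases of `F(K)` and
`F(Kᗮ)`. -/
noncomputable def wedgeBasis (e : HilbertBasis ι ℂ (Fock K)) (e' : HilbertBasis κ ℂ (Fock Kᗮ)) :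
    HilbertBasis (ι × κ) ℂ (Fock H) :=
  HilbertBasis.mkOfOrthogonalEqBot (v := fun q : ι × κ => fockWedge K (e q.1) (e' q.2))
    (by
      classical
      rw [orthonormal_iff_ite]
      rintro ⟨i, k⟩ ⟨j, l⟩
      rw [inner_fockWedge, inner_basis, inner_basis]
      simp only [Prod.mk.injEq]
      split_ifs <;> simp_all)
    (by
      rw [eq_bot_iff]
      intro v hv
      rw [Submodule.mem_bot]
      have h1 : ∀ i χ, (inner ℂ v (fockWedge K (e i) χ) : ℂ) = 0 := by
        intro i χ
        have h2 := ((hasSum_basis e' χ).mapL (fockWedge K (e i))).mapL (innerSL ℂ v)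
        refine h2.unique ?_
        convert hasSum_zero with k
        rw [map_smul, map_smul, innerSL_apply_apply,
          inner_eq_zero_symm.mp ((Submodule.mem_orthogonal _ _).mp hv _
            (Submodule.subset_span ⟨(i, k), rfl⟩)), smul_zero]
      have h2 : ∀ φ χ, (inner ℂ v (fockWedge K φ χ) : ℂ) = 0 := by
        intro φ χ
        have h2 := ((hasSum_basis e φ).mapL ((fockWedge K).flip χ)).mapL (innerSL ℂ v)
        refine h2.unique ?_
        convert hasSum_zero with i
        rw [map_smul, map_smul, innerSL_apply_apply, ContinuousLinearMap.flip_apply, h1, smul_zero]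
      refine Fock.ext_inner fun n x => ?_
      rw [inner_zero_right]
      have h3 := slater_wedge_mem K x
      generalize slater x = ψ at h3 ⊢
      induction h3 using Submodule.span_induction with
      | mem _ h => obtain ⟨_, _, _, _, rfl⟩ := h; exact inner_eq_zero_symm.mp (h2 _ _)
      | zero => simp
      | add _ _ _ _ h1 h2 => rw [inner_add_left, h1, h2, add_zero]
      | smul c _ _ h1 => rw [inner_smul_left, h1, mul_zero])

theorem wedgeBasis_apply (e : HilbertBasis ι ℂ (Fock K)) (e' : HilbertBasis κ ℂ (Fock Kᗮ))
    (q : ι × κ) : wedgeBasis K e e' q = fockWedge K (e q.1) (e' q.2) :=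
  congrFun (HilbertBasis.coe_mkOfOrthogonalEqBot _ _) q

variable [CompleteSpace H]

theorem ext_fockWedge {ψ ψ' : Fock H}
    (h : ∀ φ χ, (inner ℂ (fockWedge K φ χ) ψ : ℂ) = inner ℂ (fockWedge K φ χ) ψ') : ψ = ψ' :=
  ext_inner_basis (wedgeBasis K (slaterBasis (stdBasis K)) (slaterBasis (stdBasis Kᗮ))) fun q => by
    rw [wedgeBasis_apply]
    exact h _ _

theorem annihilation_fockWedge_left (k : K) (φ : Fock K) (χ : Fock Kᗮ) :
    annihilation (k : H) (fockWedge K φ χ) = fockWedge K (annihilation k φ) χ := by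
  refine ext_fockWedge K fun φ' χ' => ?_
  rw [annihilation, ContinuousLinearMap.adjoint_inner_right, ← fockWedge_creation_left,
    inner_fockWedge, inner_fockWedge, annihilation, ContinuousLinearMap.adjoint_inner_right]

/-- The adjoint of the rule for creators, tested on product vectors. The sign there belongs to the
Slater vector of `t` on the test side; the overlap vanishes unless `t = s`, so it may be read off
from `s`. -/
theorem annihilation_fockWedge_slaterVecOf (y : Kᗮ) (b : HilbertBasis ι ℂ K) (s : Finset ι)
    (χ : Fock Kᗮ) :
    annihilation (y : H) (fockWedge K (slaterVecOf b s) χ) =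
      (-1 : ℂ) ^ s.card • fockWedge K (slaterVecOf b s) (annihilation y χ) := by
  refine ext_inner_basis (wedgeBasis K (slaterBasis b) (slaterBasis (stdBasis Kᗮ))) fun q => ?_
  obtain ⟨t, u⟩ := q
  obtain ⟨l, -, -, h, hl⟩ := slaterVecOf_eq_slaterList b t
  rw [wedgeBasis_apply, slaterBasis_apply, annihilation, ContinuousLinearMap.adjoint_inner_right,
    hl, creation_fockWedge_right, ← hl, inner_smul_left, inner_smul_right, inner_fockWedge,
    inner_fockWedge, annihilation, ContinuousLinearMap.adjoint_inner_right, ← slaterBasis_apply b t,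
    ← slaterBasis_apply b s, inner_basis]
  split_ifs with hts
  · rw [List.length_map, h, hts]
    simp
  · simp

theorem wedgeBasis_mem_sector (b : HilbertBasis ι ℂ K) (b' : HilbertBasis κ ℂ Kᗮ)
    (q : Finset ι × Finset κ) :
    wedgeBasis K (slaterBasis b) (slaterBasis b') q ∈ sector H (q.1.card + q.2.card) := by
  obtain ⟨l, -, -, h, hl⟩ := slaterVecOf_eq_slaterList b q.1
  obtain ⟨l', -, -, h', hl'⟩ := slaterVecOf_eq_slaterList b' q.2
  rw [wedgeBasis_apply, slaterBasis_apply, slaterBasis_apply, hl, hl']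
  convert fockWedge_slaterList_mem_sector K _ _ using 2
  rw [List.length_map, List.length_map, h, h']

theorem fockWedge_mem_sector {m n : ℕ} {φ : Fock K} {χ : Fock Kᗮ} (hφ : φ ∈ sector K m)
    (hχ : χ ∈ sector Kᗮ n) : fockWedge K φ χ ∈ sector H (m + n) := by
  rw [mem_sector_iff_basis _ _ (wedgeBasis_mem_sector K (stdBasis K) (stdBasis Kᗮ))]
  rintro ⟨s, t⟩ hst
  rw [wedgeBasis_apply, inner_fockWedge, slaterBasis_apply, slaterBasis_apply]
  by_cases hs : s.card = m
  · rw [inner_slaterVecOf_of_mem_sector _ hχ (fun ht => hst (by simp [hs, ht])), mul_zero]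
  · rw [inner_slaterVecOf_of_mem_sector _ hφ hs, zero_mul]

end Wedge

/-! ### The number operator and its expectation -/

section Number

variable {H : Type*} [NormedAddCommGroup H] [InnerProductSpace ℂ H] [CompleteSpace H]
variable {ι κ : Type*}

-- For `i ∈ s`, bring `b i` to the front and use the anticommutation relation with `a†(bᵢ)² = 0`.
-- The operators `a†(bᵢ) a(bᵢ)` are thus simultaneously diagonal with occupation numbers 0 and 1.
open Classical in
theorem creation_annihilation_slaterBasis (b : HilbertBasis ι ℂ H) (i : ι) (s : Finset ι) :
    (creation (b i) ∘L annihilation (b i)) (slaterBasis b s) =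
      (((if i ∈ s then 1 else 0 : ℝ) : ℝ) : ℂ) • slaterBasis b s := by
  rw [ContinuousLinearMap.comp_apply, slaterBasis_apply]
  split_ifs with hi
  · obtain ⟨l, -, h2, -, hl⟩ := slaterVecOf_eq_slaterList b s
    obtain ⟨c, -, hc⟩ := (slaterList_perm
      ((List.perm_cons_erase ((h2 i).mpr hi)).map b)).exists_unit
    rw [List.map_cons, slaterList_cons] at hc
    rw [hl, hc, map_smul, map_smul, annihilation_creation, inner_basis, if_pos rfl, one_smul,
      map_sub, creation_self, sub_zero, Complex.ofReal_one, one_smul]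
  · rw [annihilation_slaterVecOf_of_notMem b hi, map_zero, Complex.ofReal_zero, zero_smul]

open Classical in
theorem inner_slaterBasis_sum_number (b : HilbertBasis ι ℂ H) (s J : Finset ι) (ψ : Fock H) :
    (inner ℂ (slaterBasis b s) (∑ j ∈ J, creation (b j) (annihilation (b j) ψ)) : ℂ) =
      ((J ∩ s).card : ℂ) * inner ℂ (slaterBasis b s) ψ := by
  have h : ∀ j, (inner ℂ (slaterBasis b s) (creation (b j) (annihilation (b j) ψ)) : ℂ) =
      if j ∈ s then (inner ℂ (slaterBasis b s) ψ : ℂ) else 0 := by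
    intro j
    have := inner_eigenbasis_apply (creation_annihilation_slaterBasis b j) s ψ
    rw [ContinuousLinearMap.comp_apply] at this
    rw [this]
    split_ifs <;> simp
  simp_rw [inner_sum, h]
  rw [← Finset.sum_filter, Finset.sum_const, nsmul_eq_mul, Finset.filter_mem_eq_inter]

/-- The partial sum over `J` multiplies the coefficient at `s` by `|J ∩ s|`, which is eventually
`|s|`. Conversely, the squared error at `s` is at most the squared coefficient of `χ`, so dominated
convergence gives convergence in norm. Hence `N` is the maximal diagonal operator with eigenvalues
`|s|`. -/
theorem hasSum_number_iff (b : HilbertBasis ι ℂ H) (ψ χ : Fock H) :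
    HasSum (fun j => creation (b j) (annihilation (b j) ψ)) χ ↔
      ∀ s, (inner ℂ (slaterBasis b s) χ : ℂ) = (s.card : ℂ) * inner ℂ (slaterBasis b s) ψ := by
  classical
  constructor
  · intro h s
    have h1 : Tendsto (fun J : Finset ι => (inner ℂ (slaterBasis b s)
        (∑ j ∈ J, creation (b j) (annihilation (b j) ψ)) : ℂ)) atTop
        (𝓝 (inner ℂ (slaterBasis b s) χ)) :=
      ((innerSL ℂ (slaterBasis b s)).continuous.tendsto χ).comp h
    refine tendsto_nhds_unique h1 (tendsto_const_nhds.congr' ?_)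
    filter_upwards [eventually_ge_atTop s] with J hJ
    rw [inner_slaterBasis_sum_number, Finset.inter_eq_right.mpr hJ]
  · intro h
    rw [HasSum, tendsto_iff_norm_sub_tendsto_zero]
    have hn : ∀ J : Finset ι, ‖(∑ j ∈ J, creation (b j) (annihilation (b j) ψ)) - χ‖ ^ 2 =
        ∑' s, (((s.card : ℝ) - (J ∩ s).card) * ‖(inner ℂ (slaterBasis b s) ψ : ℂ)‖) ^ 2 := by
      intro J
      rw [norm_sub_rev, ← (hasSum_norm_inner_sq (slaterBasis b) _).tsum_eq]
      refine tsum_congr fun s => ?_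
      rw [inner_sub_right, h, inner_slaterBasis_sum_number, ← sub_mul, norm_mul, mul_pow, mul_pow]
      congr 1
      rw [← Complex.ofReal_natCast, ← Complex.ofReal_natCast, ← Complex.ofReal_sub,
        Complex.norm_real, Real.norm_eq_abs, sq_abs]
    have hlim : Tendsto (fun J : Finset ι =>
        ∑' s, (((s.card : ℝ) - (J ∩ s).card) * ‖(inner ℂ (slaterBasis b s) ψ : ℂ)‖) ^ 2) atTop
        (𝓝 (∑' _ : Finset ι, (0 : ℝ))) := by
      refine tendsto_tsum_of_dominated_convergence
        (hasSum_norm_inner_sq (slaterBasis b) χ).summable (fun s => ?_)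
        (Eventually.of_forall fun J s => ?_)
      · refine tendsto_const_nhds.congr' ?_
        filter_upwards [eventually_ge_atTop s] with J hJ
        rw [Finset.inter_eq_right.mpr hJ]
        simp
      · rw [h, norm_mul, Complex.norm_natCast, Real.norm_of_nonneg (sq_nonneg _)]
        have h1 : ((J ∩ s).card : ℝ) ≤ s.card := by
          exact_mod_cast Finset.card_le_card Finset.inter_subset_right
        refine pow_le_pow_left₀ (mul_nonneg (by linarith) (norm_nonneg _))
          (mul_le_mul_of_nonneg_right ?_ (norm_nonneg _)) 2
        have : (0 : ℝ) ≤ (J ∩ s).card := Nat.cast_nonneg _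
        linarith
    rw [tsum_zero] at hlim
    simp_rw [← hn] at hlim
    have := (Real.continuous_sqrt.tendsto 0).comp hlim
    rw [Real.sqrt_zero] at this
    refine this.congr fun J => ?_
    rw [Function.comp_apply, Real.sqrt_sq (norm_nonneg _)]

theorem inner_sector_of_basis (e : HilbertBasis ι ℂ (Fock H)) (d : ι → ℕ)
    (he : ∀ i, e i ∈ sector H (d i)) {ψ χ : Fock H}
    (h : ∀ i, (inner ℂ (e i) χ : ℂ) = (d i : ℂ) * inner ℂ (e i) ψ) {n : ℕ} {u : Fock H}
    (hu : u ∈ sector H n) : (inner ℂ u χ : ℂ) = (n : ℂ) * inner ℂ u ψ := by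
  rw [← e.tsum_inner_mul_inner, ← e.tsum_inner_mul_inner u ψ, ← tsum_mul_left]
  refine tsum_congr fun i => ?_
  by_cases hi : d i = n
  · rw [h, hi]
    ring
  · rw [inner_eq_zero_of_mem_sector (fun h' => hi h'.symm) hu (he i)]
    ring

theorem slaterBasis_mem_sector (b : HilbertBasis ι ℂ H) (s : Finset ι) :
    slaterBasis b s ∈ sector H s.card := by
  rw [slaterBasis_apply]
  exact slaterVecOf_mem_sector b s

/-- A weak description of the graph of `N` that mentions only sectors, so that the basis used to
define `N` can be forgotten. -/
theorem numberOp_eq_iff (ψ χ : Fock H) :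
    (∃ h : ψ ∈ (numberOp H).domain, numberOp H ⟨ψ, h⟩ = χ) ↔
      ∀ n, ∀ u ∈ sector H n, (inner ℂ u χ : ℂ) = (n : ℂ) * inner ℂ u ψ := by
  constructor
  · rintro ⟨h, rfl⟩ n u hu
    have h1 : HasSum (fun j => creation (stdBasis H j) (annihilation (stdBasis H j) ψ))
      (numberOp H ⟨ψ, h⟩) := Summable.hasSum h
    exact inner_sector_of_basis _ _ (slaterBasis_mem_sector _) ((hasSum_number_iff _ _ _).mp h1) hu
  · intro h
    have h1 : HasSum (fun j => creation (stdBasis H j) (annihilation (stdBasis H j) ψ)) χ :=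
      (hasSum_number_iff _ _ _).mpr fun s => h _ _ (slaterBasis_mem_sector _ s)
    exact ⟨h1.summable, h1.tsum_eq⟩

/-- A vector of the `n`-sector is an eigenvector of `N` for `n`. If Δ commutes with `N`, its image
is one too, and comparing eigenvalues makes it orthogonal to every other sector. Conversely,
symmetry moves Δ onto the test vector, which stays in its sector. -/
theorem commute_numberOp_iff {Δ : Fock H →L[ℂ] Fock H}
    (hΔ : ∀ φ ψ, (inner ℂ (Δ φ) ψ : ℂ) = inner ℂ φ (Δ ψ)) :
    (∀ ψ : (numberOp H).domain, ∃ h : Δ ψ ∈ (numberOp H).domain,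
      numberOp H ⟨Δ ψ, h⟩ = Δ (numberOp H ψ)) ↔ ∀ n, ∀ u ∈ sector H n, Δ u ∈ sector H n := by
  constructor
  · intro h n u hu l hl
    obtain ⟨h1, h2⟩ := (numberOp_eq_iff u ((n : ℂ) • u)).mpr fun m w hw => by
      rw [inner_smul_right]
      by_cases hmn : m = n
      · rw [hmn]
      · rw [inner_eq_zero_of_mem_sector hmn hw hu, mul_zero, mul_zero]
    have h3 := (numberOp_eq_iff _ _).mp (h ⟨u, h1⟩) _ _ (slaterList_mem_sector l)
    rw [h2, map_smul, inner_smul_right] at h3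
    by_contra h0
    exact hl (by exact_mod_cast (mul_right_cancel₀ h0 h3).symm)
  · rintro h ⟨ψ, hψ⟩
    refine (numberOp_eq_iff _ _).mpr fun n u hu => ?_
    rw [← hΔ, ← hΔ]
    exact (numberOp_eq_iff ψ _).mp ⟨hψ, rfl⟩ n _ (h n u hu)

/-- The expectation `⟨ψ, N ψ⟩ ∈ [0, ∞]` of the number operator. -/
noncomputable def numberForm (ψ : Fock H) : ENNReal :=
  ∑' s : Finset (stdIndex H), (s.card : ENNReal) *
    ENNReal.ofReal (‖(inner ℂ (slaterBasis (stdBasis H) s) ψ : ℂ)‖ ^ 2)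

theorem numberForm_eq_tsum (e : HilbertBasis ι ℂ (Fock H)) (d : ι → ℕ)
    (he : ∀ i, e i ∈ sector H (d i)) (ψ : Fock H) :
    numberForm ψ = ∑' i, (d i : ENNReal) * ENNReal.ofReal (‖(inner ℂ (e i) ψ : ℂ)‖ ^ 2) := by
  refine tsum_label (slaterBasis (stdBasis H)) e Finset.card d (fun s i h => ?_)
    (fun n : ℕ => (n : ENNReal)) ψ
  by_contra h0
  exact h (inner_eq_zero_of_mem_sector h0 (slaterBasis_mem_sector _ s) (he i))

theorem tsum_number_eq_numberForm (ψ : Fock H) :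
    ∑' j, ENNReal.ofReal (inner ℂ ψ ((creation (stdBasis H j) ∘L annihilation (stdBasis H j)) ψ) :
      ℂ).re = numberForm ψ := by
  classical
  simp_rw [fun j => ofReal_inner_eigenbasis (creation_annihilation_slaterBasis (stdBasis H) j)
    (fun s => by split_ifs <;> norm_num) ψ]
  rw [ENNReal.tsum_comm]
  refine tsum_congr fun s => ?_
  rw [ENNReal.tsum_mul_right]
  congr 1
  rw [tsum_eq_sum (s := s)]
  · rw [Finset.sum_congr rfl fun j hj => by rw [if_pos hj, ENNReal.ofReal_one]]
    simp
  · intro j hj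
    simp [hj]

/-- The trace is taken in the eigenbasis of Δ. All terms `dᵢ ‖a(fⱼ) φᵢ‖²` are nonnegative, so the
sums over `i` and `j` commute in `[0, ∞]`. -/
theorem expectedNumber_eq_tsum {Δ : Fock H →L[ℂ] Fock H} {φ : HilbertBasis ι ℂ (Fock H)}
    {d : ι → ℝ} (hφ : ∀ i, Δ (φ i) = (d i : ℂ) • φ i) (hd : ∀ i, 0 ≤ d i) (hs : Summable d) :
    expectedNumber Δ = ∑' i, ENNReal.ofReal (d i) * numberForm (φ i) := by
  have h1 : ∀ j, ENNReal.ofReal (opTrace (Δ ∘L creation (stdBasis H j) ∘L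
      annihilation (stdBasis H j))).re = ∑' i, ENNReal.ofReal (d i) * ENNReal.ofReal
        (inner ℂ (φ i) ((creation (stdBasis H j) ∘L annihilation (stdBasis H j)) (φ i)) : ℂ).re := by
    intro j
    rw [opTrace_comp_eq_tsum hφ hd hs]
    have h2 := Complex.hasSum_re (summable_trace (b := φ) hd hs
      (creation (stdBasis H j) ∘L annihilation (stdBasis H j))).hasSum
    rw [← h2.tsum_eq]
    have h3 : ∀ i, 0 ≤ (inner ℂ (φ i) ((creation (stdBasis H j) ∘L
        annihilation (stdBasis H j)) (φ i)) : ℂ).re := by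
      intro i
      rw [ContinuousLinearMap.comp_apply, ← ContinuousLinearMap.adjoint_inner_left]
      exact inner_self_nonneg (𝕜 := ℂ)
    simp_rw [Complex.re_ofReal_mul] at h2 ⊢
    rw [ENNReal.ofReal_tsum_of_nonneg (fun i => mul_nonneg (hd i) (h3 i)) h2.summable]
    simp_rw [ENNReal.ofReal_mul (hd _)]
  unfold expectedNumber
  simp_rw [h1]
  rw [ENNReal.tsum_comm]
  refine tsum_congr fun i => ?_
  rw [ENNReal.tsum_mul_left, tsum_number_eq_numberForm]

end Number

/-! ### Product states belong to the class `ClassD` -/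

section Product

variable {H : Type*} [NormedAddCommGroup H] [InnerProductSpace ℂ H]
variable {ι κ : Type*}

theorem ClassD.mem_sector [CompleteSpace H] {Δ : Fock H →L[ℂ] Fock H} (hΔ : ClassD Δ) {n : ℕ} {u : Fock H}
    (hu : u ∈ sector H n) : Δ u ∈ sector H n :=
  (commute_numberOp_iff hΔ.isDensityOperator.isPositive.isSymmetric).mp hΔ.commute n u hu

theorem IsDensityOperator.exists_eigenbasis {E : Type*} [NormedAddCommGroup E]
    [InnerProductSpace ℂ E] [CompleteSpace E] {D : E →L[ℂ] E} (hD : IsDensityOperator D) :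
    ∃ b : EigenBasis D, (∀ i, 0 ≤ b.eigenvalue i) ∧ HasSum b.eigenvalue 1 := by
  obtain ⟨b⟩ := Nonfreeness.exists_eigenbasis hD.isPositive (by simp [hD.trace_eq_one])
  have h0 := eigenvalue_nonneg hD.isPositive b.apply_basis
  exact ⟨b, h0, hasSum_of_posTrace b.apply_basis h0 hD.trace_eq_one⟩

theorem isDensityOperator_of_eigenbasis {E : Type*} [NormedAddCommGroup E]
    [InnerProductSpace ℂ E] [CompleteSpace E] {D : E →L[ℂ] E} {b : HilbertBasis ι ℂ E} {p : ι → ℝ}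
    (hb : ∀ i, D (b i) = (p i : ℂ) • b i) (hp : ∀ i, 0 ≤ p i) (hs : HasSum p 1) :
    IsDensityOperator D := by
  refine ⟨isPositive_of_eigenbasis hb hp, ?_⟩
  rw [posTrace_eq_tsum hb hp, ← ENNReal.ofReal_tsum_of_nonneg hp hs.summable, hs.tsum_eq,
    ENNReal.ofReal_one]

variable (K : Submodule ℂ H) [CompleteSpace K]

theorem fockProd_wedgeBasis {A : Fock K →L[ℂ] Fock K} {B : Fock Kᗮ →L[ℂ] Fock Kᗮ}
    {φ : HilbertBasis ι ℂ (Fock K)} {d : ι → ℝ} (hφ : ∀ i, A (φ i) = (d i : ℂ) • φ i)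
    {χ : HilbertBasis κ ℂ (Fock Kᗮ)} {e : κ → ℝ} (hχ : ∀ i, B (χ i) = (e i : ℂ) • χ i)
    (q : ι × κ) :
    fockProd K A B (wedgeBasis K φ χ q) = ((d q.1 * e q.2 : ℝ) : ℂ) • wedgeBasis K φ χ q := by
  rw [wedgeBasis_apply, fockProd_fockWedge, hφ, hχ, map_smul, map_smul, smul_apply, smul_smul,
    mul_comm, Complex.ofReal_mul]

theorem hasSum_mul_one {d : ι → ℝ} {e : κ → ℝ} (hd : ∀ i, 0 ≤ d i) (he : ∀ k, 0 ≤ e k)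
    (hsd : HasSum d 1) (hse : HasSum e 1) : HasSum (fun q : ι × κ => d q.1 * e q.2) 1 := by
  simpa using hsd.mul hse (hsd.summable.mul_of_nonneg hse.summable hd he)

variable [CompleteSpace H]

/-- Particle numbers add and squared coefficients multiply on product Slater vectors; the unused
factor sums to 1 by Parseval. -/
theorem numberForm_fockWedge {φ : Fock K} {χ : Fock Kᗮ} (hφ : ‖φ‖ = 1) (hχ : ‖χ‖ = 1) :
    numberForm (fockWedge K φ χ) = numberForm φ + numberForm χ := by
  rw [numberForm_eq_tsum _ _ (wedgeBasis_mem_sector K (stdBasis K) (stdBasis Kᗮ)),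
    ENNReal.tsum_prod']
  have h1 : ∀ (s : Finset (stdIndex K)) (t : Finset (stdIndex Kᗮ)),
      ((s.card + t.card : ℕ) : ENNReal) * ENNReal.ofReal (‖(inner ℂ
        (wedgeBasis K (slaterBasis (stdBasis K)) (slaterBasis (stdBasis Kᗮ)) (s, t))
        (fockWedge K φ χ) : ℂ)‖ ^ 2) =
      (s.card * ENNReal.ofReal (‖(inner ℂ (slaterBasis (stdBasis K) s) φ : ℂ)‖ ^ 2)) *
        ENNReal.ofReal (‖(inner ℂ (slaterBasis (stdBasis Kᗮ) t) χ : ℂ)‖ ^ 2) +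
      ENNReal.ofReal (‖(inner ℂ (slaterBasis (stdBasis K) s) φ : ℂ)‖ ^ 2) *
        (t.card * ENNReal.ofReal (‖(inner ℂ (slaterBasis (stdBasis Kᗮ) t) χ : ℂ)‖ ^ 2)) := by
    intro s t
    rw [wedgeBasis_apply, inner_fockWedge, norm_mul, mul_pow, ENNReal.ofReal_mul (by positivity)]
    push_cast
    ring
  simp_rw [h1, ENNReal.tsum_add, ENNReal.tsum_mul_left, ENNReal.tsum_mul_right,
    tsum_ofReal_norm_inner_sq, hφ, hχ]
  simp [numberForm]

/-- The product of eigenbases gives positivity and trace one. For commutation with `N`, the product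
operator is moved onto a product of Slater vectors, where each factor stays in its sector. The
expected number is the sum of the two expected numbers because the eigenvalues of each factor sum to
1. -/
theorem ClassD.fockProd {Δ₁ : Fock K →L[ℂ] Fock K} {Δ₂ : Fock Kᗮ →L[ℂ] Fock Kᗮ} (h₁ : ClassD Δ₁)
    (h₂ : ClassD Δ₂) : ClassD (fockProd K Δ₁ Δ₂) := by
  obtain ⟨b, hb0, hb1⟩ := h₁.isDensityOperator.exists_eigenbasis
  obtain ⟨c, hc0, hc1⟩ := h₂.isDensityOperator.exists_eigenbasis
  have hw := fockProd_wedgeBasis K b.apply_basis c.apply_basis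
  have h0 : ∀ q : b.index × c.index, 0 ≤ b.eigenvalue q.1 * c.eigenvalue q.2 :=
    fun q => mul_nonneg (hb0 _) (hc0 _)
  have h1 := hasSum_mul_one hb0 hc0 hb1 hc1
  have hD := isDensityOperator_of_eigenbasis hw h0 h1
  refine ⟨hD, (commute_numberOp_iff hD.isPositive.isSymmetric).mpr fun n u hu => ?_, ?_⟩
  · have he := wedgeBasis_mem_sector K (stdBasis K) (stdBasis Kᗮ)
    rw [mem_sector_iff_basis _ _ he]
    rintro ⟨s, t⟩ hst
    rw [← ContinuousLinearMap.coe_coe, ← hD.isPositive.isSymmetric, ContinuousLinearMap.coe_coe,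
      wedgeBasis_apply, fockProd_fockWedge]
    exact inner_eq_zero_of_mem_sector hst (fockWedge_mem_sector K
      (h₁.mem_sector (slaterBasis_mem_sector _ s)) (h₂.mem_sector (slaterBasis_mem_sector _ t))) hu
  · have e1 := h₁.expectedNumber_lt_top
    have e2 := h₂.expectedNumber_lt_top
    rw [expectedNumber_eq_tsum b.apply_basis hb0 hb1.summable] at e1
    rw [expectedNumber_eq_tsum c.apply_basis hc0 hc1.summable] at e2
    rw [expectedNumber_eq_tsum hw h0 h1.summable, ENNReal.tsum_prod']
    have h2 : ∀ i k, ENNReal.ofReal (b.eigenvalue i * c.eigenvalue k) *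
        numberForm (wedgeBasis K b.basis c.basis (i, k)) =
        (ENNReal.ofReal (b.eigenvalue i) * numberForm (b.basis i)) *
          ENNReal.ofReal (c.eigenvalue k) +
        ENNReal.ofReal (b.eigenvalue i) *
          (ENNReal.ofReal (c.eigenvalue k) * numberForm (c.basis k)) := by
      intro i k
      rw [wedgeBasis_apply, numberForm_fockWedge K (norm_basis _ _) (norm_basis _ _),
        ENNReal.ofReal_mul (hb0 i)]
      ring
    have s1 : ∑' i, ENNReal.ofReal (b.eigenvalue i) = 1 := by
      rw [← ENNReal.ofReal_tsum_of_nonneg hb0 hb1.summable, hb1.tsum_eq, ENNReal.ofReal_one]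
    have s2 : ∑' i, ENNReal.ofReal (c.eigenvalue i) = 1 := by
      rw [← ENNReal.ofReal_tsum_of_nonneg hc0 hc1.summable, hc1.tsum_eq, ENNReal.ofReal_one]
    simp_rw [h2, ENNReal.tsum_add, ENNReal.tsum_mul_left, ENNReal.tsum_mul_right, s1, s2, mul_one,
      one_mul]
    exact ENNReal.add_lt_top.mpr ⟨e1, e2⟩

end Product

/-! ### The one-particle statistical operator -/

section OneParticle

variable {H : Type*} [NormedAddCommGroup H] [InnerProductSpace ℂ H]
variable {ι κ : Type*}

theorem norm_annihilation_le (h : H) : ‖annihilation h‖ ≤ ‖h‖ := by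
  rw [annihilation, LinearIsometryEquiv.norm_map]
  exact norm_creation_le h

theorem inner_creation_annihilation (g h : H) (ψ : Fock H) :
    (inner ℂ ψ ((creation g ∘L annihilation h) ψ) : ℂ) =
      inner ℂ (annihilation g ψ) (annihilation h ψ) := by
  rw [ContinuousLinearMap.comp_apply, annihilation, annihilation,
    ContinuousLinearMap.adjoint_inner_left]

theorem annihilation_add (g h : H) : annihilation (g + h) = annihilation g + annihilation h := by
  rw [annihilation, creation_add, map_add]
  rfl

theorem annihilation_smul (c : ℂ) (h : H) :
    annihilation (c • h) = (starRingEnd ℂ) c • annihilation h := by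
  rw [annihilation, creation_smul, map_smulₛₗ]
  rfl

theorem opTrace_comp_add {D : Fock H →L[ℂ] Fock H} (hD : IsDensityOperator D)
    (X Y : Fock H →L[ℂ] Fock H) :
    opTrace (D ∘L (X + Y)) = opTrace (D ∘L X) + opTrace (D ∘L Y) := by
  obtain ⟨b, hb0, hb1⟩ := hD.exists_eigenbasis
  simp_rw [opTrace_comp_eq_tsum b.apply_basis hb0 hb1.summable]
  rw [← (summable_trace hb0 hb1.summable X).tsum_add (summable_trace hb0 hb1.summable Y)]
  simp_rw [add_apply, inner_add_right, mul_add]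

theorem opTrace_comp_smul {D : Fock H →L[ℂ] Fock H} (hD : IsDensityOperator D) (c : ℂ)
    (X : Fock H →L[ℂ] Fock H) : opTrace (D ∘L (c • X)) = c * opTrace (D ∘L X) := by
  obtain ⟨b, hb0, hb1⟩ := hD.exists_eigenbasis
  simp_rw [opTrace_comp_eq_tsum b.apply_basis hb0 hb1.summable]
  rw [← tsum_mul_left]
  simp_rw [smul_apply, inner_smul_right]
  exact tsum_congr fun i => by ring

theorem norm_opTrace_comp_le {D : Fock H →L[ℂ] Fock H} (hD : IsDensityOperator D)
    (X : Fock H →L[ℂ] Fock H) : ‖opTrace (D ∘L X)‖ ≤ ‖X‖ := by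
  obtain ⟨b, hb0, hb1⟩ := hD.exists_eigenbasis
  rw [opTrace_comp_eq_tsum b.apply_basis hb0 hb1.summable]
  have h := hb1.mul_right ‖X‖
  rw [one_mul] at h
  refine tsum_of_norm_bounded h fun i => ?_
  rw [norm_mul, Complex.norm_real, Real.norm_of_nonneg (hb0 i)]
  exact mul_le_mul_of_nonneg_left (norm_inner_clm_le X i b.basis) (hb0 i)

variable [CompleteSpace H]

/-- The form `(h, g) ↦ Tr(D a†(g) a(h))` is sesquilinear and bounded by `‖h‖ ‖g‖`, so the Riesz
representation applies. Hence the default value 0 in `oneParticleOp` is never taken for a density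
operator. -/
theorem exists_oneParticleOp {D : Fock H →L[ℂ] Fock H} (hD : IsDensityOperator D) :
    ∃ γ : H →L[ℂ] H, ∀ g h : H,
      (inner ℂ h (γ g) : ℂ) = opTrace (D ∘L creation g ∘L annihilation h) := by
  let B : H →L⋆[ℂ] H →L[ℂ] ℂ := LinearMap.mkContinuous₂
    (LinearMap.mk₂'ₛₗ (starRingEnd ℂ) (RingHom.id ℂ)
      (fun h g => opTrace (D ∘L creation g ∘L annihilation h))
      (fun h h' g => by rw [annihilation_add, ContinuousLinearMap.comp_add, opTrace_comp_add hD])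
      (fun c h g => by
        rw [annihilation_smul, ContinuousLinearMap.comp_smul, opTrace_comp_smul hD, smul_eq_mul])
      (fun h g g' => by rw [creation_add, ContinuousLinearMap.add_comp, opTrace_comp_add hD])
      (fun c h g => by
        rw [creation_smul, ContinuousLinearMap.smul_comp, opTrace_comp_smul hD, smul_eq_mul]
        rfl)) 1 (fun h g => by
      refine (norm_opTrace_comp_le hD _).trans ((ContinuousLinearMap.opNorm_comp_le _ _).trans ?_)
      rw [one_mul, mul_comm]
      exact mul_le_mul (norm_annihilation_le h) (norm_creation_le g) (norm_nonneg _) (norm_nonneg _))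
  -- The operator supplied by the Riesz theorem acts on the conjugate-linear argument `h`; its
  -- adjoint acts on `g`.
  refine ⟨ContinuousLinearMap.adjoint (InnerProductSpace.continuousLinearMapOfBilin B),
    fun g h => ?_⟩
  rw [ContinuousLinearMap.adjoint_inner_right, InnerProductSpace.continuousLinearMapOfBilin_apply]
  rfl

theorem inner_oneParticleOp {D : Fock H →L[ℂ] Fock H} (hD : IsDensityOperator D) (g h : H) :
    (inner ℂ h (oneParticleOp D g) : ℂ) = opTrace (D ∘L creation g ∘L annihilation h) := by
  rw [oneParticleOp, dif_pos (exists_oneParticleOp hD)]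
  exact (exists_oneParticleOp hD).choose_spec g h

theorem oneParticleOp_eq {D : Fock H →L[ℂ] Fock H} (hD : IsDensityOperator D) {γ : H →L[ℂ] H}
    (hγ : ∀ g h : H, (inner ℂ h (γ g) : ℂ) = opTrace (D ∘L creation g ∘L annihilation h)) :
    oneParticleOp D = γ := by
  ext g
  refine ext_inner_left ℂ fun h => ?_
  rw [inner_oneParticleOp hD, hγ]

theorem inner_oneParticleOp_self {D : Fock H →L[ℂ] Fock H} {φ : HilbertBasis ι ℂ (Fock H)}
    {d : ι → ℝ} (hφ : ∀ i, D (φ i) = (d i : ℂ) • φ i) (hd : ∀ i, 0 ≤ d i) (hs : HasSum d 1)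
    (g : H) : HasSum (fun i => ((d i * ‖annihilation g (φ i)‖ ^ 2 : ℝ) : ℂ))
      (inner ℂ g (oneParticleOp D g)) := by
  have h := (summable_trace (b := φ) hd hs.summable (creation g ∘L annihilation g)).hasSum
  rw [← opTrace_comp_eq_tsum hφ hd hs.summable,
    ← inner_oneParticleOp (isDensityOperator_of_eigenbasis hφ hd hs)] at h
  simp_rw [inner_creation_annihilation, inner_self_eq_norm_sq_to_K] at h
  convert h with i
  simp

theorem oneParticleOp_isPositive {D : Fock H →L[ℂ] Fock H} (hD : IsDensityOperator D) :
    (oneParticleOp D).IsPositive := by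
  obtain ⟨b, hb0, hb1⟩ := hD.exists_eigenbasis
  rw [ContinuousLinearMap.isPositive_iff_complex]
  intro g
  have h := inner_oneParticleOp_self b.apply_basis hb0 hb1 g
  have hre := Complex.hasSum_re h
  simp only [Complex.ofReal_re] at hre
  have h1 := h.unique (Complex.hasSum_ofReal.mpr hre)
  have h2 := hre.nonneg fun i => mul_nonneg (hb0 i) (by positivity)
  rw [← inner_conj_symm, h1]
  simp [h2]

/-- Term by term the same series. Finite expected particle number therefore makes `γ` trace class,
which gives it an eigenbasis. -/
theorem posTrace_oneParticleOp {D : Fock H →L[ℂ] Fock H} (hD : IsDensityOperator D) :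
    posTrace (oneParticleOp D) = expectedNumber D := by
  unfold posTrace expectedNumber
  simp_rw [inner_oneParticleOp hD]

theorem re_inner_oneParticleOp_le {D : Fock H →L[ℂ] Fock H} (hD : IsDensityOperator D) (g : H) :
    (inner ℂ g (oneParticleOp D g) : ℂ).re ≤ ‖g‖ ^ 2 := by
  rw [inner_oneParticleOp hD]
  refine (Complex.re_le_norm _).trans ((norm_opTrace_comp_le hD _).trans
    ((ContinuousLinearMap.opNorm_comp_le _ _).trans ?_))
  rw [sq]
  exact mul_le_mul (norm_creation_le g) (norm_annihilation_le g) (norm_nonneg _) (norm_nonneg _)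

theorem ClassD.exists_eigenbasis_oneParticleOp {D : Fock H →L[ℂ] Fock H} (hD : ClassD D) :
    Nonempty (EigenBasis (oneParticleOp D)) :=
  exists_eigenbasis (oneParticleOp_isPositive hD.isDensityOperator) (by
    rw [posTrace_oneParticleOp hD.isDensityOperator]
    exact hD.expectedNumber_lt_top.ne)

theorem ClassD.eigenvalue_oneParticleOp {D : Fock H →L[ℂ] Fock H} (hD : ClassD D)
    {b : HilbertBasis ι ℂ H} {p : ι → ℝ} (hb : ∀ i, oneParticleOp D (b i) = (p i : ℂ) • b i) :
    (∀ i, 0 ≤ p i) ∧ (∀ i, p i ≤ 1) ∧ Summable p := by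
  have h0 := eigenvalue_nonneg (oneParticleOp_isPositive hD.isDensityOperator) hb
  refine ⟨h0, fun i => ?_, summable_of_posTrace hb h0 ?_⟩
  · have h := re_inner_oneParticleOp_le hD.isDensityOperator (b i)
    rw [hb, inner_smul_right, inner_self_eq_norm_sq_to_K, norm_basis] at h
    simpa using h
  · rw [posTrace_oneParticleOp hD.isDensityOperator]
    exact hD.expectedNumber_lt_top.ne

end OneParticle

/-! ### The one-particle operator of a product state -/

theorem opDirectSum_apply {H : Type*} [NormedAddCommGroup H] [InnerProductSpace ℂ H]
    (K : Submodule ℂ H) [CompleteSpace K] (γ₁ : K →L[ℂ] K) (γ₂ : Kᗮ →L[ℂ] Kᗮ) (k : K) (l : Kᗮ) :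
    opDirectSum K γ₁ γ₂ ((k : H) + l) = (γ₁ k : H) + γ₂ l := by
  have h1 : K.orthogonalProjectionOnto ((k : H) + l) = k := by
    rw [map_add, Submodule.orthogonalProjectionOnto_mem_subspace_eq_self,
      Submodule.orthogonalProjectionOnto_apply_of_mem_orthogonal l.2, add_zero]
  have h2 : Kᗮ.orthogonalProjectionOnto ((k : H) + l) = l := by
    rw [map_add, Submodule.orthogonalProjectionOnto_mem_subspace_eq_self,
      Submodule.orthogonalProjectionOnto_apply_of_mem_orthogonal
        (K.le_orthogonal_orthogonal k.2), zero_add]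
  simp only [opDirectSum, add_apply, ContinuousLinearMap.comp_apply, h1, h2,
    Submodule.subtypeL_apply]

section OneParticleProduct

variable {H : Type*} [NormedAddCommGroup H] [InnerProductSpace ℂ H] [CompleteSpace H]
variable {ι κ : Type*}

theorem IsDensityOperator.hasSum_trace {E : Type*} [NormedAddCommGroup E]
    [InnerProductSpace ℂ E] [CompleteSpace E] {D : E →L[ℂ] E} (hD : IsDensityOperator D)
    (e : HilbertBasis κ ℂ E) (X : E →L[ℂ] E) :
    HasSum (fun k => (inner ℂ (e k) (D (X (e k))) : ℂ)) (opTrace (D ∘L X)) := by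
  obtain ⟨b, hb0, hb1⟩ := hD.exists_eigenbasis
  exact opTrace_comp_eq_tsum_basis b.apply_basis hb0 hb1.summable X e

theorem IsDensityOperator.opTrace_comp_id {E : Type*} [NormedAddCommGroup E]
    [InnerProductSpace ℂ E] [CompleteSpace E] {D : E →L[ℂ] E} (hD : IsDensityOperator D) :
    opTrace (D ∘L ContinuousLinearMap.id ℂ E) = 1 := by
  obtain ⟨b, hb0, hb1⟩ := hD.exists_eigenbasis
  rw [opTrace_comp_eq_tsum b.apply_basis hb0 hb1.summable]
  simp only [ContinuousLinearMap.id_apply, inner_self_eq_norm_sq_to_K, norm_basis]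
  simp only [RCLike.ofReal_one, one_pow, mul_one]
  exact_mod_cast (Complex.hasSum_ofReal.mpr hb1).tsum_eq

variable (K : Submodule ℂ H) [CompleteSpace K]
  {Δ₁ : Fock K →L[ℂ] Fock K} {Δ₂ : Fock Kᗮ →L[ℂ] Fock Kᗮ}

/-- In the product basis the diagonal entries factorise, and so does the trace. The hypothesis on
`X` is needed only on basis vectors; for operators coming from `Kᗮ` it is checked on Slater vectors
of `K`, where the sign rule is available. -/
theorem opTrace_fockProd_comp (h₁ : ClassD Δ₁) (h₂ : ClassD Δ₂) (e : HilbertBasis ι ℂ (Fock K))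
    (e' : HilbertBasis κ ℂ (Fock Kᗮ)) {X : Fock H →L[ℂ] Fock H} {X₁ : Fock K →L[ℂ] Fock K}
    {X₂ : Fock Kᗮ →L[ℂ] Fock Kᗮ}
    (hX : ∀ i k, X (fockWedge K (e i) (e' k)) = fockWedge K (X₁ (e i)) (X₂ (e' k))) :
    opTrace (fockProd K Δ₁ Δ₂ ∘L X) = opTrace (Δ₁ ∘L X₁) * opTrace (Δ₂ ∘L X₂) := by
  have h := (h₁.fockProd K h₂).isDensityOperator.hasSum_trace (wedgeBasis K e e') X
  have h' : ∀ q : ι × κ, (inner ℂ (wedgeBasis K e e' q)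
      (fockProd K Δ₁ Δ₂ (X (wedgeBasis K e e' q))) : ℂ) =
      inner ℂ (e q.1) (Δ₁ (X₁ (e q.1))) * inner ℂ (e' q.2) (Δ₂ (X₂ (e' q.2))) := by
    intro q
    rw [wedgeBasis_apply, hX, fockProd_fockWedge, inner_fockWedge]
  simp_rw [h'] at h
  have h1 := h.prod_fiberwise fun i => (h₂.isDensityOperator.hasSum_trace e' X₂).mul_left
    (inner ℂ (e i) (Δ₁ (X₁ (e i))) : ℂ)
  exact h1.unique ((h₁.isDensityOperator.hasSum_trace e X₁).mul_right _)

/-- A creator raises the particle number by one and Δ preserves it, so the two vectors lie in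
different sectors. This is what eliminates the off-diagonal blocks. -/
theorem ClassD.inner_creation_eq_zero {Δ : Fock H →L[ℂ] Fock H} (hΔ : ClassD Δ) (b : ι → H)
    (s : Finset ι) (h : H) :
    (inner ℂ (slaterVecOf b s) (Δ (creation h (slaterVecOf b s))) : ℂ) = 0 :=
  inner_eq_zero_of_mem_sector (Nat.ne_of_lt (Nat.lt_succ_self _)) (slaterVecOf_mem_sector b s)
    (hΔ.mem_sector (creation_slaterVecOf_mem_sector b s h))

theorem opTrace_fockProd_left (h₁ : ClassD Δ₁) (h₂ : ClassD Δ₂) (g h : K) :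
    opTrace (fockProd K Δ₁ Δ₂ ∘L creation (g : H) ∘L annihilation (h : H)) =
      opTrace (Δ₁ ∘L creation g ∘L annihilation h) := by
  rw [opTrace_fockProd_comp K h₁ h₂ (stdBasis _) (stdBasis _) (X₁ := creation g ∘L annihilation h)
    (X₂ := ContinuousLinearMap.id ℂ _), h₂.isDensityOperator.opTrace_comp_id, mul_one]
  intro i k
  rw [ContinuousLinearMap.comp_apply, annihilation_fockWedge_left, ← fockWedge_creation_left]
  rfl

/-- The annihilator and the creator each produce the sign `(-1)^|s|`, and the two signs cancel. -/
theorem opTrace_fockProd_right (h₁ : ClassD Δ₁) (h₂ : ClassD Δ₂) (g h : Kᗮ) :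
    opTrace (fockProd K Δ₁ Δ₂ ∘L creation (g : H) ∘L annihilation (h : H)) =
      opTrace (Δ₂ ∘L creation g ∘L annihilation h) := by
  rw [opTrace_fockProd_comp K h₁ h₂ (slaterBasis (stdBasis _)) (stdBasis _)
    (X₁ := ContinuousLinearMap.id ℂ _)
    (X₂ := creation g ∘L annihilation h), h₁.isDensityOperator.opTrace_comp_id, one_mul]
  intro s k
  rw [ContinuousLinearMap.comp_apply, slaterBasis_apply, annihilation_fockWedge_slaterVecOf,
    map_smul, creation_fockWedge_slaterVecOf, smul_smul, ← mul_pow]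
  simp

theorem opTrace_fockProd_left_right (h₁ : ClassD Δ₁) (h₂ : ClassD Δ₂) (g : K) (h : Kᗮ) :
    opTrace (fockProd K Δ₁ Δ₂ ∘L creation (g : H) ∘L annihilation (h : H)) = 0 := by
  have hs := (h₁.fockProd K h₂).isDensityOperator.hasSum_trace
    (wedgeBasis K (slaterBasis (stdBasis K)) (slaterBasis (stdBasis Kᗮ)))
    (creation (g : H) ∘L annihilation (h : H))
  refine hs.unique ?_
  convert hasSum_zero with q
  rw [wedgeBasis_apply, ContinuousLinearMap.comp_apply, slaterBasis_apply,
    annihilation_fockWedge_slaterVecOf, map_smul, ← fockWedge_creation_left, map_smul,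
    fockProd_fockWedge, inner_smul_right, inner_fockWedge, h₁.inner_creation_eq_zero, zero_mul,
    mul_zero]

theorem opTrace_fockProd_right_left (h₁ : ClassD Δ₁) (h₂ : ClassD Δ₂) (g : Kᗮ) (h : K) :
    opTrace (fockProd K Δ₁ Δ₂ ∘L creation (g : H) ∘L annihilation (h : H)) = 0 := by
  have hs := (h₁.fockProd K h₂).isDensityOperator.hasSum_trace
    (wedgeBasis K (slaterBasis (stdBasis K)) (slaterBasis (stdBasis Kᗮ)))
    (creation (g : H) ∘L annihilation (h : H))
  refine hs.unique ?_
  convert hasSum_zero with q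
  -- The two operators anticommute because `h ⟂ g`. The creator is made to act first, while the left
  -- factor is still a Slater vector to which the sign rule applies.
  have hcar : ∀ ψ : Fock H, creation (g : H) (annihilation (h : H) ψ) =
      -annihilation (h : H) (creation (g : H) ψ) := by
    intro ψ
    rw [annihilation_creation, Submodule.inner_right_of_mem_orthogonal h.2 g.2, zero_smul, zero_sub,
      neg_neg]
  rw [wedgeBasis_apply, ContinuousLinearMap.comp_apply, hcar, slaterBasis_apply,
    creation_fockWedge_slaterVecOf, map_smul, annihilation_fockWedge_left, map_neg, map_smul,
    fockProd_fockWedge, inner_neg_right, inner_smul_right, inner_fockWedge, slaterBasis_apply,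
    h₂.inner_creation_eq_zero, mul_zero, mul_zero, neg_zero]

/-- Split `g` and `h` along `K ⊕ Kᗮ`. The two diagonal terms are those of the factors and the two
mixed terms vanish. -/
theorem oneParticleOp_fockProd (h₁ : ClassD Δ₁) (h₂ : ClassD Δ₂) :
    oneParticleOp (fockProd K Δ₁ Δ₂) =
      opDirectSum K (oneParticleOp Δ₁) (oneParticleOp Δ₂) := by
  have hD := (h₁.fockProd K h₂).isDensityOperator
  refine oneParticleOp_eq hD fun g h => ?_
  obtain ⟨k, hk, l, hl, rfl⟩ := K.exists_add_mem_mem_orthogonal g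
  obtain ⟨k', hk', l', hl', rfl⟩ := K.exists_add_mem_mem_orthogonal h
  lift k to K using hk
  lift l to Kᗮ using hl
  lift k' to K using hk'
  lift l' to Kᗮ using hl'
  rw [opDirectSum_apply, creation_add, annihilation_add, ContinuousLinearMap.add_comp,
    ContinuousLinearMap.comp_add (creation (k : H)),
    ContinuousLinearMap.comp_add (creation (l : H)), opTrace_comp_add hD,
    opTrace_comp_add hD, opTrace_comp_add hD, opTrace_fockProd_left K h₁ h₂,
    opTrace_fockProd_right K h₁ h₂, opTrace_fockProd_left_right K h₁ h₂,
    opTrace_fockProd_right_left K h₁ h₂, ← inner_oneParticleOp h₁.isDensityOperator,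
    ← inner_oneParticleOp h₂.isDensityOperator, inner_add_left, inner_add_right, inner_add_right,
    Submodule.inner_right_of_mem_orthogonal k'.2 (oneParticleOp Δ₂ l).2,
    Submodule.inner_left_of_mem_orthogonal (oneParticleOp Δ₁ k).2 l'.2, Submodule.coe_inner,
    Submodule.coe_inner]

end OneParticleProduct

/-! ### Free states: independence of the eigenbasis and factorisation -/

section FreeStates

variable {H : Type*} [NormedAddCommGroup H] [InnerProductSpace ℂ H]
variable {ι κ : Type*}

/-- A nonzero determinant has a nonzero term in its Leibniz expansion; the permutation of that term
pairs vectors with nonzero overlaps, hence with equal labels. -/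
theorem exists_equiv_of_inner_slaterVecOf_ne_zero {b : ι → H} {b' : κ → H} {L : Type*} {l : ι → L}
    {l' : κ → L} (hl : ∀ i k, (inner ℂ (b i) (b' k) : ℂ) ≠ 0 → l i = l' k) {s : Finset ι}
    {t : Finset κ} (h : (inner ℂ (slaterVecOf b s) (slaterVecOf b' t) : ℂ) ≠ 0) :
    ∃ σ : s ≃ t, ∀ i, l' (σ i) = l i := by
  rw [slaterVecOf, slaterVecOf, slater, slater, UniformSpace.Completion.inner_coe,
    SlaterSpan.inner_of] at h
  have hst : s.card = t.card := by
    by_contra h0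
    exact h (slaterKernel_of_ne h0)
  rw [slaterKernel, dif_pos hst, Matrix.det_apply'] at h
  obtain ⟨τ, -, hτ⟩ := Finset.exists_ne_zero_of_sum_ne_zero h
  have h1 := right_ne_zero_of_mul hτ
  rw [Finset.prod_ne_zero_iff] at h1
  refine ⟨(s.equivFin.trans τ.symm).trans ((finCongr hst).trans t.equivFin.symm), fun i => ?_⟩
  have h2 := hl _ _ (h1 (τ.symm (s.equivFin i)) (Finset.mem_univ _))
  rw [Equiv.apply_symm_apply, Equiv.symm_apply_apply] at h2
  exact h2.symm

theorem tsum_ite_eq_encard {L : Type*} [DecidableEq L] (l : ι → L) (c : L) :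
    ∑' i, (if l i = c then 1 else 0 : ENNReal) = ({i | l i = c}.encard : ENNReal) := by
  rw [← ENNReal.tsum_set_one, tsum_subtype {i | l i = c} fun _ => (1 : ENNReal)]
  refine tsum_congr fun i => ?_
  simp [Set.indicator_apply]

/-- Apply `tsum_label_indicator` to the indicator function of `c`: both sides count the dimension of
the eigenspace. -/
theorem ncard_eigenvalue_eq {T : H →L[ℂ] H} {b : HilbertBasis ι ℂ H} {p : ι → ℝ}
    {b' : HilbertBasis κ ℂ H} {p' : κ → ℝ} (hb : ∀ i, T (b i) = (p i : ℂ) • b i)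
    (hb' : ∀ i, T (b' i) = (p' i : ℂ) • b' i) (c : ℝ) :
    {i | p i = c}.ncard = {k | p' k = c}.ncard := by
  have h := tsum_label_indicator b b' p p' (eigenvalue_eq_of_inner_ne_zero hb hb')
    (fun x => if x = c then 1 else 0)
  rw [tsum_ite_eq_encard, tsum_ite_eq_encard] at h
  rw [Set.ncard, Set.ncard]
  congr 1
  exact_mod_cast h

/-- Each `b'ₖ` is nonzero, so it overlaps some `bᵢ` and shares its eigenvalue. Summability transfers
because the trace does not depend on the eigenbasis. -/
theorem eigenvalue_congr {T : H →L[ℂ] H} {b : HilbertBasis ι ℂ H} {p : ι → ℝ}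
    {b' : HilbertBasis κ ℂ H} {p' : κ → ℝ} (hb : ∀ i, T (b i) = (p i : ℂ) • b i)
    (hb' : ∀ i, T (b' i) = (p' i : ℂ) • b' i) (h0 : ∀ i, 0 ≤ p i) (h1 : ∀ i, p i ≤ 1)
    (hs : Summable p) : (∀ k, 0 ≤ p' k) ∧ (∀ k, p' k ≤ 1) ∧ Summable p' := by
  have hex : ∀ k, ∃ i, p i = p' k := by
    intro k
    by_contra! hk
    have h2 : b' k = 0 := ext_inner_basis b fun i => by
      rw [inner_zero_right]
      by_contra h0
      exact hk i (eigenvalue_eq_of_inner_ne_zero hb hb' i k h0)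
    have h3 := norm_basis b' k
    rw [h2, norm_zero] at h3
    exact zero_ne_one h3
  have h0' : ∀ k, 0 ≤ p' k := fun k => by
    obtain ⟨i, hi⟩ := hex k
    exact hi ▸ h0 i
  refine ⟨h0', fun k => ?_, ?_⟩
  · obtain ⟨i, hi⟩ := hex k
    exact hi ▸ h1 i
  · have h := tsum_label_indicator b b' p p' (eigenvalue_eq_of_inner_ne_zero hb hb') ENNReal.ofReal
    rw [← ENNReal.ofReal_tsum_of_nonneg h0 hs] at h
    have := ENNReal.summable_toReal (h ▸ ENNReal.ofReal_ne_top)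
    simpa only [ENNReal.toReal_ofReal (h0' _)] using this

variable [CompleteSpace H]

/-- The definition uses a chosen eigenbasis `c`, while `b` is arbitrary. Where Slater vectors of `c`
and `b` overlap, their index sets are matched with equal eigenvalues, so their weights agree; hence
the Slater vectors of `b` are eigenvectors too. -/
theorem freeState_slaterBasis {γ : H →L[ℂ] H} {b : HilbertBasis ι ℂ H} {p : ι → ℝ}
    (hb : ∀ i, γ (b i) = (p i : ℂ) • b i) (h0 : ∀ i, 0 ≤ p i) (h1 : ∀ i, p i ≤ 1)
    (hs : Summable p) (s : Finset ι) :
    freeState γ (slaterBasis b s) = (bernoulliWeight p s : ℂ) • slaterBasis b s := by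
  classical
  have hex : Nonempty (EigenBasis γ) := ⟨EigenBasis.ofHilbertBasis b p hb⟩
  set c := Classical.choice hex with hc
  obtain ⟨h0', h1', hs'⟩ := eigenvalue_congr hb c.apply_basis h0 h1 hs
  have hw := hasSum_bernoulliWeight h0' h1' hs'
  have hfree : HasSum (fun t : Finset c.index => ((bernoulliWeight c.eigenvalue t : ℝ) : ℂ) •
      InnerProductSpace.rankOne ℂ (slaterBasis c.basis t) (slaterBasis c.basis t))
      (freeState γ) := by
    rw [freeState, dif_pos hex]
    have hsm : Summable (fun t : Finset c.index => ((bernoulliWeight c.eigenvalue t : ℝ) : ℂ) •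
        InnerProductSpace.rankOne ℂ (slaterBasis c.basis t) (slaterBasis c.basis t)) := by
      -- The projections have norm 1 and the weights are summable, so the series converges in
      -- operator norm and `tsum` does not take its default value.
      refine Summable.of_norm_bounded hw.summable fun t => ?_
      rw [norm_smul, InnerProductSpace.norm_rankOne, norm_basis, Complex.norm_real,
        Real.norm_of_nonneg (bernoulliWeight_nonneg h0' h1' hs' t)]
      simp
    convert hsm.hasSum using 1
    refine tsum_congr fun t => ?_
    rw [slaterBasis_apply]
    rfl
  have hdiag : ∀ t, freeState γ (slaterBasis c.basis t) =
      (bernoulliWeight c.eigenvalue t : ℂ) • slaterBasis c.basis t := by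
    intro t
    have h2 := hfree.mapL (ContinuousLinearMap.apply ℂ (Fock H) (slaterBasis c.basis t))
    refine h2.unique ?_
    convert hasSum_ite_eq t ((bernoulliWeight c.eigenvalue t : ℂ) • slaterBasis c.basis t) using 1
    funext u
    rw [ContinuousLinearMap.apply_apply, smul_apply, InnerProductSpace.rankOne_apply, inner_basis]
    split_ifs with hu
    · rw [hu, one_smul]
    · rw [zero_smul, smul_zero]
  refine ext_inner_basis (slaterBasis c.basis) fun t => ?_
  rw [inner_eigenbasis_apply hdiag, inner_smul_right]
  by_cases hin : (inner ℂ (slaterBasis c.basis t) (slaterBasis b s) : ℂ) = 0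
  · rw [hin, mul_zero, mul_zero]
  · rw [slaterBasis_apply, slaterBasis_apply] at hin
    obtain ⟨σ, hσ⟩ := exists_equiv_of_inner_slaterVecOf_ne_zero
      (eigenvalue_eq_of_inner_ne_zero c.apply_basis hb) hin
    rw [bernoulliWeight_congr hs' hs (fun x _ => ncard_eigenvalue_eq c.apply_basis hb x) σ hσ]

theorem isDensityOperator_freeState {γ : H →L[ℂ] H} {b : HilbertBasis ι ℂ H} {p : ι → ℝ}
    (hb : ∀ i, γ (b i) = (p i : ℂ) • b i) (h0 : ∀ i, 0 ≤ p i) (h1 : ∀ i, p i ≤ 1)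
    (hs : Summable p) : IsDensityOperator (freeState γ) :=
  isDensityOperator_of_eigenbasis (freeState_slaterBasis hb h0 h1 hs)
    (bernoulliWeight_nonneg h0 h1 hs) (hasSum_bernoulliWeight h0 h1 hs)

theorem ClassD.isDensityOperator_freeState {Δ : Fock H →L[ℂ] Fock H} (hΔ : ClassD Δ) :
    IsDensityOperator (freeState (oneParticleOp Δ)) := by
  obtain ⟨b⟩ := hΔ.exists_eigenbasis_oneParticleOp
  obtain ⟨h0, h1, hs⟩ := hΔ.eigenvalue_oneParticleOp b.apply_basis
  exact Nonfreeness.isDensityOperator_freeState b.apply_basis h0 h1 hs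

variable (K : Submodule ℂ H) [CompleteSpace K]

/-- The union of Hilbert bases of a subspace and of its orthogonal complement. -/
noncomputable def sumBasis (b : HilbertBasis ι ℂ K) (b' : HilbertBasis κ ℂ Kᗮ) :
    HilbertBasis (ι ⊕ κ) ℂ H :=
  HilbertBasis.mkOfOrthogonalEqBot
    (v := Sum.elim (fun i => (b i : H)) (fun k => (b' k : H)))
    (by
      classical
      rw [orthonormal_iff_ite]
      rintro (i | i) (j | j)
      · simp [← Submodule.coe_inner, inner_basis]
      · simp [Submodule.inner_right_of_mem_orthogonal (b i).2 (b' j).2]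
      · simp [Submodule.inner_left_of_mem_orthogonal (b j).2 (b' i).2]
      · simp [← Submodule.coe_inner, inner_basis])
    (by
      rw [eq_bot_iff]
      intro v hv
      rw [Submodule.mem_orthogonal] at hv
      obtain ⟨k, hk, l, hl, rfl⟩ := K.exists_add_mem_mem_orthogonal v
      lift k to K using hk
      lift l to Kᗮ using hl
      have h1 : k = 0 := ext_inner_basis b fun i => by
        have := hv _ (Submodule.subset_span ⟨Sum.inl i, rfl⟩)
        rwa [Sum.elim_inl, inner_add_right, Submodule.inner_right_of_mem_orthogonal (b i).2 l.2,
          add_zero, ← Submodule.coe_inner, ← inner_zero_right (𝕜 := ℂ) (b i)] at this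
      have h2 : l = 0 := ext_inner_basis b' fun i => by
        have := hv _ (Submodule.subset_span ⟨Sum.inr i, rfl⟩)
        rwa [Sum.elim_inr, inner_add_right, Submodule.inner_left_of_mem_orthogonal k.2 (b' i).2,
          zero_add, ← Submodule.coe_inner, ← inner_zero_right (𝕜 := ℂ) (b' i)] at this
      simp [h1, h2])

theorem coe_sumBasis (b : HilbertBasis ι ℂ K) (b' : HilbertBasis κ ℂ Kᗮ) :
    ⇑(sumBasis K b b') = Sum.elim (fun i => (b i : H)) (fun k => (b' k : H)) :=
  HilbertBasis.coe_mkOfOrthogonalEqBot _ _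

theorem wedgeBasis_slaterBasis (b : HilbertBasis ι ℂ K) (b' : HilbertBasis κ ℂ Kᗮ) (s : Finset ι)
    (t : Finset κ) :
    EqUpToSign (wedgeBasis K (slaterBasis b) (slaterBasis b') (s, t))
      (slaterBasis (sumBasis K b b') (s.disjSum t)) := by
  obtain ⟨l, h1, h2, -, hl⟩ := slaterVecOf_eq_slaterList b s
  obtain ⟨l', h1', h2', -, hl'⟩ := slaterVecOf_eq_slaterList b' t
  have h := slaterVecOf_of_nodup (sumBasis K b b') (s := s.disjSum t)
    (l := l.map Sum.inl ++ l'.map Sum.inr) (by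
      rw [List.nodup_append]
      refine ⟨h1.map Sum.inl_injective, h1'.map Sum.inr_injective, ?_⟩
      intro x hx y hy
      obtain ⟨i, -, rfl⟩ := List.mem_map.mp hx
      obtain ⟨j, -, rfl⟩ := List.mem_map.mp hy
      exact Sum.inl_ne_inr) (by
      rintro (i | i)
      · simp [h2]
      · simp [h2'])
  rw [wedgeBasis_apply, slaterBasis_apply, slaterBasis_apply, slaterBasis_apply]
  convert h using 1
  rw [hl, hl', fockWedge_slaterList, coe_sumBasis]
  simp only [List.map_append, List.map_map]
  rfl

theorem opDirectSum_sumBasis {γ₁ : K →L[ℂ] K} {γ₂ : Kᗮ →L[ℂ] Kᗮ} {b : HilbertBasis ι ℂ K}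
    {b' : HilbertBasis κ ℂ Kᗮ} {p : ι → ℝ} {q : κ → ℝ} (hb : ∀ i, γ₁ (b i) = (p i : ℂ) • b i)
    (hb' : ∀ i, γ₂ (b' i) = (q i : ℂ) • b' i) (i : ι ⊕ κ) :
    opDirectSum K γ₁ γ₂ (sumBasis K b b' i) = ((Sum.elim p q i : ℝ) : ℂ) • sumBasis K b b' i := by
  rw [coe_sumBasis]
  rcases i with i | i
  · have := opDirectSum_apply K γ₁ γ₂ (b i) 0
    simp only [hb, map_zero, ZeroMemClass.coe_zero, add_zero] at this
    exact this
  · have := opDirectSum_apply K γ₁ γ₂ 0 (b' i)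
    simp only [hb', map_zero, ZeroMemClass.coe_zero, zero_add] at this
    exact this

/-- Both sides are diagonal in the product of the two Slater bases, and the eigenvalues agree by
`bernoulliWeight_disjSum`. -/
theorem freeState_opDirectSum {γ₁ : K →L[ℂ] K} {γ₂ : Kᗮ →L[ℂ] Kᗮ} {b : HilbertBasis ι ℂ K}
    {b' : HilbertBasis κ ℂ Kᗮ} {p : ι → ℝ} {q : κ → ℝ} (hb : ∀ i, γ₁ (b i) = (p i : ℂ) • b i)
    (hb' : ∀ i, γ₂ (b' i) = (q i : ℂ) • b' i) (hp0 : ∀ i, 0 ≤ p i) (hp1 : ∀ i, p i ≤ 1)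
    (hp : Summable p) (hq0 : ∀ i, 0 ≤ q i) (hq1 : ∀ i, q i ≤ 1) (hq : Summable q) :
    freeState (opDirectSum K γ₁ γ₂) = fockProd K (freeState γ₁) (freeState γ₂) := by
  refine ext_clm_basis (wedgeBasis K (slaterBasis b) (slaterBasis b')) fun ⟨s, t⟩ => ?_
  rw [fockProd_wedgeBasis K (freeState_slaterBasis hb hp0 hp1 hp)
    (freeState_slaterBasis hb' hq0 hq1 hq)]
  -- The sign relating the two kinds of Slater vectors is a common scalar on both sides and does not
  -- affect the eigenvalue.
  obtain ⟨c, -, hc⟩ := (wedgeBasis_slaterBasis K b b' s t).exists_unit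
  rw [hc, map_smul, freeState_slaterBasis (opDirectSum_sumBasis K hb hb')
    (by rintro (i | i) <;> simp [hp0, hq0]) (by rintro (i | i) <;> simp [hp1, hq1])
    (HasSum.sum (f := Sum.elim p q) hp.hasSum hq.hasSum).summable,
    bernoulliWeight_disjSum hp hq, smul_comm]

end FreeStates

/-! ### Relative entropy in arbitrary eigenbases -/

section RelativeEntropy

variable {E : Type*} [NormedAddCommGroup E] [InnerProductSpace ℂ E]
variable {ι κ : Type*}

/-- The function `d log d - d log g + g - d`. -/
noncomputable def entropyDensity (d g : ℝ) : ℝ := d * Real.log d - d * Real.log g + g - d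

/-- For `d > 0` this is `log x ≤ x - 1` at `x = g / d`. It guarantees that `ENNReal.ofReal`
truncates nothing in the entropy sum. -/
theorem entropyDensity_nonneg {d g : ℝ} (hd : 0 ≤ d) (hg : 0 ≤ g) (h : g = 0 → d = 0) :
    0 ≤ entropyDensity d g := by
  unfold entropyDensity
  rcases hd.eq_or_lt with rfl | hd
  · simpa using hg
  · have hg' : 0 < g := hg.lt_of_ne fun h0 => hd.ne' (h h0.symm)
    have h1 := Real.log_le_sub_one_of_pos (div_pos hg' hd)
    rw [Real.log_div hg'.ne' hd.ne'] at h1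
    have h2 := mul_le_mul_of_nonneg_left h1 hd.le
    rw [mul_sub, mul_sub, mul_div_cancel₀ _ hd.ne', mul_one] at h2
    linarith

/-- Additivity of the logarithm. Correction terms are distributed over the two sides so that no
subtraction remains and the identity can be summed in `[0, ∞]`. -/
theorem entropyDensity_mul {d e g h : ℝ} (hg : g = 0 → d = 0) (hh : h = 0 → e = 0) :
    entropyDensity (d * e) (g * h) + g * e + d * h =
      entropyDensity d g * e + d * entropyDensity e h + g * h + d * e := by
  unfold entropyDensity
  by_cases hd : d = 0
  · simp [hd]
    ring
  by_cases he : e = 0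
  · simp [he]
    ring
  have hg' : g ≠ 0 := fun h0 => hd (hg h0)
  have hh' : h ≠ 0 := fun h0 => he (hh h0)
  rw [Real.log_mul hd he, Real.log_mul hg' hh']
  ring

/-- The relative entropy, computed from two families of eigenvectors and eigenvalues. -/
noncomputable def entropyTsum (b : ι → E) (d : ι → ℝ) (c : κ → E) (g : κ → ℝ) : ENNReal :=
  ∑' j, ∑' k, ENNReal.ofReal (‖(inner ℂ (b j) (c k) : ℂ)‖ ^ 2 * entropyDensity (d j) (g k))

/-- Replace one eigenbasis at a time. With the vector of the other basis fixed, the inner sum is of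
the form treated in `tsum_label`, with eigenvalues as labels. -/
theorem entropyTsum_congr [CompleteSpace E] {ι' κ' : Type*} {D G : E →L[ℂ] E}
    {b : HilbertBasis ι ℂ E} {d : ι → ℝ} (hb : ∀ i, D (b i) = (d i : ℂ) • b i)
    {b' : HilbertBasis ι' ℂ E} {d' : ι' → ℝ} (hb' : ∀ i, D (b' i) = (d' i : ℂ) • b' i)
    {c : HilbertBasis κ ℂ E} {g : κ → ℝ} (hc : ∀ i, G (c i) = (g i : ℂ) • c i)
    {c' : HilbertBasis κ' ℂ E} {g' : κ' → ℝ} (hc' : ∀ i, G (c' i) = (g' i : ℂ) • c' i) :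
    entropyTsum b d c g = entropyTsum b' d' c' g' := by
  have hmul : ∀ (z : ℂ) (x : ℝ), ENNReal.ofReal (‖z‖ ^ 2 * x) =
      ENNReal.ofReal x * ENNReal.ofReal (‖z‖ ^ 2) := fun z x => by
    rw [ENNReal.ofReal_mul (by positivity), mul_comm]
  unfold entropyTsum
  simp_rw [hmul]
  rw [ENNReal.tsum_comm]
  have h1 : ∀ k, ∑' j, ENNReal.ofReal (entropyDensity (d j) (g k)) *
      ENNReal.ofReal (‖(inner ℂ (b j) (c k) : ℂ)‖ ^ 2) =
      ∑' j, ENNReal.ofReal (entropyDensity (d' j) (g k)) *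
      ENNReal.ofReal (‖(inner ℂ (b' j) (c k) : ℂ)‖ ^ 2) := fun k =>
    tsum_label b b' d d' (eigenvalue_eq_of_inner_ne_zero hb hb')
      (fun x => ENNReal.ofReal (entropyDensity x (g k))) (c k)
  rw [tsum_congr h1, ENNReal.tsum_comm]
  refine tsum_congr fun j => ?_
  simp_rw [norm_inner_symm (b' j)]
  exact tsum_label c c' g g' (eigenvalue_eq_of_inner_ne_zero hc hc')
      (fun x => ENNReal.ofReal (entropyDensity (d' j) x)) (b' j)

theorem relEntropy_eq_entropyTsum [CompleteSpace E] {D G : E →L[ℂ] E}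
    (hker : LinearMap.ker G.toLinearMap ≤ LinearMap.ker D.toLinearMap)
    {b : HilbertBasis ι ℂ E} {d : ι → ℝ} (hb : ∀ i, D (b i) = (d i : ℂ) • b i)
    {c : HilbertBasis κ ℂ E} {g : κ → ℝ} (hc : ∀ i, G (c i) = (g i : ℂ) • c i) :
    relEntropy D G = entropyTsum b d c g := by
  rw [relEntropy, dif_pos ⟨hker, ⟨EigenBasis.ofHilbertBasis b d hb⟩,
    ⟨EigenBasis.ofHilbertBasis c g hc⟩⟩]
  exact entropyTsum_congr (EigenBasis.apply_basis _) hb (EigenBasis.apply_basis _) hc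

theorem relEntropy_eq_top {D G : E →L[ℂ] E}
    (hker : ¬ LinearMap.ker G.toLinearMap ≤ LinearMap.ker D.toLinearMap) : relEntropy D G = ⊤ := by
  rw [relEntropy, dif_neg fun h => hker h.1]

theorem tsum_mul_tsum_four {α β γ δ : Type*} (f : α → γ → ENNReal) (h : β → δ → ENNReal) :
    ∑' i, ∑' j, ∑' k, ∑' l, f i k * h j l = (∑' i, ∑' k, f i k) * ∑' j, ∑' l, h j l := by
  simp_rw [ENNReal.tsum_mul_left, ENNReal.tsum_mul_right, ENNReal.tsum_mul_left,
    ENNReal.tsum_mul_right]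

/-- The matrix `|⟨bᵢ, cₖ⟩|²` is doubly stochastic, so only the normalisation of `d` remains. -/
theorem tsum_overlap_left {b : HilbertBasis ι ℂ E} {c : HilbertBasis κ ℂ E} {d : ι → ℝ}
    (hd : ∀ i, 0 ≤ d i) (hs : HasSum d 1) :
    ∑' i, ∑' k, ENNReal.ofReal (‖(inner ℂ (b i) (c k) : ℂ)‖ ^ 2) * ENNReal.ofReal (d i) = 1 := by
  simp_rw [ENNReal.tsum_mul_right, norm_inner_symm (b _), tsum_ofReal_norm_inner_sq, norm_basis]
  simp only [one_pow, ENNReal.ofReal_one, one_mul]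
  rw [← ENNReal.ofReal_tsum_of_nonneg hd hs.summable, hs.tsum_eq, ENNReal.ofReal_one]

theorem tsum_overlap_right {b : HilbertBasis ι ℂ E} {c : HilbertBasis κ ℂ E} {g : κ → ℝ}
    (hg : ∀ i, 0 ≤ g i) (hs : HasSum g 1) :
    ∑' i, ∑' k, ENNReal.ofReal (‖(inner ℂ (b i) (c k) : ℂ)‖ ^ 2) * ENNReal.ofReal (g k) = 1 := by
  rw [ENNReal.tsum_comm]
  simp_rw [norm_inner_symm (b _)]
  exact tsum_overlap_left hg hs

/-- The identity `entropyDensity_mul` weighted by the overlaps `w` and `v`. The implications `g = 0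
→ d = 0` are assumed only for nonzero overlap, which is all that the inclusion of kernels provides.
-/
theorem ofReal_entropyDensity_mul {w v d e g h : ℝ} (hw : 0 ≤ w) (hv : 0 ≤ v) (hd : 0 ≤ d)
    (he : 0 ≤ e) (hg : 0 ≤ g) (hh : 0 ≤ h) (hdg : w ≠ 0 → g = 0 → d = 0)
    (heh : v ≠ 0 → h = 0 → e = 0) :
    ENNReal.ofReal (w * v * entropyDensity (d * e) (g * h)) +
        ENNReal.ofReal w * ENNReal.ofReal g * (ENNReal.ofReal v * ENNReal.ofReal e) +
        ENNReal.ofReal w * ENNReal.ofReal d * (ENNReal.ofReal v * ENNReal.ofReal h) =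
      ENNReal.ofReal (w * entropyDensity d g) * (ENNReal.ofReal v * ENNReal.ofReal e) +
        ENNReal.ofReal w * ENNReal.ofReal d * ENNReal.ofReal (v * entropyDensity e h) +
        ENNReal.ofReal w * ENNReal.ofReal g * (ENNReal.ofReal v * ENNReal.ofReal h) +
        ENNReal.ofReal w * ENNReal.ofReal d * (ENNReal.ofReal v * ENNReal.ofReal e) := by
  by_cases hw0 : w = 0
  · simp [hw0]
  by_cases hv0 : v = 0
  · simp [hv0]
  have h1 := entropyDensity_nonneg hd hg (hdg hw0)
  have h2 := entropyDensity_nonneg he hh (heh hv0)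
  have h3 : 0 ≤ entropyDensity (d * e) (g * h) :=
    entropyDensity_nonneg (mul_nonneg hd he) (mul_nonneg hg hh) fun h0 => by
      rcases mul_eq_zero.mp h0 with h0 | h0
      · rw [hdg hw0 h0, zero_mul]
      · rw [heh hv0 h0, mul_zero]
  have h4 := entropyDensity_mul (hdg hw0) (heh hv0)
  rw [← ENNReal.ofReal_mul hw, ← ENNReal.ofReal_mul hw, ← ENNReal.ofReal_mul hv,
    ← ENNReal.ofReal_mul hv, ← ENNReal.ofReal_mul (by positivity),
    ← ENNReal.ofReal_mul (by positivity), ← ENNReal.ofReal_mul (by positivity),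
    ← ENNReal.ofReal_mul (by positivity), ← ENNReal.ofReal_mul (by positivity),
    ← ENNReal.ofReal_mul (by positivity), ← ENNReal.ofReal_add (by positivity) (by positivity),
    ← ENNReal.ofReal_add (by positivity) (by positivity),
    ← ENNReal.ofReal_add (by positivity) (by positivity),
    ← ENNReal.ofReal_add (by positivity) (by positivity),
    ← ENNReal.ofReal_add (by positivity) (by positivity)]
  congr 1
  linear_combination w * v * h4

theorem eigenvalue_eq_zero_of_ker_le {D G : E →L[ℂ] E}
    (hker : LinearMap.ker G.toLinearMap ≤ LinearMap.ker D.toLinearMap)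
    {b : HilbertBasis ι ℂ E} {d : ι → ℝ} (hb : ∀ i, D (b i) = (d i : ℂ) • b i)
    {c : HilbertBasis κ ℂ E} {g : κ → ℝ} (hc : ∀ i, G (c i) = (g i : ℂ) • c i) (i : ι) (k : κ)
    (hw : ‖(inner ℂ (b i) (c k) : ℂ)‖ ^ 2 ≠ 0) (hg : g k = 0) : d i = 0 := by
  have h1 : D (c k) = 0 := hker (x := c k) (by
    rw [LinearMap.mem_ker, ContinuousLinearMap.coe_coe, hc, hg, Complex.ofReal_zero, zero_smul])
  have h2 := inner_eigenbasis_apply hb i (c k)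
  rw [h1, inner_zero_right] at h2
  have h3 : (inner ℂ (b i) (c k) : ℂ) ≠ 0 := by
    intro h0
    simp [h0] at hw
  exact_mod_cast (mul_eq_zero.mp h2.symm).resolve_right h3

end RelativeEntropy

/-! ### Relative entropy of product operators -/

section ProductEntropy

variable {H : Type*} [NormedAddCommGroup H] [InnerProductSpace ℂ H]
variable {ι κ : Type*} (K : Submodule ℂ H)

theorem norm_fockWedge (φ : Fock K) (χ : Fock Kᗮ) : ‖fockWedge K φ χ‖ = ‖φ‖ * ‖χ‖ := by
  have h := inner_fockWedge K φ φ χ χ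
  rw [inner_self_eq_norm_sq_to_K, inner_self_eq_norm_sq_to_K, inner_self_eq_norm_sq_to_K] at h
  have h2 : ‖fockWedge K φ χ‖ ^ 2 = (‖φ‖ * ‖χ‖) ^ 2 := by
    rw [mul_pow]
    exact_mod_cast h
  exact (sq_eq_sq₀ (norm_nonneg _) (by positivity)).mp h2

variable [CompleteSpace K] {D₁ G₁ : Fock K →L[ℂ] Fock K} {D₂ G₂ : Fock Kᗮ →L[ℂ] Fock Kᗮ}

/-- Expand a kernel vector in the product of eigenbases of `G₁` and `G₂`. Its nonzero coefficients
sit where one of the two eigenvalues is 0, and such product vectors are killed by `D₁ ⊗ D₂`. -/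
theorem ker_fockProd_le (hG₁ : IsDensityOperator G₁) (hG₂ : IsDensityOperator G₂)
    (h₁ : LinearMap.ker G₁.toLinearMap ≤ LinearMap.ker D₁.toLinearMap)
    (h₂ : LinearMap.ker G₂.toLinearMap ≤ LinearMap.ker D₂.toLinearMap) :
    LinearMap.ker (fockProd K G₁ G₂).toLinearMap ≤ LinearMap.ker (fockProd K D₁ D₂).toLinearMap := by
  obtain ⟨b, -, -⟩ := hG₁.exists_eigenbasis
  obtain ⟨c, -, -⟩ := hG₂.exists_eigenbasis
  intro v hv
  rw [LinearMap.mem_ker, ContinuousLinearMap.coe_coe] at hv ⊢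
  refine ((hasSum_basis (wedgeBasis K b.basis c.basis) v).mapL (fockProd K D₁ D₂)).unique ?_
  convert hasSum_zero with q
  have h3 := inner_eigenbasis_apply
    (fockProd_wedgeBasis K b.apply_basis c.apply_basis) q v
  rw [hv, inner_zero_right, Complex.ofReal_mul] at h3
  rw [map_smul, wedgeBasis_apply, fockProd_fockWedge, ← wedgeBasis_apply]
  rcases mul_eq_zero.mp h3.symm with h4 | h4
  · rcases mul_eq_zero.mp h4 with h5 | h5
    · have : D₁ (b.basis q.1) = 0 := h₁ (x := b.basis q.1) (by
        rw [LinearMap.mem_ker, ContinuousLinearMap.coe_coe, b.apply_basis, h5, zero_smul])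
      rw [this, map_zero, zero_apply, smul_zero]
    · have : D₂ (c.basis q.2) = 0 := h₂ (x := c.basis q.2) (by
        rw [LinearMap.mem_ker, ContinuousLinearMap.coe_coe, c.apply_basis, h5, zero_smul])
      rw [this, map_zero, smul_zero]
  · rw [h4, zero_smul]

theorem IsDensityOperator.exists_apply_ne_zero {E : Type*} [NormedAddCommGroup E]
    [InnerProductSpace ℂ E] [CompleteSpace E] {D : E →L[ℂ] E} (hD : IsDensityOperator D) :
    ∃ v, D v ≠ 0 := by
  by_contra! h
  have := hD.trace_eq_one
  simp [posTrace, h] at this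

/-- Pair a vector of `ker G₁` with some `u₂` such that `D₂ u₂ ≠ 0`; the product lies in the kernel
of `G₁ ⊗ G₂`, so the first factor must be killed by `D₁`. The other side is symmetric. -/
theorem ker_le_of_ker_fockProd_le (hD₁ : IsDensityOperator D₁) (hD₂ : IsDensityOperator D₂)
    (h : LinearMap.ker (fockProd K G₁ G₂).toLinearMap ≤
      LinearMap.ker (fockProd K D₁ D₂).toLinearMap) :
    LinearMap.ker G₁.toLinearMap ≤ LinearMap.ker D₁.toLinearMap ∧
      LinearMap.ker G₂.toLinearMap ≤ LinearMap.ker D₂.toLinearMap := by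
  obtain ⟨u₁, hu₁⟩ := hD₁.exists_apply_ne_zero
  obtain ⟨u₂, hu₂⟩ := hD₂.exists_apply_ne_zero
  have key : ∀ φ χ, fockWedge K (G₁ φ) (G₂ χ) = 0 → ‖D₁ φ‖ * ‖D₂ χ‖ = 0 := by
    intro φ χ h0
    rw [← norm_fockWedge, ← fockProd_fockWedge, norm_eq_zero]
    exact h (x := fockWedge K φ χ) (by
      rw [LinearMap.mem_ker, ContinuousLinearMap.coe_coe, fockProd_fockWedge, h0])
  constructor
  · intro v hv
    rw [LinearMap.mem_ker, ContinuousLinearMap.coe_coe] at hv ⊢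
    have := key v u₂ (by rw [hv, map_zero, zero_apply])
    simpa [hu₂] using this
  · intro v hv
    rw [LinearMap.mem_ker, ContinuousLinearMap.coe_coe] at hv ⊢
    have := key u₁ v (by rw [hv, map_zero])
    simpa [hu₁] using this

theorem relEntropy_fockProd [CompleteSpace H] (hD₁ : IsDensityOperator D₁)
    (hD₂ : IsDensityOperator D₂) (hG₁ : IsDensityOperator G₁) (hG₂ : IsDensityOperator G₂) :
    relEntropy (fockProd K D₁ D₂) (fockProd K G₁ G₂) = relEntropy D₁ G₁ + relEntropy D₂ G₂ := by
  by_cases hker : LinearMap.ker (fockProd K G₁ G₂).toLinearMap ≤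
      LinearMap.ker (fockProd K D₁ D₂).toLinearMap
  swap
  -- If both inclusions held for the factors, so would the one for the product. Hence one summand on
  -- the right is infinite.
  · rw [relEntropy_eq_top hker]
    by_cases h₁ : LinearMap.ker G₁.toLinearMap ≤ LinearMap.ker D₁.toLinearMap
    · rw [relEntropy_eq_top (D := D₂) fun h₂ => hker (ker_fockProd_le K hG₁ hG₂ h₁ h₂), add_top]
    · rw [relEntropy_eq_top h₁, top_add]
  obtain ⟨h₁, h₂⟩ := ker_le_of_ker_fockProd_le K hD₁ hD₂ hker
  obtain ⟨b₁, hb₁, hs₁⟩ := hD₁.exists_eigenbasis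
  obtain ⟨b₂, hb₂, hs₂⟩ := hD₂.exists_eigenbasis
  obtain ⟨c₁, hc₁, ht₁⟩ := hG₁.exists_eigenbasis
  obtain ⟨c₂, hc₂, ht₂⟩ := hG₂.exists_eigenbasis
  rw [relEntropy_eq_entropyTsum hker (fockProd_wedgeBasis K b₁.apply_basis b₂.apply_basis)
      (fockProd_wedgeBasis K c₁.apply_basis c₂.apply_basis),
    relEntropy_eq_entropyTsum h₁ b₁.apply_basis c₁.apply_basis,
    relEntropy_eq_entropyTsum h₂ b₂.apply_basis c₂.apply_basis]
  have hpt := fun i j k l => ofReal_entropyDensity_mul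
    (sq_nonneg ‖(inner ℂ (b₁.basis i) (c₁.basis k) : ℂ)‖)
    (sq_nonneg ‖(inner ℂ (b₂.basis j) (c₂.basis l) : ℂ)‖) (hb₁ i) (hb₂ j) (hc₁ k) (hc₂ l)
    (eigenvalue_eq_zero_of_ker_le h₁ b₁.apply_basis c₁.apply_basis i k)
    (eigenvalue_eq_zero_of_ker_le h₂ b₂.apply_basis c₂.apply_basis j l)
  have hsum := congrArg (fun F : _ → _ → _ → _ → ENNReal => ∑' i, ∑' j, ∑' k, ∑' l, F i j k l)
    (funext fun i => funext fun j => funext fun k => funext fun l => hpt i j k l)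
  simp only [ENNReal.tsum_add, tsum_mul_tsum_four] at hsum
  simp only [tsum_overlap_left hb₁ hs₁, tsum_overlap_left hb₂ hs₂, tsum_overlap_right hc₁ ht₁,
    tsum_overlap_right hc₂ ht₂, mul_one, one_mul] at hsum
  have hT : entropyTsum (wedgeBasis K b₁.basis b₂.basis)
      (fun q => b₁.eigenvalue q.1 * b₂.eigenvalue q.2) (wedgeBasis K c₁.basis c₂.basis)
      (fun q => c₁.eigenvalue q.1 * c₂.eigenvalue q.2) =
      ∑' i, ∑' j, ∑' k, ∑' l, ENNReal.ofReal (‖(inner ℂ (b₁.basis i) (c₁.basis k) : ℂ)‖ ^ 2 *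
        ‖(inner ℂ (b₂.basis j) (c₂.basis l) : ℂ)‖ ^ 2 * entropyDensity
          (b₁.eigenvalue i * b₂.eigenvalue j) (c₁.eigenvalue k * c₂.eigenvalue l)) := by
    unfold entropyTsum
    rw [ENNReal.tsum_prod']
    refine tsum_congr fun i => tsum_congr fun j => ?_
    rw [ENNReal.tsum_prod']
    refine tsum_congr fun k => tsum_congr fun l => ?_
    rw [wedgeBasis_apply, wedgeBasis_apply, inner_fockWedge, norm_mul, mul_pow]
  rw [hT]
  -- The correction terms contribute `1 + 1` on each side; being finite, they can be cancelled in
  -- `[0, ∞]`.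
  rw [add_assoc, add_assoc _ (1 : ENNReal) 1] at hsum
  exact (ENNReal.add_left_inj (by norm_num)).mp hsum

end ProductEntropy

/-! ### Additivity of nonfreeness -/

section Main

variable {H : Type*} [NormedAddCommGroup H] [InnerProductSpace ℂ H] [CompleteSpace H]
  (K : Submodule ℂ H) [CompleteSpace K]
  {Δ₁ : Fock K →L[ℂ] Fock K} {Δ₂ : Fock Kᗮ →L[ℂ] Fock Kᗮ}

theorem ClassD.freeState_opDirectSum (h₁ : ClassD Δ₁) (h₂ : ClassD Δ₂) :
    freeState (opDirectSum K (oneParticleOp Δ₁) (oneParticleOp Δ₂)) =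
      Nonfreeness.fockProd K (freeState (oneParticleOp Δ₁)) (freeState (oneParticleOp Δ₂)) := by
  obtain ⟨b⟩ := h₁.exists_eigenbasis_oneParticleOp
  obtain ⟨c⟩ := h₂.exists_eigenbasis_oneParticleOp
  obtain ⟨hp0, hp1, hp⟩ := h₁.eigenvalue_oneParticleOp b.apply_basis
  obtain ⟨hq0, hq1, hq⟩ := h₂.eigenvalue_oneParticleOp c.apply_basis
  exact Nonfreeness.freeState_opDirectSum K b.apply_basis c.apply_basis hp0 hp1 hp hq0 hq1 hq

theorem nonfreeness_fockProd (h₁ : ClassD Δ₁) (h₂ : ClassD Δ₂) :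
    nonfreeness (fockProd K Δ₁ Δ₂) = nonfreeness Δ₁ + nonfreeness Δ₂ := by
  rw [nonfreeness, oneParticleOp_fockProd K h₁ h₂, h₁.freeState_opDirectSum K h₂]
  exact relEntropy_fockProd K h₁.isDensityOperator h₂.isDensityOperator
    h₁.isDensityOperator_freeState h₂.isDensityOperator_freeState

end Main

end Nonfreeness

theorem mainTheorem7 {H : Type*} [NormedAddCommGroup H] [InnerProductSpace ℂ H] [CompleteSpace H]
    (H₁ : Submodule ℂ H) [CompleteSpace H₁]
    (Δ₁ : Nonfreeness.Fock H₁ →L[ℂ] Nonfreeness.Fock H₁)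
    (Δ₂ : Nonfreeness.Fock H₁ᗮ →L[ℂ] Nonfreeness.Fock H₁ᗮ)
    (hΔ₁ : Nonfreeness.ClassD Δ₁) (hΔ₂ : Nonfreeness.ClassD Δ₂) :
    Nonfreeness.ClassD (Nonfreeness.fockProd H₁ Δ₁ Δ₂) ∧
    Nonfreeness.freeState (Nonfreeness.opDirectSum H₁ (Nonfreeness.oneParticleOp Δ₁)
        (Nonfreeness.oneParticleOp Δ₂)) =
      Nonfreeness.fockProd H₁ (Nonfreeness.freeState (Nonfreeness.oneParticleOp Δ₁))
        (Nonfreeness.freeState (Nonfreeness.oneParticleOp Δ₂)) ∧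
    Nonfreeness.nonfreeness (Nonfreeness.fockProd H₁ Δ₁ Δ₂) =
      Nonfreeness.nonfreeness Δ₁ + Nonfreeness.nonfreeness Δ₂ :=
  ⟨hΔ₁.fockProd H₁ hΔ₂, hΔ₁.freeState_opDirectSum H₁ hΔ₂,
    Nonfreeness.nonfreeness_fockProd H₁ hΔ₁ hΔ₂⟩
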